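/- Let $m\ge 3$ and $k\ge 1$ be integers. Let $\mathcal{H}_k$ be the space of real homogeneous harmonic polynomials of degree $k$ on $\mathbb{R}^m$, $\mathbb{B}^m$ the open unit ball, $dS$ the surface measure on the unit sphere $\mathbb{S}^{m-1}$ and $\omega_m$ its total mass. Write $x=(x',y)$ with $x'\in\mathbb{R}^{m-1}$, and $\mathbb{R}^m_+=\{x: y>0\}$. The bosonic Laplacian acts on functions of $(x,u)$ by $$\mathcal{D}_k=\Delta_x-\frac{4\langle u,D_x\rangle\langle D_u,D_x\rangle}{m+2k-2}+\frac{4|u|^2\langle D_u,D_x\rangle^2}{(m+2k-2)(m+2k-4)},\qquad \langle u,D_x\rangle=\sum_j u_j\partial_{x_j},\quad \langle D_u,D_x\rangle=\sum_j\partial_{u_j}\partial_{x_j}.$$ Let $Z_k(u,v)$ be the reproducing kernel of $\mathcal{H}_k$: $Z_k(\cdot,v)\in\mathcal{H}_k$ and $p(v)=\int_{\mathbb{S}^{m-1}}Z_k(u,v)p(u)\,dS(u)$ for all $p\in\mathcal{H}_k$. For $z\neq 0$ put $zuz/|z|^2=u-2\frac{\langle u,z\rangle}{|z|^2}z$ (the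 Clifford product with $e_ie_j+e_je_i=-2\delta_{ij}$), and for $x\in\mathbb{R}^m_+$, $t=(t',0)$, let $$P_H(x,t,u,v)=c_{m,k}\,\frac{y}{|x-t|^m}\,Z_k\Big(\frac{(x-t)u(x-t)}{|x-t|^2},v\Big),\qquad c_{m,k}=\frac{2(m+2k-2)}{(m-2)\,\omega_m},$$ $$P_H[f](x,v)=\int_{\mathbb{R}^{m-1}}\int_{\mathbb{S}^{m-1}}P_H(x,t,u,v)f(t',u)\,dS(u)\,dt'.$$ There is a constant $a_{m,k}>0$, depending only on $m$ and $k$, such that the following holds. Let $f$ be a continuous function on $\mathbb{R}^{m-1}\times\mathbb{B}^m$, with $f\in L^\infty(\mathbb{R}^{m-1}\times\mathbb{B}^m)$ and $f(x',\cdot)\in\mathcal{H}_k$ for every $x'$ (so that $f(x',\cdot)$ extends to a polynomial on $\mathbb{R}^m$). Then the integral defining $P_H[f](x,v)$ converges absolutely for all $x\in\mathbb{R}^m_+$, $v\in\mathbb{B}^m$, and the function $g$ on $\overline{\mathbb{R}^m_+}\times\mathbb{B}^m$ given by $g(x,v)=P_H[f](x,v)$ for $x\in\mathbb{R}^m_+$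 and $g((x',0),v)=f(x',v)$ has these properties: 1. for every $v\in\mathbb{B}^m$, $x\mapsto g(x,v)$ is continuous on $\overline{\mathbb{R}^m_+}$; 2. $g$ is $C^\infty$ on $\mathbb{R}^m_+\times\mathbb{B}^m$, $g(x,\cdot)\in\mathcal{H}_k$ for every $x\in\mathbb{R}^m_+$, and $\mathcal{D}_k g=0$ in $\mathbb{R}^m_+\times\mathbb{B}^m$; 3. $g\in L^\infty(\mathbb{R}^m_+\times\mathbb{B}^m)$ and $\|g\|_{L^\infty(\mathbb{R}^m_+\times\mathbb{B}^m)}\le a_{m,k}\,\|f\|_{L^\infty(\mathbb{R}^{m-1}\times\mathbb{B}^m)}$. -/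

import Mathlib

open MeasureTheory Set Metric
open scoped ContDiff ENNReal

noncomputable section

namespace Bosonic

/-- The Euclidean space `ℝ^m`. -/
abbrev Euc (m : ℕ) : Type := EuclideanSpace ℝ (Fin m)

/-- The space `𝓗_k` of real homogeneous harmonic polynomials of degree `k` in `m` variables. -/
def harmonicPoly (m k : ℕ) : Submodule ℝ (MvPolynomial (Fin m) ℝ) :=
  MvPolynomial.homogeneousSubmodule (Fin m) ℝ k ⊓
    LinearMap.ker (∑ i : Fin m,
      (MvPolynomial.pderiv i).toLinearMap ∘ₗ
        ((MvPolynomial.pderiv i).toLinearMap :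
          MvPolynomial (Fin m) ℝ →ₗ[ℝ] MvPolynomial (Fin m) ℝ))

/-- Evaluation of a member of `𝓗_k` at a point of `ℝ^m`, linear in the polynomial. -/
def evalAt {m k : ℕ} (u : Euc m) : harmonicPoly m k →ₗ[ℝ] ℝ :=
  (MvPolynomial.aeval (R := ℝ) (fun i => u i)).toLinearMap ∘ₗ (harmonicPoly m k).subtype

theorem evalAt_apply {m k : ℕ} (u : Euc m) (p : harmonicPoly m k) :
    evalAt u p = MvPolynomial.eval (fun i => u i) (p : MvPolynomial (Fin m) ℝ) := by
  simp [evalAt]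

/-- A polynomial lies in `𝓗_k` iff it is homogeneous of degree `k` with vanishing Laplacian. -/
theorem mem_harmonicPoly {m k : ℕ} (p : MvPolynomial (Fin m) ℝ) :
    p ∈ harmonicPoly m k ↔ p.IsHomogeneous k ∧
      ∑ i, MvPolynomial.pderiv i (MvPolynomial.pderiv i p) = 0 := by
  simp [harmonicPoly, MvPolynomial.mem_homogeneousSubmodule, LinearMap.sum_apply]

/-- The unit sphere `𝕊^{m-1}` of `ℝ^m`. -/
abbrev USphere (m : ℕ) : Type := sphere (0 : Euc m) 1

/-- The (unnormalised) surface measure `dS` on the unit sphere of `ℝ^m`. -/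
def surf (m : ℕ) : Measure (USphere m) := (volume : Measure (Euc m)).toSphere

instance (m : ℕ) : IsFiniteMeasure (surf m) := by unfold surf; infer_instance

instance (m : ℕ) : (surf m).IsOpenPosMeasure := by unfold surf; infer_instance

/-- `ω_m`, the surface area of the unit sphere of `ℝ^m`. -/
def sphereArea (m : ℕ) : ℝ := (surf m).real univ

theorem continuous_evalAt {m k : ℕ} (p : harmonicPoly m k) :
    Continuous fun u : Euc m => evalAt u p := by
  simp only [evalAt_apply]
  exact (MvPolynomial.continuous_eval _).comp (by fun_prop)

theorem integrable_evalAt_mul {m k : ℕ} (p q : harmonicPoly m k) :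
    Integrable (fun u : USphere m => evalAt (u : Euc m) p * evalAt (u : Euc m) q) (surf m) := by
  have h : Continuous fun u : USphere m => evalAt (u : Euc m) p * evalAt (u : Euc m) q :=
    ((continuous_evalAt p).comp continuous_subtype_val).mul
      ((continuous_evalAt q).comp continuous_subtype_val)
  exact h.integrable_of_hasCompactSupport (HasCompactSupport.of_compactSpace _)

/-- The `L²(𝕊^{m-1}, dS)` inner product on `𝓗_k`. -/
def sphereForm (m k : ℕ) : LinearMap.BilinForm ℝ (harmonicPoly m k) :=
  LinearMap.mk₂ ℝ (fun p q => ∫ u, evalAt (u : Euc m) p * evalAt (u : Euc m) q ∂(surf m))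
    (fun p p' q => by
      simp only [map_add, add_mul]
      exact integral_add (integrable_evalAt_mul p q) (integrable_evalAt_mul p' q))
    (fun c p q => by
      simp only [map_smul, smul_eq_mul, mul_assoc]
      exact integral_const_mul _ _)
    (fun p q q' => by
      simp only [map_add, mul_add]
      exact integral_add (integrable_evalAt_mul p q) (integrable_evalAt_mul p q'))
    (fun c p q => by
      simp only [map_smul, smul_eq_mul, mul_left_comm]
      exact integral_const_mul _ _)

theorem sphereForm_apply {m k : ℕ} (p q : harmonicPoly m k) :
    sphereForm m k p q = ∫ u, evalAt (u : Euc m) p * evalAt (u : Euc m) q ∂(surf m) := rfl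

instance (m k : ℕ) : FiniteDimensional ℝ (harmonicPoly m k) := by
  have : FiniteDimensional ℝ (MvPolynomial.homogeneousSubmodule (Fin m) ℝ k) :=
    Module.Finite.iff_fg.2 (MvPolynomial.homogeneousSubmodule_fg (σ := Fin m) (R := ℝ) k)
  exact Submodule.finiteDimensional_of_le (inf_le_left : harmonicPoly m k ≤ _)

theorem sphereForm_self {m k : ℕ} [NeZero m] (p : harmonicPoly m k)
    (h : sphereForm m k p p = 0) : p = 0 := by
  have hc : Continuous fun u : USphere m => evalAt (u : Euc m) p :=
    (continuous_evalAt p).comp continuous_subtype_val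
  have h0 : ∀ u : USphere m, evalAt (u : Euc m) p = 0 := by
    by_contra hne
    push Not at hne
    obtain ⟨u, hu⟩ := hne
    have := integral_pos_of_integrable_nonneg_nonzero (μ := surf m) (x := u) (hc.mul hc)
      (integrable_evalAt_mul p p) (fun v => mul_self_nonneg _) (mul_ne_zero hu hu)
    rw [sphereForm_apply] at h
    exact this.ne' h
  have hom : (p : MvPolynomial (Fin m) ℝ).IsHomogeneous k := ((mem_harmonicPoly _).1 p.2).1
  apply Subtype.ext
  refine MvPolynomial.funext_set (fun _ => ({0}ᶜ : Set ℝ))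
    (fun _ => (Set.finite_singleton (0 : ℝ)).infinite_compl) ?_
  intro x hx
  have hx0 : (WithLp.toLp 2 x : Euc m) ≠ 0 := by
    intro hz
    have : x 0 = 0 := congrArg (fun w : Euc m => w 0) hz
    exact hx 0 (mem_univ _) this
  set w : Euc m := WithLp.toLp 2 x with hw
  have hn : ‖w‖ ≠ 0 := norm_ne_zero_iff.2 hx0
  have hs : (‖w‖⁻¹ • w) ∈ sphere (0 : Euc m) 1 := by
    simp [norm_smul, hn]
  have h1 := h0 ⟨_, hs⟩
  rw [evalAt_apply] at h1
  have h3 : MvPolynomial.eval (‖w‖⁻¹ • x) (p : MvPolynomial (Fin m) ℝ)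
      = ‖w‖⁻¹ ^ k * MvPolynomial.eval x (p : MvPolynomial (Fin m) ℝ) := by
    rw [MvPolynomial.eval_eq, MvPolynomial.eval_eq, Finset.mul_sum]
    refine Finset.sum_congr rfl fun d hd => ?_
    have hd' : ∑ i, d i = k := by
      have := hom (MvPolynomial.mem_support_iff.1 hd)
      rw [← this, Pi.one_def, ← Finsupp.degree_eq_weight_one, Finsupp.degree_eq_sum]
    have hk' : ‖w‖⁻¹ ^ k = ∏ i, ‖w‖⁻¹ ^ d i := by
      rw [Finset.prod_pow_eq_pow_sum, hd']
    rw [hk']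
    simp only [Pi.smul_apply, smul_eq_mul, mul_pow, Finset.prod_mul_distrib]
    have : ∀ g : Fin m → ℝ, ∏ i ∈ d.support, g i ^ d i = ∏ i, g i ^ d i := fun g =>
      Finset.prod_subset (Finset.subset_univ _) fun i _ hi => by
        simp [Finsupp.notMem_support_iff.1 hi]
    rw [this fun _ => ‖w‖⁻¹, this x]
    ring
  have h4 : (fun i => ((‖w‖⁻¹ • w : Euc m)) i) = ‖w‖⁻¹ • x := by
    ext i; simp [hw]
  rw [h4, h3] at h1
  simpa [hn] using h1

theorem sphereForm_nondegenerate (m k : ℕ) [NeZero m] : (sphereForm m k).Nondegenerate :=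
  ⟨fun p hp => sphereForm_self p (hp p), fun p hp => sphereForm_self p (hp p)⟩

/-- `zonalPoly m k v` is the member `Z_k(·, v)` of `𝓗_k` that represents evaluation at `v` for the
`L²(𝕊^{m-1}, dS)` inner product. -/
def zonalPoly (m k : ℕ) [NeZero m] (v : Euc m) : harmonicPoly m k :=
  ((sphereForm m k).toDual (sphereForm_nondegenerate m k)).symm (evalAt v)

/-- The reproducing kernel `Z_k(u, v)` of the spherical harmonics of degree `k`. -/
def zonal (m k : ℕ) [NeZero m] (u v : Euc m) : ℝ := evalAt u (zonalPoly m k v)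

/-- The reproducing property `f(v) = ∫ Z_k(u, v) f(u) dS(u)`, for every `f ∈ 𝓗_k`. -/
theorem zonal_reproducing {m k : ℕ} [NeZero m] (v : Euc m) (p : harmonicPoly m k) :
    ∫ u, zonal m k (u : Euc m) v * evalAt (u : Euc m) p ∂(surf m) = evalAt v p :=
  LinearMap.BilinForm.apply_toDual_symm_apply (hB := sphereForm_nondegenerate m k) (evalAt v) p

/-- The reproducing property determines `Z_k(·, v)` in `𝓗_k`. -/
theorem zonalPoly_unique {m k : ℕ} [NeZero m] (v : Euc m) (q : harmonicPoly m k)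
    (h : ∀ p : harmonicPoly m k,
      ∫ u, evalAt (u : Euc m) q * evalAt (u : Euc m) p ∂(surf m) = evalAt v p) :
    q = zonalPoly m k v := by
  rw [zonalPoly, LinearEquiv.eq_symm_apply]
  ext p
  exact h p

/-- The vector `x u x / |x|²` (Clifford product), that is, the reflection of `u` in the hyperplane
orthogonal to `x`. -/
def reflect {m : ℕ} (x u : Euc m) : Euc m := u - (2 * inner ℝ u x / ‖x‖ ^ 2) • x

/-- The quadratic form `x ↦ -|x|²`, whose Clifford algebra is `𝒞l_m`. -/
def cliffordForm (m : ℕ) : QuadraticForm ℝ (Euc m) :=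
  -(LinearMap.BilinMap.toQuadraticMap (innerₗ (Euc m)))

/-- In `𝒞l_m`, the product `x u x` is the vector `|x|² reflect x u`. -/
theorem clifford_sandwich {m : ℕ} (x u : Euc m) (hx : x ≠ 0) :
    CliffordAlgebra.ι (cliffordForm m) x * CliffordAlgebra.ι (cliffordForm m) u *
      CliffordAlgebra.ι (cliffordForm m) x =
      CliffordAlgebra.ι (cliffordForm m) (‖x‖ ^ 2 • reflect x u) := by
  rw [CliffordAlgebra.ι_mul_ι_mul_ι]
  congr 1
  have hn : ‖x‖ ^ 2 ≠ 0 := by positivity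
  have h1 : QuadraticMap.polar (cliffordForm m) x u = -(2 * inner ℝ u x) := by
    simp [cliffordForm, QuadraticMap.polar, inner_add_right,
      real_inner_comm x u]
    ring
  have h2 : cliffordForm m x = -‖x‖ ^ 2 := by
    simp [cliffordForm]
  rw [h1, h2, reflect, smul_sub, smul_smul, mul_div_cancel₀ _ hn]
  module

/-- The constant `c_{m,k} = 2(m+2k-2) / ((m-2) ω_m)`. -/
def poissonConst (m k : ℕ) : ℝ :=
  2 * ((m : ℝ) + 2 * k - 2) / (((m : ℝ) - 2) * sphereArea m)

/-- The embedding `t' ↦ (t', 0)` of `ℝ^{m-1}` in `ℝ^m`, with `m = n + 1`. -/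
def bdry {n : ℕ} (t : Euc n) : Euc (n + 1) :=
  WithLp.toLp 2 (Fin.snoc (α := fun _ => ℝ) (fun i => t i) 0)

/-- The projection `x = (x', y) ↦ x'`. -/
def tang {n : ℕ} (x : Euc (n + 1)) : Euc n := WithLp.toLp 2 fun i => x i.castSucc

/-- The last coordinate `y` of `x = (x', y)`. -/
def height {n : ℕ} (x : Euc (n + 1)) : ℝ := x (Fin.last n)

/-- The open upper half-space `ℝ^m_+`, with `m = n + 1`. -/
def upperHalf (n : ℕ) : Set (Euc (n + 1)) := {x | 0 < height x}

/-- The closed upper half-space. -/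
def closedUpperHalf (n : ℕ) : Set (Euc (n + 1)) := {x | 0 ≤ height x}

/-- The Poisson kernel `P_H(x, t, u, v)` of the upper half-space, with `t = (t', 0)`. -/
def poissonKernel (n k : ℕ) (x : Euc (n + 1)) (t : Euc n) (u v : Euc (n + 1)) : ℝ :=
  poissonConst (n + 1) k * (height x / ‖x - bdry t‖ ^ (n + 1)) *
    zonal (n + 1) k (reflect (x - bdry t) u) v

/-- The Poisson integral `P_H[f](x, v)` of an `𝓗_k`-valued function `f` on `ℝ^{m-1}`. -/
def poissonIntegral {n k : ℕ} (f : Euc n → harmonicPoly (n + 1) k) (x v : Euc (n + 1)) : ℝ :=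
  ∫ t : Euc n, ∫ u : USphere (n + 1),
    poissonKernel n k x t (u : Euc (n + 1)) v * evalAt (u : Euc (n + 1)) (f t) ∂(surf (n + 1))

open Classical in
/-- The function equal to `P_H[f]` over the open half-space and to `f` over its boundary (only
its values over the closed half-space matter). -/
def dirichletExt {n k : ℕ} (f : Euc n → harmonicPoly (n + 1) k) (x v : Euc (n + 1)) : ℝ :=
  if x ∈ upperHalf n then poissonIntegral f x v else evalAt v (f (tang x))

/-- The partial derivative `∂_{x_i}` of `F(x, u)`. -/
def dX {m : ℕ} (i : Fin m) (F : Euc m → Euc m → ℝ) (x u : Euc m) : ℝ :=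
  fderiv ℝ (fun z => F z u) x (EuclideanSpace.single i 1)

/-- The partial derivative `∂_{u_i}` of `F(x, u)`. -/
def dU {m : ℕ} (i : Fin m) (F : Euc m → Euc m → ℝ) (x u : Euc m) : ℝ :=
  fderiv ℝ (fun w => F x w) u (EuclideanSpace.single i 1)

/-- The operator `⟨u, D_x⟩ = ∑ u_i ∂_{x_i}`. -/
def uDx {m : ℕ} (F : Euc m → Euc m → ℝ) (x u : Euc m) : ℝ := ∑ i, u i * dX i F x u

/-- The operator `⟨D_u, D_x⟩ = ∑ ∂_{u_i} ∂_{x_i}`. -/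
def duDx {m : ℕ} (F : Euc m → Euc m → ℝ) (x u : Euc m) : ℝ := ∑ i, dU i (dX i F) x u

/-- The bosonic Laplacian `𝓓_k` on `ℝ^m`. -/
def bosonicLaplacian {m : ℕ} (k : ℕ) (F : Euc m → Euc m → ℝ) (x u : Euc m) : ℝ :=
  Laplacian.laplacian (fun z => F z u) x
    - 4 * uDx (duDx F) x u / ((m : ℝ) + 2 * k - 2)
    + 4 * ‖u‖ ^ 2 * duDx (duDx F) x u / (((m : ℝ) + 2 * k - 2) * ((m : ℝ) + 2 * k - 4))

end Bosonic

end

/-! For fixed `z` the map `u ↦ reflect z u` is orthogonal, so it preserves both `𝓗_k` and the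
surface measure. Changing variables on the sphere and using the reproducing property therefore
removes the zonal kernel (`integral_zonal_reflect`). With `m = n + 1`, the Poisson integral becomes
the constant times `∫ y |x - t|^{-m} f(t, reflect (x - t) v) dt`. Three facts about the kernel `y
|z|^{-m} q(reflect z v)` with `q ∈ 𝓗_k`, where `y` is the last coordinate of `z`, then carry the
theorem.

It is a null solution away from the origin (`bosonicLaplacian_kernelFun`). The three terms of `𝓓_k`
are computed explicitly with Euler's identity and `Δq = 0`, and they cancel.

It is normalised (`integral_poisson_const`): for boundary data independent of `t` the Poisson
integral returns the data. The polynomial `|z|^{2k} q(reflect z v)` is integrated against a Gaussian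
on `ℝ^m` in two ways. The divergence theorem gives a recursion in `k`, hence a product times `q(v)`.
The slicing `z = y (t, 1)` gives a Gamma factor times the hyperplane integral.

It is homogeneous of degree `-n` in `z`, and each derivative lowers the degree by one. All
derivatives are thus integrable over the boundary, locally uniformly in `x`, and one may
differentiate under the integral (`contDiffOn_bdryConv`). Since `𝓓_k` also differentiates in `v`, a
finite interpolation formula on `𝓗_k` (`exists_interpolation`) separates the variables: on `∑ φ_s(x)
P_s(v)` the operator acts through continuous linear functionals of the Hessians of the `φ_s`, which
commute with the integral.

For the boundary behaviour, the substitution `t = x' - y τ` turns the Poisson integral into `∫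
|(τ,1)|^{-m} f(x' - y τ, reflect (τ,1) v) dτ` times the constant. This makes sense and is continuous
in `x` down to `y = 0`, where normalisation gives `f(x', v)`. The same formula gives the sup bound,
because reflections preserve the ball. -/

noncomputable section

namespace Bosonic

/-! ### Solid harmonics, and the invariance of `𝓗_k` and of the surface measure under reflections.
-/

section

/-- The directional derivative of `q` in the direction `a`. -/
def dirD {m : ℕ} (a : Euc m) (q : Euc m → ℝ) (w : Euc m) : ℝ := fderiv ℝ q w a

/-- The standard basis vectors. -/
abbrev stdv {m : ℕ} (i : Fin m) : Euc m := EuclideanSpace.single i 1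

theorem ContDiff.dirD' {m : ℕ} {q : Euc m → ℝ} (hq : ContDiff ℝ ∞ q) (a : Euc m) :
    ContDiff ℝ ∞ (dirD a q) :=
  (hq.fderiv_right (m := ∞) (by simp)).clm_apply contDiff_const

theorem dirD_comm {m : ℕ} {q : Euc m → ℝ} (hq : ContDiff ℝ ∞ q) (a b : Euc m) :
    dirD a (dirD b q) = dirD b (dirD a q) := by
  have hd : Differentiable ℝ (fderiv ℝ q) :=
    (hq.fderiv_right (m := ∞) (by simp)).differentiable (by simp)
  have key : ∀ a b w, dirD a (dirD b q) w = fderiv ℝ (fderiv ℝ q) w a b := by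
    intro a b w
    have := ((hd w).hasFDerivAt.clm_apply (hasFDerivAt_const b w)).fderiv
    unfold dirD
    rw [this]; simp
  ext w
  rw [key, key]
  exact (hq.contDiffAt.isSymmSndFDerivAt (by simp; norm_cast)).eq a b

theorem dirD_dirD {m : ℕ} {q : Euc m → ℝ} (hq : ContDiff ℝ ∞ q) (a b w : Euc m) :
    dirD a (dirD b q) w = fderiv ℝ (fderiv ℝ q) w a b := by
  have hd : Differentiable ℝ (fderiv ℝ q) :=
    (hq.fderiv_right (m := ∞) (by simp)).differentiable (by simp)
  have := ((hd w).hasFDerivAt.clm_apply (hasFDerivAt_const b w)).fderiv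
  unfold dirD
  rw [this]; simp

/-- Smooth solid spherical harmonics of degree `l`. -/
structure Solid {m : ℕ} (l : ℝ) (q : Euc m → ℝ) : Prop where
  smooth : ContDiff ℝ ∞ q
  euler : ∀ w, fderiv ℝ q w w = l * q w
  harm : ∀ w, ∑ i, dirD (stdv i) (dirD (stdv i) q) w = 0

/-- Constant-coefficient derivatives commute with the Laplacian, and differentiating Euler's
identity lowers the degree by one. The degree is a real number, so `l - 1` is not truncated. -/
theorem Solid.dirD {m : ℕ} {l : ℝ} {q : Euc m → ℝ} (h : Solid l q) (a : Euc m) :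
    Solid (l - 1) (dirD a q) where
  smooth := ContDiff.dirD' h.smooth a
  euler w := by
    have hq := h.smooth
    have hd : Differentiable ℝ (fderiv ℝ q) :=
      (hq.fderiv_right (m := ∞) (by simp)).differentiable (by simp)
    have hdq : Differentiable ℝ q := hq.differentiable (by simp)
    have h1 := ((hd w).hasFDerivAt.clm_apply (hasFDerivAt_id w))
    have h2 : HasFDerivAt (fun w => fderiv ℝ q w w) (l • fderiv ℝ q w) w := by
      have : (fun w => fderiv ℝ q w w) = fun w => l * q w := funext h.euler
      rw [this]
      exact (hdq w).hasFDerivAt.const_mul l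
    have h3 := congrArg (fun T => T a) (h1.unique h2)
    have h4 := dirD_dirD hq w a w
    have h5 := (hq.contDiffAt (x := w)).isSymmSndFDerivAt (by simp; norm_cast) |>.eq a w
    simp at h3
    have : fderiv ℝ (Bosonic.dirD a q) w w = Bosonic.dirD w (Bosonic.dirD a q) w := rfl
    rw [this, h4, ← h5]
    unfold Bosonic.dirD
    linarith
  harm w := by
    have hq := h.smooth
    have h0 : ∀ i, Bosonic.dirD (stdv i) (Bosonic.dirD (stdv i) (Bosonic.dirD a q)) =
        Bosonic.dirD a (Bosonic.dirD (stdv i) (Bosonic.dirD (stdv i) q)) := fun i => by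
      rw [dirD_comm hq (stdv i) a, dirD_comm (ContDiff.dirD' hq _) (stdv i) a]
    simp only [h0]
    have h1 : HasFDerivAt (fun w => ∑ i, Bosonic.dirD (stdv i) (Bosonic.dirD (stdv i) q) w)
        (∑ i, fderiv ℝ (Bosonic.dirD (stdv i) (Bosonic.dirD (stdv i) q)) w) w :=
      HasFDerivAt.fun_sum fun i _ =>
        ((ContDiff.dirD' (ContDiff.dirD' hq _) _).differentiable (by simp) w).hasFDerivAt
    have h2 : (fun w => ∑ i, Bosonic.dirD (stdv i) (Bosonic.dirD (stdv i) q) w) = fun _ => 0 :=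
      funext h.harm
    rw [h2] at h1
    have h3 := congrArg (fun T => T a) (h1.unique (hasFDerivAt_const 0 w))
    simpa [Bosonic.dirD] using h3

/-- Evaluation of a polynomial on `Euc m`. -/
def polyFun {m : ℕ} (p : MvPolynomial (Fin m) ℝ) (w : Euc m) : ℝ :=
  MvPolynomial.eval (fun i => w i) p

theorem polyFun_hasFDerivAt {m : ℕ} (p : MvPolynomial (Fin m) ℝ) (w : Euc m) :
    HasFDerivAt (polyFun p)
      (∑ i, polyFun (MvPolynomial.pderiv i p) w • EuclideanSpace.proj (𝕜 := ℝ) i) w := by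
  induction p using MvPolynomial.induction_on with
  | C a =>
    have : polyFun (MvPolynomial.C a) = fun _ : Euc m => a := by ext; simp [polyFun]
    rw [this]
    simpa [polyFun] using hasFDerivAt_const a w
  | add p q hp hq =>
    have : polyFun (p + q) = fun w : Euc m => polyFun p w + polyFun q w := by ext; simp [polyFun]
    rw [this]
    refine (hp.add hq).congr_fderiv ?_
    ext a
    simp [polyFun, add_mul, Finset.sum_add_distrib]
  | mul_X p j hp =>
    have : polyFun (p * MvPolynomial.X j) = fun w : Euc m => polyFun p w * w j := by
      ext; simp [polyFun]
    rw [this]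
    have hj : HasFDerivAt (fun w : Euc m => w j) (EuclideanSpace.proj (𝕜 := ℝ) j) w :=
      (EuclideanSpace.proj (𝕜 := ℝ) j).hasFDerivAt
    refine (hp.mul hj).congr_fderiv ?_
    ext a
    have h1 : ∀ i, polyFun (MvPolynomial.pderiv i (p * MvPolynomial.X j)) w =
        polyFun (MvPolynomial.pderiv i p) w * w j + polyFun p w * if i = j then 1 else 0 := by
      intro i
      by_cases h : i = j
      · subst h; simp [polyFun]; ring
      · simp [polyFun, MvPolynomial.pderiv_X_of_ne (Ne.symm h), h]; ring
    have hpr : ∀ i, EuclideanSpace.proj (𝕜 := ℝ) i a = a i := fun i => rfl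
    simp only [h1, add_apply, smul_apply, smul_eq_mul,
      sum_apply, hpr, add_mul, Finset.sum_add_distrib,
      Finset.mul_sum]
    simp
    rw [add_comm]
    congr 1
    exact Finset.sum_congr rfl fun i _ => by ring

theorem polyFun_contDiff {m : ℕ} (p : MvPolynomial (Fin m) ℝ) : ContDiff ℝ ∞ (polyFun p) := by
  induction p using MvPolynomial.induction_on with
  | C a =>
    have : polyFun (MvPolynomial.C a) = fun _ : Euc m => a := by ext; simp [polyFun]
    rw [this]; exact contDiff_const
  | add p q hp hq =>
    have : polyFun (p + q) = fun w : Euc m => polyFun p w + polyFun q w := by ext; simp [polyFun]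
    rw [this]; exact hp.add hq
  | mul_X p j hp =>
    have : polyFun (p * MvPolynomial.X j) = fun w : Euc m => polyFun p w * w j := by
      ext; simp [polyFun]
    rw [this]
    exact hp.mul (EuclideanSpace.proj (𝕜 := ℝ) j).contDiff

theorem dirD_stdv_polyFun {m : ℕ} (p : MvPolynomial (Fin m) ℝ) (i : Fin m) :
    dirD (stdv i) (polyFun p) = polyFun (MvPolynomial.pderiv i p) := by
  ext w
  unfold dirD
  rw [(polyFun_hasFDerivAt p w).fderiv]
  simp

theorem polyFun_injective {m : ℕ} : Function.Injective (polyFun (m := m)) := by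
  intro p q h
  refine MvPolynomial.funext fun x => ?_
  simpa [polyFun] using congrFun h (WithLp.toLp 2 x)

theorem polyFun_sum {m : ℕ} {ι : Type*} (s : Finset ι) (p : ι → MvPolynomial (Fin m) ℝ)
    (w : Euc m) : polyFun (∑ i ∈ s, p i) w = ∑ i ∈ s, polyFun (p i) w := by
  simp [polyFun]

theorem evalAt_eq_polyFun {m k : ℕ} (p : harmonicPoly m k) (u : Euc m) :
    evalAt u p = polyFun (p : MvPolynomial (Fin m) ℝ) u := evalAt_apply u p

theorem solid_polyFun {m k : ℕ} {p : MvPolynomial (Fin m) ℝ} (hp : p ∈ harmonicPoly m k) :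
    Solid k (polyFun p) where
  smooth := polyFun_contDiff p
  euler w := by
    have h := ((mem_harmonicPoly p).1 hp).1.sum_X_mul_pderiv
    rw [(polyFun_hasFDerivAt p w).fderiv]
    have := congrArg (fun q => polyFun q w) h
    simp only [polyFun_sum] at this
    simpa [polyFun, mul_comm] using this
  harm w := by
    simp only [dirD_stdv_polyFun]
    rw [← polyFun_sum, ((mem_harmonicPoly p).1 hp).2]
    simp [polyFun]

theorem mem_harmonicPoly_iff_harm {m k : ℕ} {p : MvPolynomial (Fin m) ℝ} :
    p ∈ harmonicPoly m k ↔ p.IsHomogeneous k ∧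
      ∀ w, ∑ i, dirD (stdv i) (dirD (stdv i) (polyFun p)) w = 0 := by
  rw [mem_harmonicPoly]
  refine and_congr_right fun _ => ?_
  simp only [dirD_stdv_polyFun, ← polyFun_sum]
  constructor
  · intro h w; rw [h]; simp [polyFun]
  · intro h
    apply polyFun_injective
    ext w; rw [h w]; simp [polyFun]

theorem solid_evalAt {m k : ℕ} (p : harmonicPoly m k) : Solid k (fun u : Euc m => evalAt u p) := by
  have : (fun u : Euc m => evalAt u p) = polyFun (p : MvPolynomial (Fin m) ℝ) :=
    funext (evalAt_eq_polyFun p)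
  rw [this]; exact solid_polyFun p.2

/-- Members of `𝓗_k` are homogeneous functions of degree `k`. -/
theorem polyFun_smul {m k : ℕ} {p : MvPolynomial (Fin m) ℝ} (hp : p.IsHomogeneous k) (s : ℝ)
    (w : Euc m) : polyFun p (s • w) = s ^ k * polyFun p w := by
  unfold polyFun
  rw [MvPolynomial.eval_eq, MvPolynomial.eval_eq, Finset.mul_sum]
  refine Finset.sum_congr rfl fun d hd => ?_
  have hd' : ∑ i ∈ d.support, d i = k := by
    have := hp (MvPolynomial.mem_support_iff.1 hd)
    rw [← this, Pi.one_def, ← Finsupp.degree_eq_weight_one, Finsupp.degree_apply]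
  rw [← hd', ← Finset.prod_pow_eq_pow_sum]
  simp only [PiLp.smul_apply, smul_eq_mul, mul_pow, Finset.prod_mul_distrib]
  ring

theorem evalAt_smul {m k : ℕ} (p : harmonicPoly m k) (s : ℝ) (w : Euc m) :
    evalAt (s • w) p = s ^ k * evalAt w p := by
  simp only [evalAt_eq_polyFun]
  exact polyFun_smul ((mem_harmonicPoly _).1 p.2).1 s w

theorem sum_inner_stdv_smul {m : ℕ} (z : Euc m) : ∑ i, z i • stdv i = z := by
  ext j
  simp [Pi.single_apply]

theorem inner_stdv {m : ℕ} (z : Euc m) (i : Fin m) : inner ℝ z (stdv i) = z i := by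
  simp [stdv, EuclideanSpace.inner_single_right]

theorem sum_coord_mul {m : ℕ} (f : Euc m →L[ℝ] ℝ) (z : Euc m) : ∑ i, z i * f (stdv i) = f z := by
  conv_rhs => rw [← sum_inner_stdv_smul z]
  simp

theorem sum_sq_coord {m : ℕ} (z : Euc m) : ∑ i, z i * z i = ‖z‖ ^ 2 := by
  rw [EuclideanSpace.norm_sq_eq]; simp [sq]

theorem reflect_zero_left {m : ℕ} (u : Euc m) : reflect 0 u = u := by simp [reflect]

/-- The reflection `u ↦ reflect z u` as a linear isometry. -/
def reflectIso {m : ℕ} (z : Euc m) : Euc m ≃ₗᵢ[ℝ] Euc m := (ℝ ∙ z)ᗮ.reflection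

theorem reflectIso_apply {m : ℕ} (z u : Euc m) : reflectIso z u = reflect z u := by
  rw [reflectIso, Submodule.reflection_orthogonal_apply, Submodule.reflection_singleton_apply,
    reflect, real_inner_comm, ← sub_eq_zero]
  simp only [RCLike.ofReal_real_eq_id, id]
  module

theorem norm_reflect {m : ℕ} (z u : Euc m) : ‖reflect z u‖ = ‖u‖ := by
  rw [← reflectIso_apply]; exact (reflectIso z).norm_map u

theorem reflect_reflect {m : ℕ} (z u : Euc m) : reflect z (reflect z u) = u := by
  rw [← reflectIso_apply, ← reflectIso_apply]; exact Submodule.reflection_reflection _ _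

/-- A trace does not depend on the orthonormal basis. For a reflection this is a direct expansion:
the two cross terms cancel against the quadratic one. -/
theorem trace_reflect {m : ℕ} (B : Euc m →L[ℝ] Euc m →L[ℝ] ℝ) (z : Euc m) :
    ∑ i, B (reflect z (stdv i)) (reflect z (stdv i)) = ∑ i, B (stdv i) (stdv i) := by
  by_cases hz : z = 0
  · simp [hz, reflect_zero_left]
  have hn : ‖z‖ ^ 2 ≠ 0 := by simpa using hz
  have h : ∀ i, B (reflect z (stdv i)) (reflect z (stdv i)) = B (stdv i) (stdv i)
      - 2 / ‖z‖ ^ 2 * (z i * (B z) (stdv i)) - 2 / ‖z‖ ^ 2 * (z i * (B.flip z) (stdv i))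
      + 4 / (‖z‖ ^ 2) ^ 2 * B z z * (z i * z i) := by
    intro i
    have : inner ℝ (stdv i) z = z i := by rw [real_inner_comm, inner_stdv]
    simp only [reflect, this, map_sub, map_smul, sub_apply,
      smul_apply, smul_eq_mul, ContinuousLinearMap.flip_apply]
    ring
  simp only [h, Finset.sum_add_distrib, Finset.sum_sub_distrib, ← Finset.mul_sum, sum_coord_mul,
    sum_sq_coord]
  simp only [ContinuousLinearMap.flip_apply]
  field_simp
  ring

/-- The polynomial `u ↦ p (reflect z u)`. -/
def reflectPoly {m : ℕ} (z : Euc m) (p : MvPolynomial (Fin m) ℝ) : MvPolynomial (Fin m) ℝ :=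
  MvPolynomial.aeval (fun i => ∑ j, MvPolynomial.C (reflect z (stdv j) i) * MvPolynomial.X j) p

theorem polyFun_reflectPoly {m : ℕ} (z : Euc m) (p : MvPolynomial (Fin m) ℝ) (u : Euc m) :
    polyFun (reflectPoly z p) u = polyFun p (reflect z u) := by
  have h : ∀ i, reflect z u i = ∑ j, reflect z (stdv j) i * u j := by
    intro i
    have h1 := congrArg (fun w : Euc m => w i) (congrArg (reflectIso z) (sum_inner_stdv_smul u))
    simp only [map_sum, map_smul, reflectIso_apply] at h1
    rw [← h1]
    simp [mul_comm]
  unfold polyFun reflectPoly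
  rw [MvPolynomial.aeval_def, ← MvPolynomial.coe_eval₂Hom, ← RingHom.comp_apply]
  rw [MvPolynomial.comp_eval₂Hom]
  simp only [h]
  rw [MvPolynomial.eval, MvPolynomial.coe_eval₂Hom, MvPolynomial.coe_eval₂Hom]
  congr 1
  · ext; simp
  · ext i; simp

theorem dirD_comp_reflect {m : ℕ} (q : Euc m → ℝ) (z a : Euc m) :
    dirD a (fun u => q (reflect z u)) = fun u => dirD (reflect z a) q (reflect z u) := by
  ext u
  have h1 : (fun u => q (reflect z u)) = q ∘ (reflectIso z).toContinuousLinearEquiv := by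
    ext; simp [reflectIso_apply]
  unfold dirD
  rw [h1, ContinuousLinearEquiv.comp_right_fderiv]
  simp [reflectIso_apply]

/-- A linear substitution keeps the degree, and by `trace_reflect` an orthogonal one keeps the
Laplacian. -/
theorem reflectPoly_mem {m k : ℕ} {p : MvPolynomial (Fin m) ℝ} (hp : p ∈ harmonicPoly m k)
    (z : Euc m) : reflectPoly z p ∈ harmonicPoly m k := by
  rw [mem_harmonicPoly_iff_harm]
  have hp' := (mem_harmonicPoly p).1 hp
  constructor
  · have := hp'.1.aeval (fun i => ∑ j, MvPolynomial.C (reflect z (stdv j) i) * MvPolynomial.X j)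
      (n := 1) (fun i => MvPolynomial.IsHomogeneous.sum _ _ _
        fun j _ => MvPolynomial.isHomogeneous_C_mul_X _ _)
    simpa [reflectPoly] using this
  · intro w
    have hs := polyFun_contDiff p
    have h0 : polyFun (reflectPoly z p) = fun u => polyFun p (reflect z u) :=
      funext (polyFun_reflectPoly z p)
    simp only [h0, dirD_comp_reflect, dirD_dirD hs, trace_reflect]
    simp only [← dirD_dirD hs]
    exact (solid_polyFun hp).harm _

/-- Composition of a member of `𝓗_k` with a reflection. -/
def rot {m k : ℕ} (z : Euc m) (p : harmonicPoly m k) : harmonicPoly m k :=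
  ⟨reflectPoly z p, reflectPoly_mem p.2 z⟩

theorem evalAt_rot {m k : ℕ} (z u : Euc m) (p : harmonicPoly m k) :
    evalAt u (rot z p) = evalAt (reflect z u) p := by
  rw [evalAt_eq_polyFun, evalAt_eq_polyFun]
  exact polyFun_reflectPoly z _ u

/-- The action of a reflection on the unit sphere. -/
def sphereReflect {m : ℕ} (z : Euc m) (u : USphere m) : USphere m :=
  ⟨reflect z u, by simp [norm_reflect]⟩

theorem sphereReflect_involutive {m : ℕ} (z : Euc m) :
    Function.Involutive (sphereReflect z) := fun u => Subtype.ext (reflect_reflect z u)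

theorem continuous_reflect_right {m : ℕ} (z : Euc m) : Continuous (reflect z) := by
  have : reflect z = reflectIso z := funext fun u => (reflectIso_apply z u).symm
  rw [this]; exact (reflectIso z).continuous

theorem continuous_sphereReflect {m : ℕ} (z : Euc m) : Continuous (sphereReflect z) :=
  ((continuous_reflect_right z).comp continuous_subtype_val).subtype_mk _

-- The measure `toSphere` of a set is a multiple of the volume of the cone over it. The reflection
-- maps cones to cones and preserves volume.
open scoped Pointwise in
theorem measurePreserving_sphereReflect {m : ℕ} (z : Euc m) :
    MeasurePreserving (sphereReflect z) (surf m) (surf m) := by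
  refine ⟨(continuous_sphereReflect z).measurable, ?_⟩
  ext s hs
  rw [Measure.map_apply (continuous_sphereReflect z).measurable hs, surf,
    Measure.toSphere_apply' _ ((continuous_sphereReflect z).measurable hs),
    Measure.toSphere_apply' _ hs]
  congr 1
  have h : Ioo (0 : ℝ) 1 • ((↑) '' (sphereReflect z ⁻¹' s) : Set (Euc m)) =
      reflectIso z ⁻¹' (Ioo (0 : ℝ) 1 • ((↑) '' s : Set (Euc m))) := by
    ext u
    simp only [mem_preimage, mem_smul, mem_image, Subtype.exists, exists_and_right, exists_eq_right]
    constructor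
    · rintro ⟨r, hr, v, ⟨hv, hvs⟩, rfl⟩
      exact ⟨r, hr, reflect z v, ⟨by simpa [norm_reflect] using hv, hvs⟩, by rw [map_smul, reflectIso_apply]⟩
    · rintro ⟨r, hr, v, ⟨hv, hvs⟩, h⟩
      refine ⟨r, hr, reflect z v, ⟨by simpa [norm_reflect] using hv, ?_⟩, ?_⟩
      · have h2 : sphereReflect z ⟨reflect z v, by simpa [norm_reflect] using hv⟩ = ⟨v, hv⟩ :=
          Subtype.ext (reflect_reflect z v)
        rw [h2]; exact hvs
      · rw [← reflectIso_apply, ← map_smul, h, reflectIso_apply, reflectIso_apply, reflect_reflect]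
  rw [h]
  exact (reflectIso z).measurePreserving.measure_preimage_emb
    (reflectIso z).toMeasurableEquiv.measurableEmbedding _

/-- After the change of variables `u ↦ reflect z u` the reproducing property applies to the
reflected polynomial `rot z p`. This is where the sphere integral in the Poisson kernel disappears.
-/
theorem integral_zonal_reflect {m k : ℕ} [NeZero m] (z v : Euc m) (p : harmonicPoly m k) :
    ∫ u, zonal m k (reflect z (u : Euc m)) v * evalAt (u : Euc m) p ∂(surf m) =
      evalAt (reflect z v) p := by
  have hm := continuous_sphereReflect z |>.measurable
  let e : USphere m ≃ᵐ USphere m :=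
    { toEquiv := (sphereReflect_involutive z).toPerm
      measurable_toFun := hm
      measurable_invFun := hm }
  rw [← evalAt_rot, ← zonal_reproducing,
    ← (measurePreserving_sphereReflect z).integral_comp e.measurableEmbedding]
  simp only [evalAt_rot, sphereReflect, reflect_reflect]

end

/-! ### Derivatives of `h(z) q(reflect z v)` and the operator `⟨D_u, D_x⟩` on the kernel. -/

section

theorem hasFDerivAt_inv_norm_pow {m : ℕ} (N : ℕ) {z : Euc m} (hz : z ≠ 0) :
    HasFDerivAt (fun z : Euc m => (‖z‖ ^ N)⁻¹)
      ((-(N * (‖z‖ ^ (N + 2))⁻¹) : ℝ) • innerSL ℝ z) z := by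
  have hn : ‖z‖ ≠ 0 := norm_ne_zero_iff.2 hz
  have h1 : HasFDerivAt (fun z : Euc m => ‖z‖) ((‖z‖⁻¹ : ℝ) • innerSL ℝ z) z := by
    have h2 := (hasStrictFDerivAt_norm_sq z).hasFDerivAt.sqrt (by positivity)
    have h3 : (fun y : Euc m => √(‖y‖ ^ 2)) = fun z : Euc m => ‖z‖ := by
      ext y; exact Real.sqrt_sq (norm_nonneg y)
    rw [h3] at h2
    refine h2.congr_fderiv ?_
    ext a
    simp [Real.sqrt_sq (norm_nonneg z)]
    field_simp
  have h4 : HasDerivAt (fun t : ℝ => (t ^ N)⁻¹) (-(N * ‖z‖ ^ (N - 1)) / (‖z‖ ^ N) ^ 2) ‖z‖ :=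
    (hasDerivAt_pow N ‖z‖).inv (pow_ne_zero _ hn)
  refine (h4.comp_hasFDerivAt z h1).congr_fderiv ?_
  rw [smul_smul]
  congr 1
  rcases N with _ | N
  · simp
  · simp only [Nat.add_sub_cancel]
    field_simp
    ring

/-- The derivative of `z ↦ reflect z v`. -/
def reflectDeriv {m : ℕ} (z v : Euc m) : Euc m →L[ℝ] Euc m :=
  (-(2 / ‖z‖ ^ 2)) • ((innerSL ℝ v).smulRight z + (inner ℝ v z) • ContinuousLinearMap.id ℝ (Euc m) -
    (2 * inner ℝ v z / ‖z‖ ^ 2) • (innerSL ℝ z).smulRight z)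

theorem reflectDeriv_apply {m : ℕ} (z v e : Euc m) : reflectDeriv z v e =
    (-(2 / ‖z‖ ^ 2)) • (inner ℝ v e • z + inner ℝ v z • e -
      (2 * inner ℝ v z / ‖z‖ ^ 2) • (inner ℝ z e • z)) := by
  simp [reflectDeriv]

theorem reflectDeriv_apply' {m : ℕ} (z v e : Euc m) : reflectDeriv z v e =
    (-(2 / ‖z‖ ^ 2)) • (inner ℝ v z • reflect z e + inner ℝ v e • z) := by
  rw [reflectDeriv_apply, reflect, real_inner_comm z e]
  module

theorem hasFDerivAt_reflect {m : ℕ} {z : Euc m} (hz : z ≠ 0) (v : Euc m) :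
    HasFDerivAt (fun z => reflect z v) (reflectDeriv z v) z := by
  have hn : ‖z‖ ≠ 0 := norm_ne_zero_iff.2 hz
  have h1 : HasFDerivAt (fun z : Euc m => inner ℝ v z) (innerSL ℝ v) z :=
    (innerSL ℝ v).hasFDerivAt
  have h2 := (((h1.const_mul 2).mul (hasFDerivAt_inv_norm_pow 2 hz)).smul
    (hasFDerivAt_id z)).const_sub v
  have h3 : (fun z => reflect z v) = fun z : Euc m =>
    v - ((2 * inner ℝ v z) * (‖z‖ ^ 2)⁻¹) • id z := by ext1 z; simp [reflect, div_eq_mul_inv]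
  rw [h3]
  refine h2.congr_fderiv ?_
  ext1 e
  rw [reflectDeriv_apply]
  simp
  match_scalars <;> field_simp <;> ring

/-- The dependence of `reflectDeriv z v e` on `v`. -/
def reflectDerivFlip {m : ℕ} (z e : Euc m) : Euc m →L[ℝ] Euc m :=
  (-(2 / ‖z‖ ^ 2)) • ((innerSL ℝ e).smulRight z + (innerSL ℝ z).smulRight e -
    (2 * inner ℝ z e / ‖z‖ ^ 2) • (innerSL ℝ z).smulRight z)

theorem reflectDerivFlip_apply {m : ℕ} (z v e : Euc m) :
    reflectDerivFlip z e v = reflectDeriv z v e := by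
  rw [reflectDeriv_apply, real_inner_comm e v, real_inner_comm z v]
  simp [reflectDerivFlip]
  module

theorem Solid.snd_self {m : ℕ} {l : ℝ} {q : Euc m → ℝ} (hq : Solid l q) (w a : Euc m) :
    fderiv ℝ (fderiv ℝ q) w w a = (l - 1) * fderiv ℝ q w a := by
  rw [← dirD_dirD hq.smooth]
  exact (hq.dirD a).euler w

theorem snd_symm {m : ℕ} {q : Euc m → ℝ} (hq : ContDiff ℝ ∞ q) (w a b : Euc m) :
    fderiv ℝ (fderiv ℝ q) w a b = fderiv ℝ (fderiv ℝ q) w b a :=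
  (hq.contDiffAt.isSymmSndFDerivAt (by simp; norm_cast)).eq a b

theorem Solid.hasFDerivAt {m : ℕ} {l : ℝ} {q : Euc m → ℝ} (hq : Solid l q) (w : Euc m) :
    HasFDerivAt q (fderiv ℝ q w) w := (hq.smooth.differentiable (by simp) w).hasFDerivAt

theorem Solid.hasFDerivAt_fderiv {m : ℕ} {l : ℝ} {q : Euc m → ℝ} (hq : Solid l q) (w : Euc m) :
    HasFDerivAt (fderiv ℝ q) (fderiv ℝ (fderiv ℝ q) w) w :=
  ((hq.smooth.fderiv_right (m := ∞) (by simp)).differentiable (by simp) w).hasFDerivAt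

theorem Solid.trace {m : ℕ} {l : ℝ} {q : Euc m → ℝ} (hq : Solid l q) (w : Euc m) :
    ∑ i, fderiv ℝ (fderiv ℝ q) w (stdv i) (stdv i) = 0 := by
  simpa only [dirD_dirD hq.smooth] using hq.harm w

theorem reflect_self {m : ℕ} (z : Euc m) : reflect z z = -z := by
  by_cases hz : z = 0
  · simp [hz, reflect]
  have hn : ‖z‖ ≠ 0 := norm_ne_zero_iff.2 hz
  rw [reflect, real_inner_self_eq_norm_sq, mul_div_cancel_right₀ _ (pow_ne_zero 2 hn)]
  module

theorem stdv_inner {m : ℕ} (z : Euc m) (i : Fin m) : inner ℝ (stdv i) z = z i := by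
  rw [real_inner_comm, inner_stdv]

theorem sum_coord_coord {m : ℕ} (a b : Euc m) : ∑ i, a i * b i = inner ℝ a b := by
  rw [real_inner_comm]; simp [PiLp.inner_apply]

theorem hasFDerivAt_reflect_right {m : ℕ} (z v : Euc m) : HasFDerivAt (fun v => reflect z v)
    ((reflectIso z).toContinuousLinearEquiv : Euc m →L[ℝ] Euc m) v := by
  have : (fun v => reflect z v) = ((reflectIso z).toContinuousLinearEquiv : Euc m →L[ℝ] Euc m) := by
    ext1 v; simp [reflectIso_apply]
  rw [this]
  exact ContinuousLinearMap.hasFDerivAt _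

theorem hasFDerivAt_mul_reflect {m : ℕ} {l : ℝ} {q : Euc m → ℝ} (hq : Solid l q)
    {h : Euc m → ℝ} {g z : Euc m} (hh : HasFDerivAt h (innerSL ℝ g) z) (hz : z ≠ 0) (v : Euc m) :
    HasFDerivAt (fun z => h z * q (reflect z v))
      (h z • (fderiv ℝ q (reflect z v) ∘L reflectDeriv z v) + q (reflect z v) • innerSL ℝ g) z :=
  hh.mul ((hq.hasFDerivAt (reflect z v)).comp z (hasFDerivAt_reflect hz v))

theorem dX_mul_reflect {m : ℕ} {l : ℝ} {q : Euc m → ℝ} (hq : Solid l q)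
    {h : Euc m → ℝ} {g z : Euc m} (hh : HasFDerivAt h (innerSL ℝ g) z) (hz : z ≠ 0) (i : Fin m) :
    dX i (fun z v => h z * q (reflect z v)) z = fun v =>
      h z * fderiv ℝ q (reflect z v) (reflectDerivFlip z (stdv i) v) + g i * q (reflect z v) := by
  ext v
  unfold dX
  rw [(hasFDerivAt_mul_reflect hq hh hz v).fderiv, reflectDerivFlip_apply]
  have := inner_stdv g i
  simp only [stdv] at this
  simp [this, mul_comm]

theorem hasFDerivAt_dX_mul_reflect {m : ℕ} {l : ℝ} {q : Euc m → ℝ} (hq : Solid l q)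
    {h : Euc m → ℝ} {g z : Euc m} (hh : HasFDerivAt h (innerSL ℝ g) z) (hz : z ≠ 0) (i : Fin m)
    (v : Euc m) :
    ∃ T : Euc m →L[ℝ] ℝ, HasFDerivAt (dX i (fun z v => h z * q (reflect z v)) z) T v ∧
      T (stdv i) = h z * (fderiv ℝ (fderiv ℝ q) (reflect z v) (reflect z (stdv i))
        (reflectDeriv z v (stdv i)) + fderiv ℝ q (reflect z v) (reflectDeriv z (stdv i) (stdv i))) +
        g i * fderiv ℝ q (reflect z v) (reflect z (stdv i)) := by
  rw [dX_mul_reflect hq hh hz]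
  have hr := hasFDerivAt_reflect_right z v
  have h1 := ((hq.hasFDerivAt_fderiv (reflect z v)).comp v hr).clm_apply
    (reflectDerivFlip z (stdv i)).hasFDerivAt
  have h2 := (hq.hasFDerivAt (reflect z v)).comp v hr
  refine ⟨_, (h1.const_mul (h z)).add (h2.const_mul (g i)), ?_⟩
  simp [reflectIso_apply, reflectDerivFlip_apply, mul_add]
  ring

/-- Second derivatives of `q` drop out: their trace vanishes by harmonicity, and `P (reflect z v) z`
reduces to a first derivative by Euler's identity. The result is again a sum of scalar functions of
`z` times solid harmonics at `reflect z v`, now of degree `l - 1`, so the formula can be iterated.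
-/
theorem duDx_mul_reflect {m : ℕ} {l : ℝ} {q : Euc m → ℝ} (hq : Solid l q)
    {h : Euc m → ℝ} {g z : Euc m} (hh : HasFDerivAt h (innerSL ℝ g) z) (hz : z ≠ 0) (v : Euc m) :
    duDx (fun z v => h z * q (reflect z v)) z v =
      fderiv ℝ q (reflect z v)
        (g - (2 / ‖z‖ ^ 2 * (inner ℝ g z + (m + l - 2) * h z)) • z) := by
  have hn : ‖z‖ ≠ 0 := norm_ne_zero_iff.2 hz
  set N := fderiv ℝ q (reflect z v) with hN
  set P := fderiv ℝ (fderiv ℝ q) (reflect z v) with hP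
  have hdU : ∀ i, dU i (dX i (fun z v => h z * q (reflect z v))) z v =
      h z * (P (reflect z (stdv i)) (reflectDeriv z v (stdv i)) +
        N (reflectDeriv z (stdv i) (stdv i))) + g i * N (reflect z (stdv i)) := by
    intro i
    obtain ⟨T, hT, hTi⟩ := hasFDerivAt_dX_mul_reflect hq hh hz i v
    unfold dU
    rw [hT.fderiv]
    exact hTi
  have hterm : ∀ i, dU i (dX i (fun z v => h z * q (reflect z v))) z v =
      h z * (-(2 / ‖z‖ ^ 2)) * (inner ℝ v z * P (reflect z (stdv i)) (reflect z (stdv i))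
        + v i * (P.flip z ∘L ((reflectIso z).toContinuousLinearEquiv : Euc m →L[ℝ] Euc m)) (stdv i)
        + N z + z i * N (stdv i) - 2 / ‖z‖ ^ 2 * N z * (z i * z i))
      + (g i * N (stdv i) - 2 / ‖z‖ ^ 2 * N z * (g i * z i)) := by
    intro i
    rw [hdU]
    have h1 : reflectDeriv z (stdv i) (stdv i) = (-(2 / ‖z‖ ^ 2)) •
        (z + z i • stdv i - (2 / ‖z‖ ^ 2 * (z i * z i)) • z) := by
      rw [reflectDeriv_apply, stdv_inner, stdv_inner, inner_stdv]
      simp only [stdv, PiLp.single_apply, if_true]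
      module
    have h2 : N (reflect z (stdv i)) = N (stdv i) - 2 / ‖z‖ ^ 2 * z i * N z := by
      rw [reflect, stdv_inner, map_sub, map_smul, smul_eq_mul]; ring
    rw [h1, h2, reflectDeriv_apply']
    simp only [map_smul, map_add, map_sub, smul_eq_mul, inner_stdv, ContinuousLinearMap.comp_apply,
      ContinuousLinearMap.flip_apply, ContinuousLinearEquiv.coe_coe,
      LinearIsometryEquiv.coe_toContinuousLinearEquiv, reflectIso_apply]
    ring
  have e1 : P (reflect z v) z = (l - 1) * N z := hq.snd_self _ _
  have e2 : ∑ i, P (stdv i) (stdv i) = 0 := hq.trace _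
  unfold duDx
  simp only [hterm, Finset.sum_add_distrib, Finset.sum_sub_distrib, ← Finset.mul_sum,
    sum_coord_mul, trace_reflect, sum_coord_coord]
  simp only [ContinuousLinearMap.comp_apply,
      ContinuousLinearMap.flip_apply, ContinuousLinearEquiv.coe_coe,
      LinearIsometryEquiv.coe_toContinuousLinearEquiv, reflectIso_apply, e1, e2,
      real_inner_self_eq_norm_sq, Finset.sum_const, Finset.card_univ, Fintype.card_fin,
      map_sub, map_smul, smul_eq_mul, nsmul_eq_mul]
  field_simp
  ring

theorem hasFDerivAt_coord {m : ℕ} (j : Fin m) (z : Euc m) :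
    HasFDerivAt (fun z : Euc m => z j) (innerSL ℝ (stdv j)) z := by
  have : (fun z : Euc m => z j) = innerSL ℝ (stdv j) := by
    ext1 w; rw [innerSL_apply_apply, stdv_inner]
  rw [this]; exact ContinuousLinearMap.hasFDerivAt _

theorem duDx_sum_mul_reflect {m : ℕ} {l : ℝ} {q : Fin m → Euc m → ℝ} (hq : ∀ j, Solid l (q j))
    {h : Fin m → Euc m → ℝ} {g : Fin m → Euc m} {z : Euc m}
    (hh : ∀ j, HasFDerivAt (h j) (innerSL ℝ (g j)) z) (hz : z ≠ 0) (v : Euc m) :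
    duDx (fun z v => ∑ j, h j z * q j (reflect z v)) z v =
      ∑ j, fderiv ℝ (q j) (reflect z v)
        (g j - (2 / ‖z‖ ^ 2 * (inner ℝ (g j) z + (m + l - 2) * h j z)) • z) := by
  have h1 : ∀ i, dX i (fun z v => ∑ j, h j z * q j (reflect z v)) z =
      fun v => ∑ j, dX i (fun z v => h j z * q j (reflect z v)) z v := by
    intro i; ext v
    unfold dX
    rw [fderiv_fun_sum fun j _ =>
      (hasFDerivAt_mul_reflect (hq j) (hh j) hz v).differentiableAt]
    simp
  simp only [← duDx_mul_reflect (hq _) (hh _) hz v]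
  unfold duDx
  rw [Finset.sum_comm]
  refine Finset.sum_congr rfl fun i _ => ?_
  rw [dU, h1, fderiv_fun_sum fun j _ => ?_]
  · simp [dU]
  · obtain ⟨T, hT, -⟩ := hasFDerivAt_dX_mul_reflect (hq j) (hh j) hz i v
    exact hT.differentiableAt

/-- The operators are local in the first variable. The congruence lemmas allow formulas valid only
off the origin, or only over the half-space, to be inserted under further derivatives. -/
theorem dX_congr {m : ℕ} {F G : Euc m → Euc m → ℝ} {U : Set (Euc m)} (hU : IsOpen U)
    (h : ∀ z ∈ U, F z = G z) {z : Euc m} (hz : z ∈ U) (i : Fin m) : dX i F z = dX i G z := by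
  ext v
  unfold dX
  rw [Filter.EventuallyEq.fderiv_eq]
  filter_upwards [hU.mem_nhds hz] with x hx
  rw [h x hx]

theorem duDx_congr {m : ℕ} {F G : Euc m → Euc m → ℝ} {U : Set (Euc m)} (hU : IsOpen U)
    (h : ∀ z ∈ U, F z = G z) {z : Euc m} (hz : z ∈ U) : duDx F z = duDx G z := by
  ext v
  simp only [duDx, dU, dX_congr hU h hz]

theorem uDx_congr {m : ℕ} {F G : Euc m → Euc m → ℝ} {U : Set (Euc m)} (hU : IsOpen U)
    (h : ∀ z ∈ U, F z = G z) {z : Euc m} (hz : z ∈ U) : uDx F z = uDx G z := by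
  ext v
  simp only [uDx, dX_congr hU h hz]

theorem bosonicLaplacian_congr {m k : ℕ} {F G : Euc m → Euc m → ℝ} {U : Set (Euc m)}
    (hU : IsOpen U) (h : ∀ z ∈ U, F z = G z) {z : Euc m} (hz : z ∈ U) :
    bosonicLaplacian k F z = bosonicLaplacian k G z := by
  ext v
  have h1 := fun z hz => duDx_congr hU h (z := z) hz
  have h2 : (fun z => F z v) =ᶠ[nhds z] fun z => G z v := by
    filter_upwards [hU.mem_nhds hz] with x hx
    rw [h x hx]
  simp only [bosonicLaplacian, duDx_congr hU h1 hz, uDx_congr hU h1 hz,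
    InnerProductSpace.laplacian_congr_nhds h2 |>.eq_of_nhds]

theorem hasFDerivAt_coord_mul_inv_norm_pow {m : ℕ} (j : Fin m) (N : ℕ) {z : Euc m} (hz : z ≠ 0) :
    HasFDerivAt (fun z : Euc m => z j * (‖z‖ ^ N)⁻¹)
      (innerSL ℝ ((‖z‖ ^ N)⁻¹ • stdv j - (N * z j * (‖z‖ ^ (N + 2))⁻¹) • z)) z := by
  refine ((hasFDerivAt_coord j z).mul (hasFDerivAt_inv_norm_pow N hz)).congr_fderiv ?_
  ext a
  simp
  ring

theorem uDx_eq_fderiv {m : ℕ} (F : Euc m → Euc m → ℝ) (z v : Euc m) :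
    uDx F z v = fderiv ℝ (fun z => F z v) z v := by
  unfold uDx dX
  exact sum_coord_mul _ _

variable {m k : ℕ} {q : Euc m → ℝ}

/-- The Poisson kernel applied to a solid spherical harmonic. -/
def kernelFun (i : Fin m) (q : Euc m → ℝ) (z v : Euc m) : ℝ :=
  (z i * (‖z‖ ^ m)⁻¹) * q (reflect z v)

/-- The coefficients of `⟨D_u, D_x⟩` of the Poisson kernel. -/
def kernelCoeff (i : Fin m) (α : ℝ) (j : Fin m) (z : Euc m) : ℝ :=
  (stdv i : Euc m) j * (‖z‖ ^ m)⁻¹ - α * (z j * (z i * (‖z‖ ^ (m + 2))⁻¹))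

theorem hasFDerivAt_kernelCoeff (i : Fin m) (α : ℝ) (j : Fin m) {z : Euc m} (hz : z ≠ 0) :
    HasFDerivAt (kernelCoeff i α j) (innerSL ℝ (
      (-(m * (‖z‖ ^ (m + 2))⁻¹ * (stdv i : Euc m) j)) • z
      - α • ((z i * (‖z‖ ^ (m + 2))⁻¹) • stdv j + z j • ((‖z‖ ^ (m + 2))⁻¹ • stdv i
        - ((m + 2) * z i * (‖z‖ ^ (m + 4))⁻¹) • z)))) z := by
  refine (((hasFDerivAt_inv_norm_pow m hz).const_mul ((stdv i : Euc m) j)).sub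
    (((hasFDerivAt_coord j z).mul
      (hasFDerivAt_coord_mul_inv_norm_pow i (m + 2) hz)).const_mul α)).congr_fderiv ?_
  ext a
  simp only [innerSL_apply_apply, sub_apply, smul_apply, add_apply, inner_sub_left, inner_smul_left,
    inner_add_left, smul_eq_mul, RCLike.conj_to_real]
  push_cast
  ring

/-- For `h = z_i |z|^{-m}` one has `⟨∇h, z⟩ = (1 - m) h`. The radial coefficients `m` and `2(k - 1)`
from `duDx_mul_reflect` then add up to `m + 2k - 2`. -/
theorem duDx_kernelFun (hq : Solid k q) (i : Fin m) {z : Euc m} (hz : z ≠ 0) :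
    duDx (kernelFun i q) z = fun v => ∑ j, kernelCoeff i (m + 2 * k - 2) j z *
      dirD (stdv j) q (reflect z v) := by
  have hn : ‖z‖ ≠ 0 := norm_ne_zero_iff.2 hz
  ext v
  unfold kernelFun
  rw [duDx_mul_reflect hq (hasFDerivAt_coord_mul_inv_norm_pow i m hz) hz]
  have h1 : ∀ j, kernelCoeff i (m + 2 * k - 2) j z * dirD (stdv j) q (reflect z v) =
      (‖z‖ ^ m)⁻¹ * ((stdv i : Euc m) j * fderiv ℝ q (reflect z v) (stdv j)) -
      (m + 2 * k - 2) * (z i * (‖z‖ ^ (m + 2))⁻¹) * (z j * fderiv ℝ q (reflect z v) (stdv j)) := by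
    intro j; unfold kernelCoeff dirD; ring
  simp only [h1, Finset.sum_sub_distrib, ← Finset.mul_sum, sum_coord_mul]
  simp only [map_sub, map_smul, smul_eq_mul, inner_sub_left, inner_smul_left, stdv_inner,
    RCLike.conj_to_real, real_inner_self_eq_norm_sq, pow_add]
  field_simp
  ring

theorem duDx_duDx_kernelFun (hq : Solid k q) (i : Fin m) {z : Euc m} (hz : z ≠ 0) (v : Euc m) :
    duDx (duDx (kernelFun i q)) z v = (m + 2 * k - 4) * (‖z‖ ^ (m + 2))⁻¹ *
      (-2 * fderiv ℝ (fderiv ℝ q) (reflect z v) z (stdv i) + (m + 2 * k - 2) * z i / ‖z‖ ^ 2 *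
        fderiv ℝ (fderiv ℝ q) (reflect z v) z z) := by
  have hn : ‖z‖ ≠ 0 := norm_ne_zero_iff.2 hz
  -- The second application is to the partial derivatives of `q`, which are solid harmonics of
  -- degree `k - 1`.
  rw [duDx_congr (U := {0}ᶜ) isOpen_compl_singleton (fun z hz => duDx_kernelFun hq i hz) hz,
    duDx_sum_mul_reflect (fun j => hq.dirD (stdv j)) (fun j => hasFDerivAt_kernelCoeff i _ j hz) hz]
  set P := fderiv ℝ (fderiv ℝ q) (reflect z v) with hP
  have h0 : ∀ j a, fderiv ℝ (dirD (stdv j) q) (reflect z v) a = P a (stdv j) :=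
    fun j a => dirD_dirD hq.smooth a (stdv j) (reflect z v)
  have hs : P (stdv i) z = P z (stdv i) := snd_symm hq.smooth _ _ _
  have e2 : ∑ i, P (stdv i) (stdv i) = 0 := hq.trace _
  have h1 : ∀ j, (P ((-(m * (‖z‖ ^ (m + 2))⁻¹ * (stdv i : Euc m) j)) • z
      - ((m : ℝ) + 2 * k - 2) • ((z i * (‖z‖ ^ (m + 2))⁻¹) • stdv j + z j • ((‖z‖ ^ (m + 2))⁻¹ • stdv i
        - ((m + 2) * z i * (‖z‖ ^ (m + 4))⁻¹) • z)) - (2 / ‖z‖ ^ 2 * (inner ℝ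
        ((-(m * (‖z‖ ^ (m + 2))⁻¹ * (stdv i : Euc m) j)) • z
      - ((m : ℝ) + 2 * k - 2) • ((z i * (‖z‖ ^ (m + 2))⁻¹) • stdv j + z j • ((‖z‖ ^ (m + 2))⁻¹ • stdv i
        - ((m + 2) * z i * (‖z‖ ^ (m + 4))⁻¹) • z))) z + (m + (k - 1) - 2) *
          kernelCoeff i (m + 2 * k - 2) j z)) • z)) (stdv j) =
      (-2 * (m + 2 * k - 4) * (‖z‖ ^ (m + 2))⁻¹ + (m + 2 * k - 2) * (‖z‖ ^ (m + 2))⁻¹) *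
        ((stdv i : Euc m) j * P z (stdv j))
      - (m + 2 * k - 2) * (z i * (‖z‖ ^ (m + 2))⁻¹) * P (stdv j) (stdv j)
      - (m + 2 * k - 2) * (‖z‖ ^ (m + 2))⁻¹ * (z j * P (stdv i) (stdv j))
      + (m + 2 * k - 2) * (m + 2 * k - 4) * z i * (‖z‖ ^ (m + 2))⁻¹ / ‖z‖ ^ 2 *
        (z j * P z (stdv j)) := by
    intro j
    unfold kernelCoeff
    simp only [map_sub, map_smul, map_add, smul_eq_mul, inner_sub_left, inner_smul_left, stdv_inner,
      inner_add_left, RCLike.conj_to_real, real_inner_self_eq_norm_sq, pow_add, sub_apply,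
      smul_apply, add_apply]
    field_simp
    ring
  simp only [h0, h1, Finset.sum_sub_distrib, Finset.sum_add_distrib, ← Finset.mul_sum,
    sum_coord_mul, e2, hs]
  ring

end

/-! ### The Laplacian of the kernel, and its cancellation in `𝓓_k`. -/

section

variable {m k : ℕ} {q : Euc m → ℝ}

theorem reflect_add_self (z v : Euc m) :
    reflect z v + (2 * inner ℝ v z / ‖z‖ ^ 2) • z = v := by
  rw [reflect]; module

/-- `reflect z v` is homogeneous of degree zero in `z`, so its radial derivative vanishes. -/
theorem reflectDeriv_self {z : Euc m} (v : Euc m) : reflectDeriv z v z = 0 := by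
  rw [reflectDeriv_apply', reflect_self]; simp

/-- Writing `v` as `reflect z v` plus a multiple of `z`, the first part is handled by Euler's
identity. Together with `Solid.snd_reflect` this reduces derivatives along `v` to derivatives along
`z`. -/
theorem Solid.fst_reflect (hq : Solid k q) (z v : Euc m) :
    fderiv ℝ q (reflect z v) v = k * q (reflect z v) +
      2 * inner ℝ v z / ‖z‖ ^ 2 * fderiv ℝ q (reflect z v) z := by
  conv_lhs => rw [← reflect_add_self z v, map_add, map_smul, reflect_add_self z v, hq.euler]
  simp

theorem Solid.snd_reflect (hq : Solid k q) (z v a : Euc m) :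
    fderiv ℝ (fderiv ℝ q) (reflect z v) v a = (k - 1) * fderiv ℝ q (reflect z v) a +
      2 * inner ℝ v z / ‖z‖ ^ 2 * fderiv ℝ (fderiv ℝ q) (reflect z v) z a := by
  conv_lhs => rw [← reflect_add_self z v, map_add, map_smul, reflect_add_self z v, add_apply,
    hq.snd_self]
  simp

theorem uDx_duDx_kernelFun (hq : Solid k q) (i : Fin m) {z : Euc m} (hz : z ≠ 0) (v : Euc m) :
    uDx (duDx (kernelFun i q)) z v = (‖z‖ ^ (m + 2))⁻¹ *
      (-(m + 2 * k - 2) * inner ℝ v z * fderiv ℝ q (reflect z v) (stdv i)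
        - 2 * ‖v‖ ^ 2 * fderiv ℝ (fderiv ℝ q) (reflect z v) z (stdv i)
        + (m + 2 * k - 2) * (-v i * fderiv ℝ q (reflect z v) z - z i * k * q (reflect z v)
          + (m + 2 * k - 2) * z i * inner ℝ v z / ‖z‖ ^ 2 * fderiv ℝ q (reflect z v) z
          + 2 * z i * ‖v‖ ^ 2 / ‖z‖ ^ 2 * fderiv ℝ (fderiv ℝ q) (reflect z v) z z)) := by
  have hn : ‖z‖ ≠ 0 := norm_ne_zero_iff.2 hz
  rw [uDx_congr (U := {0}ᶜ) isOpen_compl_singleton (fun z hz => duDx_kernelFun hq i hz) hz,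
    uDx_eq_fderiv, fderiv_fun_sum fun j _ => (hasFDerivAt_mul_reflect (hq.dirD (stdv j))
      (hasFDerivAt_kernelCoeff i _ j hz) hz v).differentiableAt]
  simp only [sum_apply, fun j => (hasFDerivAt_mul_reflect (hq.dirD (stdv j))
      (hasFDerivAt_kernelCoeff i (m + 2 * k - 2) j hz) hz v).fderiv]
  set P := fderiv ℝ (fderiv ℝ q) (reflect z v) with hP
  set N := fderiv ℝ q (reflect z v) with hN
  have h0 : ∀ j a, fderiv ℝ (dirD (stdv j) q) (reflect z v) a = P a (stdv j) :=
    fun j a => dirD_dirD hq.smooth a (stdv j) (reflect z v)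
  have h2 : ∀ j, dirD (stdv j) q (reflect z v) = N (stdv j) := fun j => rfl
  -- The derivative of the reflection in the direction `v` is a combination of `reflect z v` and
  -- `z`. Euler's identity for `∇q` turns the first contribution into a multiple of `N`.
  have hL : P (reflectDeriv z v v) = (-(2 / ‖z‖ ^ 2)) • (‖v‖ ^ 2 • P z +
      (inner ℝ v z * (k - 1)) • N) := by
    ext a
    have h3 : P (reflect z v) a = (k - 1) * N a := hq.snd_self _ _
    rw [reflectDeriv_apply', real_inner_self_eq_norm_sq]
    simp only [map_smul, map_add, smul_apply, add_apply, smul_eq_mul, h3]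
    ring
  have hv : N v = k * q (reflect z v) + 2 * inner ℝ v z / ‖z‖ ^ 2 * N z := hq.fst_reflect z v
  have h1 : ∀ j, (kernelCoeff i (m + 2 * k - 2) j z •
        (fderiv ℝ (dirD (stdv j) q) (reflect z v) ∘L reflectDeriv z v) +
        dirD (stdv j) q (reflect z v) • innerSL ℝ ((-(m * (‖z‖ ^ (m + 2))⁻¹ * (stdv i : Euc m) j)) • z
      - ((m : ℝ) + 2 * k - 2) • ((z i * (‖z‖ ^ (m + 2))⁻¹) • stdv j + z j • ((‖z‖ ^ (m + 2))⁻¹ • stdv i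
        - ((m + 2) * z i * (‖z‖ ^ (m + 4))⁻¹) • z)))) v =
      ((stdv i : Euc m) j * P (reflectDeriv z v v) (stdv j)) * (‖z‖ ^ m)⁻¹
      - (m + 2 * k - 2) * (z i * (‖z‖ ^ (m + 2))⁻¹) * (z j * P (reflectDeriv z v v) (stdv j))
      - m * (‖z‖ ^ (m + 2))⁻¹ * inner ℝ v z * ((stdv i : Euc m) j * N (stdv j))
      - (m + 2 * k - 2) * (z i * (‖z‖ ^ (m + 2))⁻¹) * (v j * N (stdv j))
      - (m + 2 * k - 2) * ((‖z‖ ^ (m + 2))⁻¹ * v i - (m + 2) * z i * (‖z‖ ^ (m + 4))⁻¹ * inner ℝ v z)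
        * (z j * N (stdv j)) := by
    intro j
    rw [real_inner_comm]
    unfold kernelCoeff
    simp only [smul_apply, add_apply, smul_eq_mul, ContinuousLinearMap.comp_apply, h0, h2,
      innerSL_apply_apply, inner_sub_left, inner_smul_left, stdv_inner,
      inner_add_left, RCLike.conj_to_real]
    ring
  rw [Finset.sum_congr rfl fun j _ => h1 j]
  simp only [Finset.sum_sub_distrib, ← Finset.mul_sum, ← Finset.sum_mul, sum_coord_mul]
  simp only [hL, hv, smul_apply, add_apply, smul_eq_mul, pow_add]
  field_simp
  ring

/-- The vector field `V` is differentiable at `z` with divergence `d`. -/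
def HasDivAt (V : Euc m → Euc m) (d : ℝ) (z : Euc m) : Prop :=
  ∃ T : Euc m →L[ℝ] Euc m, HasFDerivAt V T z ∧ ∑ i, T (stdv i) i = d

theorem HasDivAt.add {V W : Euc m → Euc m} {d e : ℝ} {z : Euc m} (hV : HasDivAt V d z)
    (hW : HasDivAt W e z) : HasDivAt (fun z => V z + W z) (d + e) z := by
  obtain ⟨T, hT, rfl⟩ := hV
  obtain ⟨S, hS, rfl⟩ := hW
  exact ⟨T + S, hT.add hS, by simp [Finset.sum_add_distrib]⟩

theorem HasDivAt.smul {V : Euc m → Euc m} {d : ℝ} {z : Euc m} (hV : HasDivAt V d z)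
    {f : Euc m → ℝ} {f' : Euc m →L[ℝ] ℝ} (hf : HasFDerivAt f f' z) :
    HasDivAt (fun z => f z • V z) (f z * d + f' (V z)) z := by
  obtain ⟨T, hT, rfl⟩ := hV
  refine ⟨_, hf.smul hT, ?_⟩
  simp only [add_apply, smul_apply, ContinuousLinearMap.smulRight_apply, PiLp.add_apply,
    PiLp.smul_apply, smul_eq_mul, Finset.sum_add_distrib, ← Finset.mul_sum]
  congr 1
  rw [← sum_coord_mul f' (V z)]
  exact Finset.sum_congr rfl fun i _ => mul_comm _ _

theorem hasDivAt_const (a z : Euc m) : HasDivAt (fun _ => a) 0 z :=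
  ⟨0, hasFDerivAt_const a z, by simp⟩

theorem hasDivAt_id (z : Euc m) : HasDivAt (fun z => z) m z :=
  ⟨_, hasFDerivAt_id z, by simp⟩

/-- The Laplacian is the divergence of the gradient. The product rule for divergences then replaces
an expansion of second derivatives. -/
theorem laplacian_eq_of_hasDivAt {f : Euc m → ℝ} {G : Euc m → Euc m} {d : ℝ} {z : Euc m}
    (hf : ∀ᶠ x in nhds z, HasFDerivAt f (innerSL ℝ (G x)) x) (hG : HasDivAt G d z) :
    Laplacian.laplacian f z = d := by
  obtain ⟨T, hT, rfl⟩ := hG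
  have h1 : fderiv ℝ f =ᶠ[nhds z] fun x => innerSL ℝ (G x) := by
    filter_upwards [hf] with x hx using hx.fderiv
  have h2 : fderiv ℝ (fderiv ℝ f) z = (innerSL ℝ (E := Euc m) : Euc m →L[ℝ] Euc m →L[ℝ] ℝ) ∘L T := by
    rw [h1.fderiv_eq]
    exact ((innerSL ℝ (E := Euc m) : Euc m →L[ℝ] Euc m →L[ℝ] ℝ).hasFDerivAt.comp z hT).fderiv
  rw [InnerProductSpace.laplacian_eq_iteratedFDeriv_orthonormalBasis f
    (EuclideanSpace.basisFun (Fin m) ℝ)]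
  refine Finset.sum_congr rfl fun i _ => ?_
  simp only [iteratedFDeriv_two_apply, h2, EuclideanSpace.basisFun_apply, Matrix.cons_val_zero,
    Matrix.cons_val_one, ContinuousLinearMap.comp_apply]
  exact inner_stdv _ _

/-- The gradient of `q` at `reflect z v`, as a vector field in `z`. -/
def gradReflect (q : Euc m → ℝ) (v z : Euc m) : Euc m :=
  ∑ j, dirD (stdv j) q (reflect z v) • stdv j

theorem inner_gradReflect (q : Euc m → ℝ) (v z a : Euc m) :
    inner ℝ (gradReflect q v z) a = fderiv ℝ q (reflect z v) a := by
  rw [gradReflect, sum_inner, ← sum_coord_mul]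
  refine Finset.sum_congr rfl fun i _ => ?_
  rw [inner_smul_left, stdv_inner]
  simp [dirD, mul_comm]

/-- The trace of the Hessian vanishes, and the terms in `P z z` cancel once `P z v` is rewritten by
`Solid.snd_reflect`. -/
theorem hasDivAt_gradReflect (hq : Solid k q) {z : Euc m} (hz : z ≠ 0) (v : Euc m) :
    HasDivAt (gradReflect q v) (-(2 / ‖z‖ ^ 2) * (k - 1) * fderiv ℝ q (reflect z v) z) z := by
  have hn : ‖z‖ ≠ 0 := norm_ne_zero_iff.2 hz
  refine ⟨_, HasFDerivAt.fun_sum fun j _ => (((hq.dirD (stdv j)).hasFDerivAt (reflect z v)).comp z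
    (hasFDerivAt_reflect hz v)).smul_const (stdv j), ?_⟩
  set P := fderiv ℝ (fderiv ℝ q) (reflect z v) with hP
  have h0 : ∀ j a, fderiv ℝ (dirD (stdv j) q) (reflect z v) a = P a (stdv j) :=
    fun j a => dirD_dirD hq.smooth a (stdv j) (reflect z v)
  have hs : P z v = P v z := snd_symm hq.smooth _ _ _
  have hv : P v z = (k - 1) * fderiv ℝ q (reflect z v) z + 2 * inner ℝ v z / ‖z‖ ^ 2 * P z z :=
    hq.snd_reflect z v z
  have e2 : ∑ i, P (stdv i) (stdv i) = 0 := hq.trace _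
  have h1 : ∀ i, (∑ j, (fderiv ℝ (dirD (stdv j) q) (reflect z v) ∘L reflectDeriv z v).smulRight
      (stdv j)) (stdv i) i = (-(2 / ‖z‖ ^ 2)) * (v i * P z (stdv i) +
        inner ℝ v z * P (stdv i) (stdv i) - 2 * inner ℝ v z / ‖z‖ ^ 2 * (z i * P z (stdv i))) := by
    intro i
    have h3 : (∑ j, (fderiv ℝ (dirD (stdv j) q) (reflect z v) ∘L reflectDeriv z v).smulRight
      (stdv j)) (stdv i) i = P (reflectDeriv z v (stdv i)) (stdv i) := by
      simp [h0, Pi.single_apply]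
    rw [h3, reflectDeriv_apply, inner_stdv, inner_stdv]
    simp only [map_smul, map_add, map_sub, smul_apply, sub_apply, add_apply, smul_eq_mul]
  rw [Finset.sum_congr rfl fun i _ => h1 i]
  simp only [← Finset.mul_sum, Finset.sum_add_distrib, Finset.sum_sub_distrib, sum_coord_mul, e2,
    hs, hv]
  ring

/-- The gradient in `z` of the kernel. -/
theorem hasFDerivAt_kernelFun (hq : Solid k q) (i : Fin m) {z : Euc m} (hz : z ≠ 0) (v : Euc m) :
    HasFDerivAt (fun z => kernelFun i q z v) (innerSL ℝ (
      ((‖z‖ ^ m)⁻¹ * q (reflect z v)) • stdv i +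
      ((-m * (z i * (‖z‖ ^ (m + 2))⁻¹)) * q (reflect z v)) • z +
      (-2 * (z i * (‖z‖ ^ (m + 2))⁻¹) * fderiv ℝ q (reflect z v) z) • v +
      (-2 * (z i * (‖z‖ ^ (m + 2))⁻¹) * inner ℝ v z) • gradReflect q v z +
      (4 * (z i * (‖z‖ ^ (m + 4))⁻¹) * inner ℝ v z * fderiv ℝ q (reflect z v) z) • z)) z := by
  have hn : ‖z‖ ≠ 0 := norm_ne_zero_iff.2 hz
  refine (hasFDerivAt_mul_reflect hq
    (hasFDerivAt_coord_mul_inv_norm_pow i m hz) hz v).congr_fderiv ?_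
  ext a
  simp only [innerSL_apply_apply, smul_apply, add_apply, sub_apply, smul_eq_mul, inner_gradReflect, reflectDeriv_apply,
    ContinuousLinearMap.comp_apply, map_smul, map_add, map_sub, pow_add]
  field_simp
  ring

theorem laplacian_kernelFun (hq : Solid k q) (i : Fin m) {z : Euc m} (hz : z ≠ 0) (v : Euc m) :
    Laplacian.laplacian (fun z => kernelFun i q z v) z = (‖z‖ ^ (m + 2))⁻¹ *
      (-4 * inner ℝ v z * fderiv ℝ q (reflect z v) (stdv i) - 4 * v i * fderiv ℝ q (reflect z v) z
        - 4 * z i * k * q (reflect z v)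
        + 4 * (m + 2 * k - 2) * z i * inner ℝ v z / ‖z‖ ^ 2 * fderiv ℝ q (reflect z v) z
        + 4 * z i * ‖v‖ ^ 2 / ‖z‖ ^ 2 * fderiv ℝ (fderiv ℝ q) (reflect z v) z z) := by
  have hn : ‖z‖ ≠ 0 := norm_ne_zero_iff.2 hz
  have hs := (hq.hasFDerivAt (reflect z v)).comp z (hasFDerivAt_reflect hz v)
  have hσ : HasFDerivAt (fun z : Euc m => inner ℝ v z) (innerSL ℝ v) z :=
    (innerSL ℝ v).hasFDerivAt
  have hN := ((hq.hasFDerivAt_fderiv (reflect z v)).comp z (hasFDerivAt_reflect hz v)).clm_apply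
    (hasFDerivAt_id z)
  have hy2 := hasFDerivAt_coord_mul_inv_norm_pow i (m + 2) hz
  have hy4 := hasFDerivAt_coord_mul_inv_norm_pow i (m + 4) hz
  -- The five summands of the gradient in `hasFDerivAt_kernelFun`, each a scalar function times a
  -- constant field, the identity field, or `gradReflect`.
  have d1 := (hasDivAt_const (stdv i) z).smul ((hasFDerivAt_inv_norm_pow m hz).mul hs)
  have d2 := (hasDivAt_id z).smul ((hy2.const_mul (-m)).mul hs)
  have d3 := (hasDivAt_const v z).smul ((hy2.const_mul (-2)).mul hN)
  have d4 := (hasDivAt_gradReflect hq hz v).smul ((hy2.const_mul (-2)).mul hσ)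
  have d5 := (hasDivAt_id z).smul (((hy4.const_mul 4).mul hσ).mul hN)
  have hd := (((d1.add d2).add d3).add d4).add d5
  have hev : ∀ᶠ x in nhds z, x ≠ 0 := isOpen_compl_singleton.mem_nhds hz
  refine (laplacian_eq_of_hasDivAt (hev.mono fun x hx => hasFDerivAt_kernelFun hq i hx v) hd).trans ?_
  set P := fderiv ℝ (fderiv ℝ q) (reflect z v)
  set N := fderiv ℝ q (reflect z v) with hN
  have hL : P (reflectDeriv z v v) = (-(2 / ‖z‖ ^ 2)) • (‖v‖ ^ 2 • P z +
      (inner ℝ v z * (k - 1)) • N) := by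
    ext a
    have h3 : P (reflect z v) a = (k - 1) * N a := hq.snd_self _ _
    rw [reflectDeriv_apply', real_inner_self_eq_norm_sq]
    simp only [map_smul, map_add, smul_apply, add_apply, smul_eq_mul, h3]
    ring
  have hv : N v = k * q (reflect z v) + 2 * inner ℝ v z / ‖z‖ ^ 2 * N z := hq.fst_reflect z v
  have hLi : N (reflectDeriv z v (stdv i)) = (-(2 / ‖z‖ ^ 2)) * (v i * N z + inner ℝ v z * N (stdv i)
      - 2 * inner ℝ v z / ‖z‖ ^ 2 * (z i * N z)) := by
    rw [reflectDeriv_apply, inner_stdv, inner_stdv]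
    simp only [map_smul, map_add, map_sub, smul_eq_mul]
  have hLg : N (reflectDeriv z v v) = (-(2 / ‖z‖ ^ 2)) * (‖v‖ ^ 2 * N z + inner ℝ v z * N v
      - 2 * inner ℝ v z / ‖z‖ ^ 2 * (inner ℝ v z * N z)) := by
    rw [reflectDeriv_apply, real_inner_self_eq_norm_sq, real_inner_comm v z]
    simp only [map_smul, map_add, map_sub, smul_eq_mul]
  have hg : ∀ a, inner ℝ a (gradReflect q v z) = N a := fun a => by
    rw [real_inner_comm, inner_gradReflect]
  simp only [add_apply, smul_apply, sub_apply, ContinuousLinearMap.comp_apply, smul_eq_mul,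
    innerSL_apply_apply, map_sub, map_smul, Pi.mul_apply,
    stdv_inner, hg, hLi, reflectDeriv_self, real_inner_self_eq_norm_sq, Function.comp_apply,
    ContinuousLinearMap.flip_apply, ContinuousLinearMap.id_apply, id, map_zero, zero_apply, hL,
    ← hN, inner_stdv, real_inner_comm z v, hv, pow_add]
  push_cast
  field_simp
  ring

/-- After division by `α = m + 2k - 2` and `β = m + 2k - 4`, the terms in `q`, `N (stdv i)`, `N z`,
`P z (stdv i)` and `P z z` cancel separately. The hypotheses on `m` and `k` keep both denominators
nonzero. -/
theorem bosonicLaplacian_kernelFun (hq : Solid k q) (hm : 2 < m) (i : Fin m) {z : Euc m}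
    (hk : 1 ≤ k) (hz : z ≠ 0) (v : Euc m) :
    bosonicLaplacian k (kernelFun i q) z v = 0 := by
  have hn : ‖z‖ ≠ 0 := norm_ne_zero_iff.2 hz
  have hm' : (2 : ℝ) < m := by exact_mod_cast hm
  have hk' : (1 : ℝ) ≤ k := by exact_mod_cast hk
  have h1 : (m : ℝ) + 2 * k - 2 ≠ 0 := by linarith
  have h2 : (m : ℝ) + 2 * k - 4 ≠ 0 := by linarith
  rw [bosonicLaplacian, laplacian_kernelFun hq i hz, uDx_duDx_kernelFun hq i hz,
    duDx_duDx_kernelFun hq i hz]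
  generalize hα : (m : ℝ) + 2 * k - 2 = α at *
  generalize hβ : (m : ℝ) + 2 * k - 4 = β at *
  field_simp
  ring

end

/-! ### Gaussian integrals of harmonic polynomials composed with `z ↦ |z|² reflect z v`. -/

section

variable {m k : ℕ}

/-- The function `f` is given by a polynomial in the coordinates. -/
def IsPoly (f : Euc m → ℝ) : Prop := ∃ P : MvPolynomial (Fin m) ℝ, f = polyFun P

theorem isPoly_const (c : ℝ) : IsPoly (fun _ : Euc m => c) :=
  ⟨MvPolynomial.C c, by ext; simp [polyFun]⟩

theorem isPoly_coord (i : Fin m) : IsPoly (fun z : Euc m => z i) :=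
  ⟨MvPolynomial.X i, by ext; simp [polyFun]⟩

theorem IsPoly.add {f g : Euc m → ℝ} (hf : IsPoly f) (hg : IsPoly g) :
    IsPoly fun z => f z + g z := by
  obtain ⟨P, rfl⟩ := hf
  obtain ⟨Q, rfl⟩ := hg
  exact ⟨P + Q, by ext; simp [polyFun]⟩

theorem IsPoly.mul {f g : Euc m → ℝ} (hf : IsPoly f) (hg : IsPoly g) :
    IsPoly fun z => f z * g z := by
  obtain ⟨P, rfl⟩ := hf
  obtain ⟨Q, rfl⟩ := hg
  exact ⟨P * Q, by ext; simp [polyFun]⟩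

theorem isPoly_sum {ι : Type*} (s : Finset ι) {f : ι → Euc m → ℝ} (hf : ∀ i ∈ s, IsPoly (f i)) :
    IsPoly fun z => ∑ i ∈ s, f i z := by
  classical
  induction s using Finset.induction_on with
  | empty => simpa using isPoly_const 0
  | insert a s ha ih =>
    simp only [Finset.sum_insert ha]
    exact (hf a (Finset.mem_insert_self a s)).add
      (ih fun i hi => hf i (Finset.mem_insert_of_mem hi))

theorem isPoly_inner (v : Euc m) : IsPoly fun z : Euc m => inner ℝ v z := by
  simp only [← sum_coord_coord]
  exact isPoly_sum _ fun i _ => (isPoly_const (v i)).mul (isPoly_coord i)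

theorem isPoly_norm_sq : IsPoly fun z : Euc m => ‖z‖ ^ 2 := by
  simp only [← sum_sq_coord]
  exact isPoly_sum _ fun i _ => (isPoly_coord i).mul (isPoly_coord i)

theorem isPoly_comp (P : MvPolynomial (Fin m) ℝ) {W : Euc m → Euc m}
    (hW : ∀ i, IsPoly fun z => W z i) : IsPoly fun z => polyFun P (W z) := by
  induction P using MvPolynomial.induction_on with
  | C a => simpa [polyFun] using isPoly_const a
  | add p q hp hq =>
    have := hp.add hq
    simpa [polyFun] using this
  | mul_X p j hp =>
    have := hp.mul (hW j)
    simpa [polyFun] using this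

theorem IsPoly.contDiff {f : Euc m → ℝ} (hf : IsPoly f) : ContDiff ℝ ∞ f := by
  obtain ⟨P, rfl⟩ := hf; exact polyFun_contDiff P

theorem IsPoly.dirD {f : Euc m → ℝ} (hf : IsPoly f) (a : Euc m) : IsPoly (dirD a f) := by
  obtain ⟨P, rfl⟩ := hf
  have : Bosonic.dirD a (polyFun P) = fun z => ∑ i, polyFun (MvPolynomial.pderiv i P) z * a i := by
    ext z
    unfold Bosonic.dirD
    rw [(polyFun_hasFDerivAt P z).fderiv]
    simp
  rw [this]
  exact isPoly_sum _ fun i _ => IsPoly.mul ⟨_, rfl⟩ (isPoly_const _)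

theorem IsPoly.bound {f : Euc m → ℝ} (hf : IsPoly f) :
    ∃ (C : ℝ) (N : ℕ), 0 ≤ C ∧ ∀ z, |f z| ≤ C * (1 + ‖z‖) ^ N := by
  obtain ⟨P, rfl⟩ := hf
  induction P using MvPolynomial.induction_on with
  | C a => exact ⟨|a|, 0, abs_nonneg a, fun z => by simp [polyFun]⟩
  | add p q hp hq =>
    obtain ⟨C, N, hC, h⟩ := hp
    obtain ⟨D, M, hD, h'⟩ := hq
    refine ⟨C + D, N + M, by positivity, fun z => ?_⟩
    have h1 : (1 : ℝ) ≤ 1 + ‖z‖ := by linarith [norm_nonneg z]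
    calc |polyFun (p + q) z| ≤ |polyFun p z| + |polyFun q z| := by
          simpa [polyFun] using abs_add_le _ _
      _ ≤ C * (1 + ‖z‖) ^ (N + M) + D * (1 + ‖z‖) ^ (N + M) := by
          refine add_le_add ((h z).trans ?_) ((h' z).trans ?_)
          · exact mul_le_mul_of_nonneg_left (pow_le_pow_right₀ h1 (by omega)) hC
          · exact mul_le_mul_of_nonneg_left (pow_le_pow_right₀ h1 (by omega)) hD
      _ = _ := by ring
  | mul_X p j hp =>
    obtain ⟨C, N, hC, h⟩ := hp
    refine ⟨C, N + 1, hC, fun z => ?_⟩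
    have h2 : |z j| ≤ 1 + ‖z‖ := (PiLp.norm_apply_le z j).trans (by linarith)
    calc |polyFun (p * MvPolynomial.X j) z| = |polyFun p z| * |z j| := by simp [polyFun, abs_mul]
      _ ≤ (C * (1 + ‖z‖) ^ N) * (1 + ‖z‖) :=
          mul_le_mul (h z) h2 (abs_nonneg _) (by positivity)
      _ = _ := by ring

/-- The Gaussian weight. -/
def gauss (z : Euc m) : ℝ := Real.exp (-‖z‖ ^ 2)

theorem pow_mul_exp_neg_sq_le (M : ℕ) {r : ℝ} (hr : 0 ≤ r) :
    (1 + r) ^ M * Real.exp (-r ^ 2) ≤ M.factorial * Real.exp 2 := by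
  have h1 := Real.pow_div_factorial_le_exp (1 + r) (by linarith) M
  have hf : (0 : ℝ) < M.factorial := by exact_mod_cast M.factorial_pos
  rw [div_le_iff₀ hf] at h1
  calc (1 + r) ^ M * Real.exp (-r ^ 2) ≤ (Real.exp (1 + r) * M.factorial) * Real.exp (-r ^ 2) :=
        mul_le_mul_of_nonneg_right h1 (Real.exp_pos _).le
    _ = M.factorial * Real.exp (1 + r + -r ^ 2) := by rw [Real.exp_add (1 + r)]; ring
    _ ≤ _ := by
        refine mul_le_mul_of_nonneg_left (Real.exp_le_exp.2 ?_) hf.le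
        nlinarith [sq_nonneg (r - 1 / 2)]

theorem continuous_gauss : Continuous (gauss (m := m)) := by unfold gauss; fun_prop

theorem IsPoly.integrable {f : Euc m → ℝ} (hf : IsPoly f) :
    Integrable fun z => f z * gauss z := by
  obtain ⟨C, N, hC, h⟩ := hf.bound
  -- Comparison with `(1 + ‖z‖)^{-(m+1)}`, integrable in dimension `m`; the Gaussian absorbs the
  -- growth of the polynomial together with the extra factor.
  have hi := (integrable_one_add_norm (E := Euc m) (μ := volume) (r := m + 1)
    (by simp)).const_mul (C * ((N + (m + 1)).factorial * Real.exp 2))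
  refine hi.mono' (hf.contDiff.continuous.mul continuous_gauss).aestronglyMeasurable
    (Filter.Eventually.of_forall fun z => ?_)
  have h0 : (0 : ℝ) < 1 + ‖z‖ := by positivity
  have h1 := pow_mul_exp_neg_sq_le (N + (m + 1)) (norm_nonneg z)
  rw [Real.rpow_neg h0.le, ← div_eq_mul_inv]
  have h3 : (1 + ‖z‖) ^ ((m : ℝ) + 1) = (1 + ‖z‖) ^ (m + 1) := by exact_mod_cast Real.rpow_natCast _ _
  rw [h3, le_div_iff₀ (by positivity), norm_mul, Real.norm_eq_abs, Real.norm_eq_abs,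
    abs_of_nonneg (show 0 ≤ gauss z from (Real.exp_pos _).le)]
  calc |f z| * gauss z * (1 + ‖z‖) ^ (m + 1)
      ≤ (C * (1 + ‖z‖) ^ N) * gauss z * (1 + ‖z‖) ^ (m + 1) := by
        have : 0 ≤ gauss z := (Real.exp_pos _).le
        gcongr
        exact h z
    _ = C * ((1 + ‖z‖) ^ (N + (m + 1)) * Real.exp (-‖z‖ ^ 2)) := by unfold gauss; ring
    _ ≤ _ := mul_le_mul_of_nonneg_left h1 hC

theorem hasFDerivAt_gauss (z : Euc m) :
    HasFDerivAt gauss ((-2 * gauss z) • innerSL ℝ z) z := by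
  refine ((hasStrictFDerivAt_norm_sq z).hasFDerivAt.neg.exp).congr_fderiv ?_
  ext a
  simp [gauss]
  ring

/-- Integration by parts with `∇ gauss = -2 z gauss`; polynomials times the Gaussian are integrable,
so there is no boundary term. -/
theorem IsPoly.integral_dirD {f : Euc m → ℝ} (hf : IsPoly f) (a : Euc m) :
    ∫ z, Bosonic.dirD a f z * gauss z = 2 * ∫ z, inner ℝ a z * f z * gauss z := by
  have hg : ∀ z : Euc m, fderiv ℝ gauss z a = -2 * (inner ℝ a z * gauss z) := fun z => by
    rw [(hasFDerivAt_gauss z).fderiv, real_inner_comm z a]; simp; ring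
  have h := integral_mul_fderiv_eq_neg_fderiv_mul_of_integrable (μ := volume) (f := f)
    (g := gauss) (v := a) (hf.dirD a).integrable ?_ hf.integrable
    (fun z _ => hf.contDiff.differentiable (by simp) z)
    (fun z _ => (hasFDerivAt_gauss z).differentiableAt)
  · have h2 : ∀ z, f z * fderiv ℝ gauss z a = (-2) * (inner ℝ a z * f z * gauss z) := fun z => by
      rw [hg]; ring
    simp only [h2, integral_const_mul] at h
    unfold Bosonic.dirD
    linarith
  · have := ((isPoly_inner a).mul hf).integrable.const_mul (-2)
    refine this.congr (Filter.Eventually.of_forall fun z => ?_)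
    simp only [hg]; ring

/-- The divergence theorem for polynomial vector fields with the Gaussian weight. -/
theorem integral_div_gauss {V : Fin m → Euc m → ℝ} (hV : ∀ i, IsPoly (V i)) :
    ∫ z, (∑ i, dirD (stdv i) (V i) z) * gauss z = 2 * ∫ z, (∑ i, z i * V i z) * gauss z := by
  simp only [Finset.sum_mul]
  rw [integral_finsetSum _ fun i _ => ((hV i).dirD (stdv i)).integrable,
    integral_finsetSum _ fun i _ => ((isPoly_coord i).mul (hV i)).integrable, Finset.mul_sum]
  refine Finset.sum_congr rfl fun i _ => ?_
  rw [(hV i).integral_dirD]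
  simp only [stdv_inner]

/-- The quadratic map `z ↦ |z|² reflect z v`. -/
def quadReflect (v z : Euc m) : Euc m := ‖z‖ ^ 2 • v - (2 * inner ℝ v z) • z

theorem isPoly_quadReflect (v : Euc m) (i : Fin m) : IsPoly fun z => quadReflect v z i := by
  have : (fun z => quadReflect v z i) = fun z : Euc m =>
      ‖z‖ ^ 2 * v i + ((-2) * inner ℝ v z) * z i := by
    ext z; simp [quadReflect]; ring
  rw [this]
  exact (isPoly_norm_sq.mul (isPoly_const _)).add
    (((isPoly_const _).mul (isPoly_inner v)).mul (isPoly_coord i))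

theorem hasFDerivAt_quadReflect (v z : Euc m) : HasFDerivAt (quadReflect v)
    ((2 • innerSL ℝ z).smulRight v - ((2 * inner ℝ v z) • ContinuousLinearMap.id ℝ (Euc m) +
      ((2 : ℝ) • innerSL ℝ v).smulRight z)) z := by
  have h1 : HasFDerivAt (fun z : Euc m => 2 * inner ℝ v z) ((2 : ℝ) • innerSL ℝ v) z :=
    (innerSL ℝ v).hasFDerivAt.const_mul 2
  exact ((hasStrictFDerivAt_norm_sq z).hasFDerivAt.smul_const v).sub (h1.smul (hasFDerivAt_id z))

/-- The derivative of a harmonic polynomial in a direction is a harmonic polynomial. -/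
theorem exists_dirD_mem {p : MvPolynomial (Fin m) ℝ} (hp : p ∈ harmonicPoly m (k + 1)) (a : Euc m) :
    ∃ p' ∈ harmonicPoly m k, polyFun p' = dirD a (polyFun p) := by
  have hj : ∀ j, MvPolynomial.pderiv j p ∈ harmonicPoly m k := by
    intro j
    rw [mem_harmonicPoly_iff_harm]
    refine ⟨((mem_harmonicPoly p).1 hp).1.pderiv, ?_⟩
    rw [← dirD_stdv_polyFun]
    exact ((solid_polyFun hp).dirD (stdv j)).harm
  refine ⟨∑ j, a j • MvPolynomial.pderiv j p,
    Submodule.sum_mem _ fun j _ => Submodule.smul_mem _ _ (hj j), ?_⟩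
  ext w
  rw [polyFun_sum]
  unfold dirD
  rw [(polyFun_hasFDerivAt p w).fderiv]
  simp [polyFun, mul_comm]

/-- The Gaussian divergence theorem is applied to `V = z p'(W) - 2⟨v, z⟩ ∇p(W)` with `W =
quadReflect v z`. The field is chosen so that `⟨z, V⟩` is the derivative of `p` at `W` along `W`
itself, which Euler's identity evaluates. Its divergence is a multiple of `p'(W)`. -/
theorem integral_quadReflect_succ {p p' : MvPolynomial (Fin m) ℝ} (v : Euc m)
    (hp : p ∈ harmonicPoly m (k + 1)) (hp' : polyFun p' = dirD v (polyFun p)) :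
    2 * (k + 1) * ∫ z, polyFun p (quadReflect v z) * gauss z =
      (m + 2 * k - 2) * ∫ z, polyFun p' (quadReflect v z) * gauss z := by
  have hq := solid_polyFun hp
  have hd : ∀ i, IsPoly (fun z => dirD (stdv i) (polyFun p) (quadReflect v z)) := fun i => by
    rw [dirD_stdv_polyFun]; exact isPoly_comp _ (isPoly_quadReflect v)
  have hp'' : IsPoly (fun z => polyFun p' (quadReflect v z)) := isPoly_comp _ (isPoly_quadReflect v)
  set V : Fin m → Euc m → ℝ := fun i z => z i * polyFun p' (quadReflect v z) +
    ((-2) * inner ℝ v z) * dirD (stdv i) (polyFun p) (quadReflect v z) with hVdef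
  have hV : ∀ i, IsPoly (V i) := fun i => ((isPoly_coord i).mul hp'').add
    (((isPoly_const _).mul (isPoly_inner v)).mul (hd i))
  have key := integral_div_gauss hV
  have hR : ∀ z, ∑ i, z i * V i z = (k + 1) * polyFun p (quadReflect v z) := by
    intro z
    have h1 : ∀ i, z i * V i z = polyFun p' (quadReflect v z) * (z i * z i) + (-2 * inner ℝ v z) *
        (z i * fderiv ℝ (polyFun p) (quadReflect v z) (stdv i)) := by
      intro i; simp only [hVdef, dirD]; ring
    rw [Finset.sum_congr rfl fun i _ => h1 i]
    rw [Finset.sum_add_distrib, ← Finset.mul_sum, ← Finset.mul_sum, sum_coord_mul, sum_sq_coord, hp',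
      dirD]
    have h2 := hq.euler (quadReflect v z)
    have h3 : ∀ T : Euc m →L[ℝ] ℝ, T (quadReflect v z) = ‖z‖ ^ 2 * T v - 2 * inner ℝ v z * T z :=
      fun T => by simp [quadReflect]
    rw [h3] at h2
    push_cast at h2
    rw [← h2]
    ring
  have hL : ∀ z, ∑ i, dirD (stdv i) (V i) z = (m + 2 * k - 2) * polyFun p' (quadReflect v z) := by
    intro z
    set P := fderiv ℝ (fderiv ℝ (polyFun p)) (quadReflect v z) with hP
    set N := fderiv ℝ (polyFun p) (quadReflect v z) with hN
    set L := (2 • innerSL ℝ z).smulRight v - ((2 * inner ℝ v z) • ContinuousLinearMap.id ℝ (Euc m) +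
      ((2 : ℝ) • innerSL ℝ v).smulRight z) with hLdef
    have hW : HasFDerivAt (quadReflect v) L z := hasFDerivAt_quadReflect v z
    -- `W` is quadratic in `z`, so its radial derivative is `2W`; with Euler's identity for `p'` of
    -- degree `k` this yields the `2k` in the coefficient.
    have hLz : L z = (2 : ℝ) • quadReflect v z := by
      simp only [hLdef, quadReflect]
      simp
      module
    have hLi : ∀ i, L (stdv i) = (2 * z i) • v - (2 * inner ℝ v z) • stdv i - (2 * v i) • z := by
      intro i
      have h1 : inner ℝ z (stdv i) = z i := inner_stdv z i
      have h2 : inner ℝ v (stdv i) = v i := inner_stdv v i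
      simp [hLdef, h1, h2]
      module
    have hV' : ∀ i, dirD (stdv i) (V i) z = polyFun p' (quadReflect v z) +
        z i * (P.flip v ∘L L) (stdv i) - 2 * (v i * N (stdv i) +
          inner ℝ v z * P (L (stdv i)) (stdv i)) := by
      intro i
      have e1 := (hasFDerivAt_coord i z).mul
        (((hq.dirD v).hasFDerivAt (quadReflect v z)).comp z hW)
      have e2 := (((innerSL ℝ v).hasFDerivAt (x := z)).const_mul (-2)).mul
        (((hq.dirD (stdv i)).hasFDerivAt (quadReflect v z)).comp z hW)
      have h0 : ∀ j a, fderiv ℝ (dirD j (polyFun p)) (quadReflect v z) a = P a j :=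
        fun j a => dirD_dirD hq.smooth a j (quadReflect v z)
      have h1 : inner ℝ v (stdv i) = v i := inner_stdv v i
      have e3 := (e1.add e2).fderiv
      rw [← hp'] at e3
      refine (congrArg (fun T => T (stdv i)) e3).trans ?_
      simp [h0, h1, hp']
      simp only [dirD, ← hN]
      ring
    -- The field `z ↦ ∇p(W)` is divergence free: the rank-one parts of `L` cancel by symmetry of the
    -- Hessian, and its scalar part by harmonicity.
    have ht : ∑ i, P (L (stdv i)) (stdv i) = 0 := by
      have h1 : ∀ i, P (L (stdv i)) (stdv i) = 2 * (z i * P v (stdv i)) -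
          2 * inner ℝ v z * P (stdv i) (stdv i) - 2 * (v i * P z (stdv i)) := by
        intro i
        rw [hLi]
        simp only [map_sub, map_smul, sub_apply, smul_apply, smul_eq_mul]
        ring
      have h2 : ∑ i, P (stdv i) (stdv i) = 0 := hq.trace _
      have h3 : P v z = P z v := snd_symm hq.smooth _ _ _
      simp only [h1, Finset.sum_sub_distrib, ← Finset.mul_sum, sum_coord_mul, h2, h3]
      ring
    have hNv : N v = polyFun p' (quadReflect v z) := by rw [hp']; rfl
    have hPv : P (quadReflect v z) v = k * N v := by
      have := hq.snd_self (quadReflect v z) v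
      push_cast at this
      rw [this]; ring
    simp only [hV', Finset.sum_sub_distrib, Finset.sum_add_distrib, ← Finset.mul_sum, sum_coord_mul,
      ht, hNv]
    simp only [ContinuousLinearMap.comp_apply, ContinuousLinearMap.flip_apply, hLz, map_smul,
      hPv, hNv]
    simp
    ring
  simp only [hR, hL, mul_assoc, integral_const_mul] at key
  linarith

/-- Each step of the induction replaces `p` by its derivative along `v`, whose value at `v` is the
degree times `p(v)`. This factor cancels the `k + 1` of the recursion and leaves `m/2 + k - 1`. -/
theorem integral_quadReflect {p : MvPolynomial (Fin m) ℝ} (hp : p ∈ harmonicPoly m k) (v : Euc m) :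
    ∫ z, polyFun p (quadReflect v z) * gauss z =
      Real.pi ^ ((m : ℝ) / 2) * (∏ j ∈ Finset.range k, ((m : ℝ) / 2 + j - 1)) * polyFun p v := by
  induction k generalizing p with
  | zero =>
    have h1 : ∀ w : Euc m, polyFun p w = polyFun p v := by
      intro w
      have h0 := ((mem_harmonicPoly p).1 hp).1
      have h2 := polyFun_smul h0 0 w
      have h3 := polyFun_smul h0 0 v
      simp only [pow_zero, one_mul, zero_smul] at h2 h3
      rw [← h2, h3]
    have h2 : ∫ z : Euc m, gauss z = Real.pi ^ ((m : ℝ) / 2) := by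
      have := GaussianFourier.integral_rexp_neg_mul_sq_norm (V := Euc m) one_pos
      simpa [gauss] using this
    simp only [h1, integral_const_mul, h2]
    simp [mul_comm]
  | succ k ih =>
    obtain ⟨p', hp', he⟩ := exists_dirD_mem hp v
    have h1 := integral_quadReflect_succ v hp he
    rw [ih hp', he, dirD, (solid_polyFun hp).euler] at h1
    have hk : (k : ℝ) + 1 ≠ 0 := by positivity
    rw [Finset.prod_range_succ]
    push_cast at h1 ⊢
    refine mul_left_cancel₀ (mul_ne_zero two_ne_zero hk) (h1.trans ?_)
    ring

end

/-! ### From the Gaussian integral on `ℝ^{n+1}` to the hyperplane `y = 1`: the normalisation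
constant. -/

section

variable {n k : ℕ}

/-- The point `(t, y)` of `ℝ^{n+1}`. -/
def pt (t : Euc n) (y : ℝ) : Euc (n + 1) := WithLp.toLp 2 (Fin.snoc (α := fun _ => ℝ) (fun i => t i) y)

theorem pt_last (t : Euc n) (y : ℝ) : pt t y (Fin.last n) = y := by simp [pt]

theorem pt_castSucc (t : Euc n) (y : ℝ) (i : Fin n) : pt t y i.castSucc = t i := by simp [pt]

theorem bdry_eq_pt (t : Euc n) : bdry t = pt t 0 := rfl

theorem euc_ext {x y : Euc (n + 1)} (h : ∀ i : Fin n, x i.castSucc = y i.castSucc)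
    (h' : x (Fin.last n) = y (Fin.last n)) : x = y := by
  ext i
  exact Fin.lastCases h' h i

theorem pt_sub (t s : Euc n) (y z : ℝ) : pt (t - s) (y - z) = pt t y - pt s z :=
  euc_ext (fun i => by simp [pt_castSucc]) (by simp [pt_last])

theorem pt_smul (c : ℝ) (t : Euc n) (y : ℝ) : pt (c • t) (c * y) = c • pt t y :=
  euc_ext (fun i => by simp [pt_castSucc]) (by simp [pt_last])

theorem pt_tang_height (x : Euc (n + 1)) : pt (tang x) (height x) = x :=
  euc_ext (fun i => by simp [pt_castSucc, tang]) (by simp [pt_last, height])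

theorem norm_pt_sq (t : Euc n) (y : ℝ) : ‖pt t y‖ ^ 2 = ‖t‖ ^ 2 + y ^ 2 := by
  simp only [← sum_sq_coord, Fin.sum_univ_castSucc, pt_castSucc, pt_last]
  ring

theorem norm_pt_one_pos (t : Euc n) : 0 < ‖pt t 1‖ := by
  have := norm_pt_sq t 1
  nlinarith [sq_nonneg ‖t‖, norm_nonneg (pt t 1)]

theorem continuous_pt : Continuous fun p : Euc n × ℝ => pt p.1 p.2 := by
  unfold pt
  refine (PiLp.continuous_toLp 2 _).comp (continuous_pi fun i => ?_)
  refine Fin.lastCases ?_ (fun i => ?_) i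
  · simpa using continuous_snd
  · simp only [Fin.snoc_castSucc]
    exact (EuclideanSpace.proj (𝕜 := ℝ) i).continuous.comp continuous_fst

theorem measurePreserving_pt :
    MeasurePreserving (fun p : ℝ × Euc n => pt p.2 p.1) (volume.prod volume) volume := by
  have h1 := (volume_preserving_piFinSuccAbove (fun _ : Fin (n + 1) => ℝ) (Fin.last n)).symm
  have h2 := (MeasurePreserving.id (volume : Measure ℝ)).prod (PiLp.volume_preserving_ofLp (Fin n))
  have h3 := (PiLp.volume_preserving_toLp (Fin (n + 1))).comp (h1.comp h2)
  have he : (fun p : ℝ × Euc n => pt p.2 p.1) = WithLp.toLp 2 ∘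
      (MeasurableEquiv.piFinSuccAbove (fun _ : Fin (n + 1) => ℝ) (Fin.last n)).symm ∘
        Prod.map id WithLp.ofLp := by
    funext p
    refine euc_ext (fun i => ?_) ?_
    · rw [pt_castSucc]; simp [MeasurableEquiv.piFinSuccAbove]
    · rw [pt_last]; simp [MeasurableEquiv.piFinSuccAbove]
  rw [he]
  exact h3

theorem measurableEmbedding_pt :
    MeasurableEmbedding (fun p : ℝ × Euc n => pt p.2 p.1) := by
  refine Continuous.measurableEmbedding (continuous_pt.comp continuous_swap) ?_
  rintro ⟨y, t⟩ ⟨z, s⟩ h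
  have h1 : y = z := by simpa [pt_last] using congrArg (fun w : Euc (n + 1) => w (Fin.last n)) h
  have h2 : t = s := by
    ext i
    simpa [pt_castSucc] using congrArg (fun w : Euc (n + 1) => w i.castSucc) h
  rw [h1, h2]

theorem inv_norm_pt_pow (t : Euc n) : (‖pt t 1‖ ^ (n + 1))⁻¹ =
    (1 + ‖t‖ ^ 2) ^ (-((n : ℝ) + 1) / 2) := by
  have h := norm_pt_one_pos t
  have h1 : 1 + ‖t‖ ^ 2 = ‖pt t 1‖ ^ (2 : ℝ) := by
    have := norm_pt_sq t 1
    rw [Real.rpow_two, this]; ring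
  rw [h1, ← Real.rpow_mul h.le, ← Real.rpow_natCast, ← Real.rpow_neg h.le]
  congr 1
  push_cast
  ring

theorem integrable_inv_norm_pt_pow :
    Integrable fun t : Euc n => (‖pt t 1‖ ^ (n + 1))⁻¹ := by
  simp only [inv_norm_pt_pow]
  exact integrable_rpow_neg_one_add_norm_sq (by simp)

theorem integrable_abs_pow_mul_exp (N : ℕ) {b : ℝ} (hb : 0 < b) :
    Integrable fun y : ℝ => |y| ^ N * Real.exp (-b * y ^ 2) := by
  have h := (integrable_rpow_mul_exp_neg_mul_sq hb (s := N) (by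
    have : (0 : ℝ) ≤ N := by positivity
    linarith)).norm
  refine h.congr (Filter.Eventually.of_forall fun y => ?_)
  simp

theorem integral_abs_pow_mul_exp (N : ℕ) {r : ℝ} (hr : 0 < r) :
    ∫ y : ℝ, |y| ^ N * Real.exp (-r ^ 2 * y ^ 2) =
      Real.Gamma (((N : ℝ) + 1) / 2) * (r ^ (N + 1))⁻¹ := by
  have h1 := integral_comp_abs (f := fun y : ℝ => y ^ N * Real.exp (-r ^ 2 * y ^ 2))
  simp only [sq_abs] at h1
  rw [h1]
  have hN : (0 : ℝ) ≤ N := by positivity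
  have h2 := integral_rpow_mul_exp_neg_mul_rpow (p := 2) (q := N) (b := r ^ 2) two_pos
    (by linarith) (by positivity)
  simp only [Real.rpow_natCast, Real.rpow_two] at h2
  rw [h2]
  have h3 : (r ^ 2) ^ (-((N : ℝ) + 1) / 2) = (r ^ (N + 1))⁻¹ := by
    rw [← Real.rpow_two, ← Real.rpow_mul hr.le, ← Real.rpow_natCast, ← Real.rpow_neg hr.le]
    congr 1
    push_cast
    ring
  rw [h3]
  ring

/-- Reduction of Gaussian integrals of homogeneous functions to a hyperplane. -/
theorem integral_mul_gauss_eq {G : Euc (n + 1) → ℝ} (hG : Continuous G)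
    (hom : ∀ (y : ℝ) z, G (y • z) = y ^ (2 * k) * G z) {C : ℝ}
    (hC : ∀ z, |G z| ≤ C * ‖z‖ ^ (2 * k)) (hi : Integrable fun z => G z * gauss z) :
    ∫ z, G z * gauss z = Real.Gamma (((n : ℝ) + 1) / 2 + k) *
      ∫ t : Euc n, G (pt t 1) * (‖pt t 1‖ ^ (n + 2 * k + 1))⁻¹ := by
  -- `F y t` is the integrand after the substitution `z = y (t, 1)`; the Jacobian `|y|^n` and the
  -- homogeneity factor `y^{2k}` combine into `|y|^{n+2k}`.
  set F : ℝ → Euc n → ℝ := fun y t =>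
    G (pt t 1) * (|y| ^ (n + 2 * k) * Real.exp (-‖pt t 1‖ ^ 2 * y ^ 2)) with hF
  have hpt1 : Continuous fun t : Euc n => pt t 1 :=
    continuous_pt.comp (f := fun t : Euc n => (t, (1 : ℝ))) (by fun_prop)
  have hΓ : ((n : ℝ) + 2 * k + 1) / 2 = ((n : ℝ) + 1) / 2 + k := by ring
  have hFy : ∀ t, ∫ y, F y t = Real.Gamma (((n : ℝ) + 1) / 2 + k) *
      (G (pt t 1) * (‖pt t 1‖ ^ (n + 2 * k + 1))⁻¹) := by
    intro t
    simp only [hF, integral_const_mul, integral_abs_pow_mul_exp _ (norm_pt_one_pos t)]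
    push_cast
    rw [hΓ]; ring
  have hFn : ∀ t, ∫ y, ‖F y t‖ = Real.Gamma (((n : ℝ) + 1) / 2 + k) *
      (|G (pt t 1)| * (‖pt t 1‖ ^ (n + 2 * k + 1))⁻¹) := by
    intro t
    have : ∀ y, ‖F y t‖ = |G (pt t 1)| * (|y| ^ (n + 2 * k) * Real.exp (-‖pt t 1‖ ^ 2 * y ^ 2)) := by
      intro y
      rw [hF, norm_mul, Real.norm_eq_abs, Real.norm_eq_abs, abs_of_nonneg (a := _ * _) (by positivity)]
    simp only [this, integral_const_mul, integral_abs_pow_mul_exp _ (norm_pt_one_pos t)]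
    push_cast
    rw [hΓ]; ring
  have hFc : Continuous (Function.uncurry F) := by
    simp only [hF, Function.uncurry_def]
    have h1 : Continuous fun p : ℝ × Euc n => pt p.2 1 := hpt1.comp continuous_snd
    have h2 := hG.comp h1
    have h3 := h1.norm
    simp only [Function.comp_def] at h2
    fun_prop
  have hFi : Integrable (Function.uncurry F) (volume.prod volume) := by
    rw [integrable_prod_iff' hFc.aestronglyMeasurable]
    constructor
    · refine Filter.Eventually.of_forall fun t => ?_
      simp only [Function.uncurry_apply_pair, hF]
      exact (integrable_abs_pow_mul_exp _ (pow_pos (norm_pt_one_pos t) 2)).const_mul _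
    · simp only [Function.uncurry_apply_pair, hFn]
      refine Integrable.const_mul ?_ _
      refine (integrable_inv_norm_pt_pow.const_mul C).mono' ?_ (Filter.Eventually.of_forall fun t => ?_)
      · have h2 := hG.comp hpt1
        have h3 := hpt1.norm
        refine Continuous.aestronglyMeasurable (Continuous.mul h2.abs (Continuous.inv₀ (by fun_prop) ?_))
        intro t
        have := norm_pt_one_pos t
        positivity
      · have h := norm_pt_one_pos t
        rw [Real.norm_eq_abs, abs_of_nonneg (by positivity)]
        calc |G (pt t 1)| * (‖pt t 1‖ ^ (n + 2 * k + 1))⁻¹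
            ≤ (C * ‖pt t 1‖ ^ (2 * k)) * (‖pt t 1‖ ^ (n + 2 * k + 1))⁻¹ :=
              mul_le_mul_of_nonneg_right (hC _) (by positivity)
          _ = C * (‖pt t 1‖ ^ (n + 1))⁻¹ := by
              rw [show n + 2 * k + 1 = (n + 1) + 2 * k by ring, pow_add _ (n + 1)]
              field_simp
  have hi' := measurePreserving_pt.integrable_comp_emb measurableEmbedding_pt |>.2 hi
  simp only [Function.comp_def] at hi'
  rw [← measurePreserving_pt.integral_comp measurableEmbedding_pt, integral_prod _ hi']
  have hy : ∀ y : ℝ, y ≠ 0 → ∫ t : Euc n, G (pt t y) * gauss (pt t y) = ∫ t, F y t := by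
    intro y hy
    have h1 := Measure.integral_comp_smul (volume : Measure (Euc n))
      (fun t => G (pt t y) * gauss (pt t y)) y
    have h2 : ∀ t : Euc n, pt (y • t) y = y • pt t 1 := fun t => by rw [← pt_smul, mul_one]
    have h3 : ∀ t, F y t = |y| ^ n * (G (pt (y • t) y) * gauss (pt (y • t) y)) := by
      intro t
      rw [h2, hom, gauss, norm_smul, mul_pow, Real.norm_eq_abs, sq_abs, ← (even_two_mul k).pow_abs]
      simp only [hF, pow_add]
      ring_nf
    simp only [h3, integral_const_mul, h1, finrank_euclideanSpace_fin, abs_inv, abs_pow, smul_eq_mul]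
    rw [mul_inv_cancel_left₀ (pow_ne_zero _ (abs_ne_zero.2 hy))]
  -- The substitution degenerates only on the null slice `y = 0`.
  have hae : (fun y : ℝ => ∫ t : Euc n, G (pt t y) * gauss (pt t y)) =ᵐ[volume]
      fun y => ∫ t, F y t := by
    filter_upwards [compl_mem_ae_iff.2 (measure_singleton (0 : ℝ))] with y hy0
    exact hy y hy0
  rw [integral_congr_ae hae, integral_integral_swap hFi]
  simp only [hFy, integral_const_mul]

theorem quadReflect_eq {m : ℕ} (v : Euc m) {z : Euc m} (hz : z ≠ 0) :
    quadReflect v z = ‖z‖ ^ 2 • reflect z v := by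
  have hn : ‖z‖ ≠ 0 := norm_ne_zero_iff.2 hz
  rw [quadReflect, reflect, smul_sub, smul_smul]
  field_simp

theorem sphereArea_eq (hn : 1 ≤ n) :
    sphereArea n = 2 * Real.pi ^ ((n : ℝ) / 2) / Real.Gamma ((n : ℝ) / 2) := by
  have : Nonempty (Fin n) := ⟨⟨0, hn⟩⟩
  have hn' : (0 : ℝ) < n := by exact_mod_cast hn
  have hg : 0 < Real.Gamma ((n : ℝ) / 2) := Real.Gamma_pos_of_pos (by positivity)
  rw [sphereArea, surf, Measure.toSphere_real_apply_univ, measureReal_def,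
    EuclideanSpace.volume_ball, Real.Gamma_add_one (by positivity)]
  simp only [finrank_euclideanSpace_fin, ENNReal.ofReal_one, one_pow, one_mul, Fintype.card_fin]
  rw [ENNReal.toReal_ofReal (by positivity), Real.sqrt_eq_rpow, ← Real.rpow_natCast,
    ← Real.rpow_mul Real.pi_pos.le]
  rw [show 1 / 2 * (n : ℝ) = n / 2 by ring]
  field_simp

/-- With `s = m/2`, both sides telescope to `(s-1) s (s+1) ⋯ (s+k-1) Γ(s)`. This identity matches
the constant `c_{m,k}` with the two evaluations of the Gaussian integral. -/
theorem gamma_add_nat {s : ℝ} (hs : 1 < s) (k : ℕ) :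
    (s + k - 1) * (∏ j ∈ Finset.range k, (s + j - 1)) * Real.Gamma s =
      (s - 1) * Real.Gamma (s + k) := by
  induction k with
  | zero => simp
  | succ k ih =>
    have hk : (0 : ℝ) ≤ k := by positivity
    rw [Finset.prod_range_succ]
    push_cast
    rw [← add_assoc, Real.Gamma_add_one (by linarith)]
    linear_combination (s + k) * ih

/-- The normalised Poisson kernel reproduces constant boundary values. -/
theorem integral_poisson_const (hn : 2 ≤ n) {p : MvPolynomial (Fin (n + 1)) ℝ}
    (hp : p ∈ harmonicPoly (n + 1) k) (v : Euc (n + 1)) :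
    poissonConst (n + 1) k * ∫ t : Euc n, (‖pt t 1‖ ^ (n + 1))⁻¹ * polyFun p (reflect (pt t 1) v) =
      polyFun p v := by
  have hhom := fun s w => polyFun_smul ((mem_harmonicPoly p).1 hp).1 s w
  have hcont : Continuous (polyFun p) := (polyFun_contDiff p).continuous
  obtain ⟨C, hC⟩ := (isCompact_closedBall (0 : Euc (n + 1)) ‖v‖).exists_bound_of_continuousOn
    hcont.continuousOn
  have hpoly := isPoly_comp p (isPoly_quadReflect v)
  have hC0 : 0 ≤ C := (norm_nonneg _).trans (hC v (by simp))
  -- Passing from `reflect` to `quadReflect` multiplies by `|z|^{2k}`, which makes the integrand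
  -- polynomial and homogeneous of degree `2k`.
  have key := integral_mul_gauss_eq (k := k) (G := fun z => polyFun p (quadReflect v z)) (C := C)
    hpoly.contDiff.continuous ?_ ?_ hpoly.integrable
  · rw [integral_quadReflect hp] at key
    have h1 : ∀ t : Euc n, polyFun p (quadReflect v (pt t 1)) * (‖pt t 1‖ ^ (n + 2 * k + 1))⁻¹ =
        (‖pt t 1‖ ^ (n + 1))⁻¹ * polyFun p (reflect (pt t 1) v) := by
      intro t
      have h := norm_pt_one_pos t
      rw [quadReflect_eq v (norm_pos_iff.1 h), hhom, show n + 2 * k + 1 = (n + 1) + 2 * k by ring,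
        pow_add _ (n + 1), ← pow_mul]
      field_simp
    simp only [h1] at key
    have hn' : (2 : ℝ) ≤ n := by exact_mod_cast hn
    have hk' : (0 : ℝ) ≤ k := by positivity
    have hΓ := gamma_add_nat (s := ((n : ℝ) + 1) / 2) (by linarith) k
    have hg1 : 0 < Real.Gamma (((n : ℝ) + 1) / 2) := Real.Gamma_pos_of_pos (by positivity)
    have hg2 : 0 < Real.Gamma (((n : ℝ) + 1) / 2 + k) := Real.Gamma_pos_of_pos (by positivity)
    have hpi : 0 < Real.pi ^ (((n : ℝ) + 1) / 2) := Real.rpow_pos_of_pos Real.pi_pos _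
    rw [poissonConst, sphereArea_eq (by omega)]
    push_cast at key ⊢
    have h2 : (n : ℝ) + 1 - 2 ≠ 0 := by linarith
    have h3 : (n : ℝ) + 1 + 2 * k - 2 ≠ 0 := by linarith
    rw [← mul_right_inj' hg2.ne', ← mul_assoc, mul_comm (Real.Gamma _), mul_assoc, ← key]
    generalize (∏ x ∈ Finset.range k, (((n : ℝ) + 1) / 2 + x - 1)) = Q at *
    generalize Real.Gamma (((n : ℝ) + 1) / 2 + k) = g at *
    field_simp
    have h4 : ((n : ℝ) + 1) / 2 + k - 1 = ((n : ℝ) + 1 + 2 * k - 2) / 2 := by ring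
    rw [h4] at hΓ
    linear_combination 2 * polyFun p v * hΓ
  · intro y z
    have : quadReflect v (y • z) = y ^ 2 • quadReflect v z := by
      simp only [quadReflect, norm_smul, inner_smul_right, mul_pow, Real.norm_eq_abs, sq_abs]
      module
    simp only [this, hhom, pow_mul]
  · intro z
    by_cases hz : z = 0
    · have h0 : quadReflect v 0 = (0 : ℝ) ^ 2 • v := by simp [quadReflect]
      simp only [hz, h0, hhom, norm_zero]
      rw [← pow_mul, abs_mul, abs_of_nonneg (a := (0 : ℝ) ^ (2 * k)) (by positivity), mul_comm]
      exact mul_le_mul_of_nonneg_right (hC v (by simp)) (by positivity)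
    · simp only [quadReflect_eq v hz, hhom]
      rw [abs_mul, ← pow_mul, abs_of_nonneg (a := ‖z‖ ^ (2 * k)) (by positivity), mul_comm]
      exact mul_le_mul_of_nonneg_right (hC _ (by simp [norm_reflect])) (by positivity)

end

/-! ### Differentiation under the boundary integral for homogeneous kernels. -/

section

variable {n k : ℕ}

/-- Homogeneity of degree `-b` under positive dilations. -/
def HomNeg {m : ℕ} {F : Type} [NormedAddCommGroup F] [NormedSpace ℝ F] (b : ℕ) (G : Euc m → F) :
    Prop := ∀ s : ℝ, 0 < s → ∀ z, G (s • z) = (s ^ b)⁻¹ • G z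

theorem HomNeg.fderiv {m : ℕ} {F : Type} [NormedAddCommGroup F] [NormedSpace ℝ F] {b : ℕ}
    {G : Euc m → F} (h : HomNeg b G) : HomNeg (b + 1) (fderiv ℝ G) := by
  intro s hs z
  have h1 : _root_.fderiv ℝ (fun w => G (s • w)) z = s • _root_.fderiv ℝ G (s • z) :=
    fderiv_comp_smul s
  have h2 : (fun w => G (s • w)) = fun w => (s ^ b)⁻¹ • G w := funext fun w => h s hs w
  rw [h2, show (fun w => (s ^ b)⁻¹ • G w) = (s ^ b)⁻¹ • G from rfl,
    fderiv_const_smul_field, Pi.smul_apply] at h1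
  rw [pow_succ, mul_inv, mul_comm, mul_smul, h1, inv_smul_smul₀ hs.ne']

/-- The unit sphere is compact, and homogeneity transports the bound from there to all of `{0}ᶜ`. -/
theorem HomNeg.exists_bound {m : ℕ} {F : Type} [NormedAddCommGroup F] [NormedSpace ℝ F] {b : ℕ}
    {G : Euc m → F} (h : HomNeg b G) (hc : ContinuousOn G {0}ᶜ) :
    ∃ C, 0 ≤ C ∧ ∀ z, z ≠ 0 → ‖G z‖ ≤ C * (‖z‖ ^ b)⁻¹ := by
  obtain ⟨C, hC⟩ := (isCompact_sphere (0 : Euc m) 1).exists_bound_of_continuousOn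
    (hc.mono fun z hz => by
      rintro rfl
      simp at hz)
  refine ⟨max C 0, le_max_right _ _, fun z hz => ?_⟩
  have hz' : 0 < ‖z‖ := norm_pos_iff.2 hz
  have h1 : G z = (‖z‖ ^ b)⁻¹ • G (‖z‖⁻¹ • z) := by
    rw [← h _ hz', smul_inv_smul₀ hz'.ne']
  have h2 := hC (‖z‖⁻¹ • z) (by simp [norm_smul, hz'.ne'])
  rw [h1, norm_smul, mul_comm, Real.norm_of_nonneg (by positivity)]
  exact mul_le_mul_of_nonneg_right (h2.trans (le_max_left _ _)) (by positivity)

theorem height_sub_bdry (x : Euc (n + 1)) (t : Euc n) : height (x - bdry t) = height x := by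
  simp [height, bdry_eq_pt, pt_last]

theorem abs_height_le (x : Euc (n + 1)) : |height x| ≤ ‖x‖ := by
  have := PiLp.norm_apply_le x (Fin.last n)
  simpa [height] using this

theorem height_sub (x y : Euc (n + 1)) : height (x - y) = height x - height y := by
  simp [height]

theorem norm_bdry (t : Euc n) : ‖bdry t‖ = ‖t‖ := by
  have := norm_pt_sq t 0
  rw [bdry_eq_pt]
  rw [← sq_eq_sq₀ (norm_nonneg _) (norm_nonneg _), this]
  ring

theorem one_le_norm_pt_one (t : Euc n) : 1 ≤ ‖pt t 1‖ := by
  simpa [height, pt_last] using abs_height_le (pt t 1)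

theorem isOpen_upperHalf : IsOpen (upperHalf n) :=
  isOpen_lt continuous_const (EuclideanSpace.proj (𝕜 := ℝ) (Fin.last n)).continuous

theorem sub_bdry_ne_zero {x : Euc (n + 1)} (hx : x ∈ upperHalf n) (t : Euc n) :
    x - bdry t ≠ 0 := by
  intro h
  have := height_sub_bdry x t
  have hx' : 0 < height x := hx
  rw [← this, h] at hx'
  simp [height] at hx'

theorem continuous_bdry : Continuous (bdry : Euc n → Euc (n + 1)) :=
  continuous_pt.comp (f := fun t : Euc n => (t, (0 : ℝ))) (by fun_prop)

/-- Locally uniform comparison with the fixed weight `‖pt t 1‖`. On a ball of radius half the height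
of `x₀`, the distance to the boundary stays at least `ε`, so additive constants can be absorbed into
a multiple of `‖x - bdry t‖`. -/
theorem exists_norm_pt_le {x₀ : Euc (n + 1)} (hx : x₀ ∈ upperHalf n) :
    ∃ ε > 0, ∃ A > 0, ∀ x ∈ ball x₀ ε, x ∈ upperHalf n ∧ ∀ t, ‖pt t 1‖ ≤ A * ‖x - bdry t‖ := by
  have hx' : 0 < height x₀ := hx
  set ε := height x₀ / 2 with hε
  have hε0 : 0 < ε := by positivity
  refine ⟨ε, hε0, 1 + (‖x₀‖ + ε + 1) / ε, by positivity, fun x hxb => ?_⟩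
  rw [mem_ball_iff_norm] at hxb
  have h1 : ε ≤ height x := by
    have := abs_height_le (x - x₀)
    rw [height_sub] at this
    have := (abs_le.1 (this.trans hxb.le)).1
    linarith
  refine ⟨hε0.trans_le h1, fun t => ?_⟩
  have h2 : ε ≤ ‖x - bdry t‖ := by
    have := abs_height_le (x - bdry t)
    rw [height_sub_bdry] at this
    exact h1.trans ((le_abs_self _).trans this)
  have h3 : ‖pt t 1‖ ≤ ‖t‖ + 1 := by
    have := norm_pt_sq t 1
    nlinarith [norm_nonneg t, norm_nonneg (pt t 1)]
  have h4 : ‖t‖ ≤ ‖x - bdry t‖ + ‖x‖ := by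
    rw [← norm_bdry]
    have := norm_sub_le x (x - bdry t)
    rw [sub_sub_cancel] at this
    linarith
  have h5 : ‖x‖ ≤ ‖x₀‖ + ε := by
    have := norm_add_le (x - x₀) x₀
    rw [sub_add_cancel] at this
    linarith
  have h6 : ‖x₀‖ + ε + 1 ≤ (‖x₀‖ + ε + 1) / ε * ‖x - bdry t‖ := by
    rw [div_mul_eq_mul_div, le_div_iff₀ hε0]
    exact mul_le_mul_of_nonneg_left h2 (by positivity)
  linarith

section Convolution
variable {F : Type} [NormedAddCommGroup F] [NormedSpace ℝ F]

/-- The boundary potential `∫ a(t) G(x - t) dt`. -/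
def bdryConv (a : Euc n → ℝ) (G : Euc (n + 1) → F) (x : Euc (n + 1)) : F :=
  ∫ t, a t • G (x - bdry t)

theorem continuous_smul_sub_bdry {a : Euc n → ℝ} (ha : Continuous a) {G : Euc (n + 1) → F}
    (hc : ContinuousOn G {0}ᶜ) {x : Euc (n + 1)} (hx : x ∈ upperHalf n) :
    Continuous fun t => a t • G (x - bdry t) := by
  have h1 : Continuous fun t : Euc n => x - bdry t := continuous_const.sub continuous_bdry
  have h2 := hc.comp_continuous h1 fun t => sub_bdry_ne_zero hx t
  exact ha.smul h2

/-- Supplies a dominating function independent of `x` near `x₀`. Since `‖pt t 1‖ ≥ 1`, decay of any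
order `b ≥ n + 1` is bounded by decay of order `n + 1`. -/
theorem exists_bound_sub_bdry {b : ℕ} (hb : n + 1 ≤ b) {a : Euc n → ℝ} {M : ℝ}
    (hM : ∀ t, |a t| ≤ M) {G : Euc (n + 1) → F} (hc : ContinuousOn G {0}ᶜ) (hG : HomNeg b G)
    {x₀ : Euc (n + 1)} (hx : x₀ ∈ upperHalf n) :
    ∃ ε > 0, ∃ C, ∀ x ∈ ball x₀ ε, x ∈ upperHalf n ∧
      ∀ t, ‖a t • G (x - bdry t)‖ ≤ C * (‖pt t 1‖ ^ (n + 1))⁻¹ := by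
  obtain ⟨ε, hε, A, hA, h⟩ := exists_norm_pt_le hx
  obtain ⟨C, hC0, hC⟩ := hG.exists_bound hc
  refine ⟨ε, hε, M * (C * A ^ b), fun x hxb => ⟨(h x hxb).1, fun t => ?_⟩⟩
  have hz := sub_bdry_ne_zero (h x hxb).1 t
  have hz' := norm_pos_iff.2 hz
  have h1 := (h x hxb).2 t
  have hp := one_le_norm_pt_one t
  have h2 : (‖x - bdry t‖ ^ b)⁻¹ ≤ A ^ b * (‖pt t 1‖ ^ (n + 1))⁻¹ := by
    rw [← div_eq_mul_inv, le_div_iff₀ (by positivity), inv_mul_le_iff₀ (by positivity), mul_comm,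
      ← mul_pow]
    exact (pow_le_pow_right₀ hp hb).trans (pow_le_pow_left₀ (by positivity) h1 b)
  rw [norm_smul, mul_assoc]
  refine mul_le_mul (hM t) ((hC _ hz).trans ?_) (norm_nonneg _) ((abs_nonneg _).trans (hM t))
  rw [mul_assoc]
  exact mul_le_mul_of_nonneg_left h2 hC0

theorem integrable_sub_bdry {b : ℕ} (hb : n + 1 ≤ b) {a : Euc n → ℝ} (ha : Continuous a) {M : ℝ}
    (hM : ∀ t, |a t| ≤ M) {G : Euc (n + 1) → F} (hc : ContinuousOn G {0}ᶜ) (hG : HomNeg b G)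
    {x : Euc (n + 1)} (hx : x ∈ upperHalf n) : Integrable fun t => a t • G (x - bdry t) := by
  obtain ⟨ε, hε, C, h⟩ := exists_bound_sub_bdry hb hM hc hG hx
  exact (integrable_inv_norm_pt_pow.const_mul C).mono'
    (continuous_smul_sub_bdry ha hc hx).aestronglyMeasurable
    (Filter.Eventually.of_forall (h x (mem_ball_self hε)).2)

theorem contDiffOn_fderiv_compl_zero {m : ℕ} {G : Euc m → F} (hs : ContDiffOn ℝ ∞ G {0}ᶜ) :
    ContDiffOn ℝ ∞ (fderiv ℝ G) {0}ᶜ :=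
  hs.fderiv_of_isOpen isOpen_compl_singleton (by simp)

/-- Degree `-n` suffices, because only the derivative, of degree at most `-(n + 1)`, must be
dominated. Integrability of the kernel itself is a separate hypothesis: degree `-n` alone does not
ensure it. -/
theorem hasFDerivAt_bdryConv {b : ℕ} (hb : n ≤ b) {a : Euc n → ℝ} (ha : Continuous a) {M : ℝ}
    (hM : ∀ t, |a t| ≤ M) {G : Euc (n + 1) → F} (hs : ContDiffOn ℝ ∞ G {0}ᶜ) (hG : HomNeg b G)
    {x : Euc (n + 1)} (hx : x ∈ upperHalf n) (hi : Integrable fun t => a t • G (x - bdry t)) :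
    HasFDerivAt (bdryConv a G) (bdryConv a (fderiv ℝ G) x) x := by
  have hs' := contDiffOn_fderiv_compl_zero hs
  obtain ⟨ε, hε, C, h⟩ := exists_bound_sub_bdry (b := b + 1) (by omega) hM hs'.continuousOn
    hG.fderiv hx
  refine hasFDerivAt_integral_of_dominated_of_fderiv_le (𝕜 := ℝ)
    (F := fun x t => a t • G (x - bdry t)) (F' := fun x t => a t • fderiv ℝ G (x - bdry t)) (ball_mem_nhds x hε)
    (bound := fun t => C * (‖pt t 1‖ ^ (n + 1))⁻¹) ?_ hi ?_ ?_
    (integrable_inv_norm_pt_pow.const_mul C) ?_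
  · filter_upwards [ball_mem_nhds x hε] with x' hx'
    exact (continuous_smul_sub_bdry ha hs.continuousOn (h x' hx').1).aestronglyMeasurable
  · exact (continuous_smul_sub_bdry ha hs'.continuousOn hx).aestronglyMeasurable
  · exact Filter.Eventually.of_forall fun t x' hx' => (h x' hx').2 t
  · refine Filter.Eventually.of_forall fun t x' hx' => ?_
    have hz := sub_bdry_ne_zero (h x' hx').1 t
    have h1 : HasFDerivAt G (fderiv ℝ G (x' - bdry t)) (x' - bdry t) :=
      ((hs.contDiffAt (isOpen_compl_singleton.mem_nhds hz)).differentiableAt (by simp)).hasFDerivAt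
    exact ((hasFDerivAt_comp_sub (bdry t)).2 h1).const_smul (a t)

end Convolution

/-- The derivative of the potential is the potential of the derivative, whose degree is at most `-(n
+ 1)`, so integrability is automatic from then on. The induction must range over all codomains and
all degrees, as both change under differentiation. -/
theorem contDiffOn_bdryConv_nat {a : Euc n → ℝ} (ha : Continuous a) {M : ℝ}
    (hM : ∀ t, |a t| ≤ M) (N : ℕ) : ∀ {F : Type} [NormedAddCommGroup F] [NormedSpace ℝ F]
    {b : ℕ} {G : Euc (n + 1) → F}, n ≤ b → ContDiffOn ℝ ∞ G {0}ᶜ → HomNeg b G →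
    (∀ x ∈ upperHalf n, Integrable fun t => a t • G (x - bdry t)) →
    ContDiffOn ℝ N (bdryConv a G) (upperHalf n) := by
  induction N with
  | zero =>
    intro F _ _ b G hb hs hG hi
    exact contDiffOn_zero.2 fun x hx =>
      (hasFDerivAt_bdryConv hb ha hM hs hG hx (hi x hx)).continuousAt.continuousWithinAt
  | succ N ih =>
    intro F _ _ b G hb hs hG hi
    have h1 := fun x hx => hasFDerivAt_bdryConv hb ha hM hs hG hx (hi x hx)
    have hs' := contDiffOn_fderiv_compl_zero hs
    push_cast
    rw [contDiffOn_succ_iff_fderiv_of_isOpen isOpen_upperHalf]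
    refine ⟨fun x hx => (h1 x hx).differentiableAt.differentiableWithinAt, by simp, ?_⟩
    refine (ih (b := b + 1) (G := fderiv ℝ G) (by omega) hs' hG.fderiv fun x hx =>
      integrable_sub_bdry (by omega) ha hM hs'.continuousOn hG.fderiv hx).congr fun x hx => ?_
    exact (h1 x hx).fderiv

theorem contDiffOn_bdryConv {F : Type} [NormedAddCommGroup F] [NormedSpace ℝ F] {b : ℕ}
    (hb : n ≤ b) {a : Euc n → ℝ} (ha : Continuous a) {M : ℝ}
    (hM : ∀ t, |a t| ≤ M) {G : Euc (n + 1) → F} (hs : ContDiffOn ℝ ∞ G {0}ᶜ) (hG : HomNeg b G)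
    (hi : ∀ x ∈ upperHalf n, Integrable fun t => a t • G (x - bdry t)) :
    ContDiffOn ℝ ∞ (bdryConv a G) (upperHalf n) :=
  contDiffOn_infty.2 fun N => contDiffOn_bdryConv_nat ha hM N hb hs hG hi

end

/-! ### Separation of variables for `𝓓_k`, and interpolation in `𝓗_k`. -/

section

variable {n k : ℕ}

section Separated
variable {m : ℕ} {ι : Type*} [Fintype ι]

/-- A finite sum of products of functions of `z` and functions of `v`. -/
def sepFun (φ P : ι → Euc m → ℝ) (z v : Euc m) : ℝ := ∑ s, φ s z * P s v

theorem hasFDerivAt_sepFun_left {φ P : ι → Euc m → ℝ} {z : Euc m}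
    (hφ : ∀ s, DifferentiableAt ℝ (φ s) z) (v : Euc m) :
    HasFDerivAt (fun z => sepFun φ P z v) (∑ s, P s v • fderiv ℝ (φ s) z) z :=
  HasFDerivAt.fun_sum fun s _ => (hφ s).hasFDerivAt.mul_const (P s v)

theorem dX_sepFun {φ P : ι → Euc m → ℝ} {z : Euc m} (hφ : ∀ s, DifferentiableAt ℝ (φ s) z)
    (i : Fin m) (v : Euc m) :
    dX i (sepFun φ P) z v = sepFun (fun s => dirD (stdv i) (φ s)) P z v := by
  rw [dX, (hasFDerivAt_sepFun_left hφ v).fderiv]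
  simp [sepFun, dirD, sum_apply, mul_comm]

theorem duDx_sepFun {φ P : ι → Euc m → ℝ} {z : Euc m} (hφ : ∀ s, DifferentiableAt ℝ (φ s) z)
    (hP : ∀ s, Differentiable ℝ (P s)) (v : Euc m) :
    duDx (sepFun φ P) z v = sepFun (ι := ι × Fin m) (fun s => dirD (stdv s.2) (φ s.1))
      (fun s => dirD (stdv s.2) (P s.1)) z v := by
  have h : ∀ i, dU i (dX i (sepFun φ P)) z v =
      ∑ s, dirD (stdv i) (φ s) z * dirD (stdv i) (P s) v := by
    intro i
    have h1 : (fun w => dX i (sepFun φ P) z w) =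
        fun w => ∑ s, dirD (stdv i) (φ s) z * P s w := funext fun w => dX_sepFun hφ i w
    have h2 : HasFDerivAt (fun w => ∑ s, dirD (stdv i) (φ s) z * P s w)
        (∑ s, dirD (stdv i) (φ s) z • fderiv ℝ (P s) v) v :=
      HasFDerivAt.fun_sum fun s _ => ((hP s) v).hasFDerivAt.const_mul _
    rw [dU, h1, h2.fderiv]
    simp [dirD, sum_apply]
  simp only [duDx, h, sepFun, Fintype.sum_prod_type]
  exact Finset.sum_comm

/-- Evaluation of bilinear forms at a pair of vectors. -/
def evalPair (a b : Euc m) : (Euc m →L[ℝ] Euc m →L[ℝ] ℝ) →L[ℝ] ℝ :=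
  (ContinuousLinearMap.apply ℝ ℝ b).comp (ContinuousLinearMap.apply ℝ (Euc m →L[ℝ] ℝ) a)

theorem evalPair_apply (a b : Euc m) (B : Euc m →L[ℝ] Euc m →L[ℝ] ℝ) :
    evalPair a b B = B a b := rfl

/-- The functional of the Hessian in `x` through which `𝓓_k` acts on products `φ(x) P(v)`. -/
def bosonicSymbol (k : ℕ) (P : Euc m → ℝ) (v : Euc m) : (Euc m →L[ℝ] Euc m →L[ℝ] ℝ) →L[ℝ] ℝ :=
  P v • (∑ i : Fin m, evalPair (stdv i) (stdv i))
    + (-4 / ((m : ℝ) + 2 * k - 2)) • (∑ i : Fin m, dirD (stdv i) P v • evalPair v (stdv i))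
    + (4 * ‖v‖ ^ 2 / (((m : ℝ) + 2 * k - 2) * ((m : ℝ) + 2 * k - 4))) •
      (∑ i : Fin m, ∑ j : Fin m, dirD (stdv j) (dirD (stdv i) P) v • evalPair (stdv j) (stdv i))

theorem laplacian_eq_sum_fderiv (f : Euc m → ℝ) (z : Euc m) :
    Laplacian.laplacian f z = ∑ i, fderiv ℝ (fderiv ℝ f) z (stdv i) (stdv i) := by
  rw [InnerProductSpace.laplacian_eq_iteratedFDeriv_orthonormalBasis f
    (EuclideanSpace.basisFun (Fin m) ℝ)]
  simp [iteratedFDeriv_two_apply]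

/-- Every term of `𝓓_k` is of second order in `x`, so on a product it is a linear functional of the
Hessian of `φ s` with coefficients determined by `P s`, `v` and `k`. Continuity of this functional
later lets it pass through integrals. -/
theorem bosonicLaplacian_sepFun {φ P : ι → Euc m → ℝ} {U : Set (Euc m)} (hU : IsOpen U)
    (hφ : ∀ s, ContDiffOn ℝ ∞ (φ s) U) (hP : ∀ s, ContDiff ℝ ∞ (P s)) {z : Euc m} (hz : z ∈ U)
    (v : Euc m) : bosonicLaplacian k (sepFun φ P) z v =
      ∑ s, bosonicSymbol k (P s) v (fderiv ℝ (fderiv ℝ (φ s)) z) := by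
  have hd : ∀ s, ∀ x ∈ U, DifferentiableAt ℝ (φ s) x := fun s x hx =>
    ((hφ s).contDiffAt (hU.mem_nhds hx)).differentiableAt (by simp)
  have hφ' : ∀ s, ContDiffOn ℝ ∞ (fderiv ℝ (φ s)) U := fun s =>
    (hφ s).fderiv_of_isOpen hU (by simp)
  have hd' : ∀ s, ∀ x ∈ U, HasFDerivAt (fderiv ℝ (φ s)) (fderiv ℝ (fderiv ℝ (φ s)) x) x :=
    fun s x hx => (((hφ' s).contDiffAt (hU.mem_nhds hx)).differentiableAt (by simp)).hasFDerivAt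
  have hd2 : ∀ s (a : Euc m), ∀ x ∈ U, HasFDerivAt (dirD a (φ s))
      ((fderiv ℝ (fderiv ℝ (φ s)) x).flip a) x := fun s a x hx =>
    ((hd' s x hx).clm_apply (hasFDerivAt_const a x)).congr_fderiv (by ext; simp)
  have hPd : ∀ s, Differentiable ℝ (P s) := fun s => (hP s).differentiable (by simp)
  have hPd' : ∀ s i, Differentiable ℝ (dirD (stdv i) (P s)) := fun s i =>
    (ContDiff.dirD' (hP s) _).differentiable (by simp)
  set φ' : ι × Fin m → Euc m → ℝ := fun s => dirD (stdv s.2) (φ s.1)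
  set P' : ι × Fin m → Euc m → ℝ := fun s => dirD (stdv s.2) (P s.1)
  have hφd : ∀ s, DifferentiableAt ℝ (φ' s) z := fun s =>
    (hd2 s.1 (stdv s.2) z hz).differentiableAt
  have e1 : ∀ x ∈ U, duDx (sepFun φ P) x = sepFun φ' P' x := fun x hx =>
    funext fun w => duDx_sepFun (fun s => hd s x hx) hPd w
  have e2 : uDx (duDx (sepFun φ P)) z v = ∑ s, ∑ i, dirD (stdv i) (P s) v *
      fderiv ℝ (fderiv ℝ (φ s)) z v (stdv i) := by
    rw [uDx_congr hU e1 hz, uDx_eq_fderiv, (hasFDerivAt_sepFun_left hφd v).fderiv]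
    simp only [sum_apply, smul_apply, smul_eq_mul, Fintype.sum_prod_type, φ', P',
      (hd2 _ _ z hz).fderiv, ContinuousLinearMap.flip_apply]
  have e3 : duDx (duDx (sepFun φ P)) z v = ∑ s, ∑ i, ∑ j,
      dirD (stdv j) (dirD (stdv i) (P s)) v *
        fderiv ℝ (fderiv ℝ (φ s)) z (stdv j) (stdv i) := by
    rw [duDx_congr hU e1 hz, duDx_sepFun hφd fun s => hPd' s.1 s.2]
    simp only [sepFun, Fintype.sum_prod_type, φ']
    refine Finset.sum_congr rfl fun s _ => Finset.sum_congr rfl fun i _ =>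
      Finset.sum_congr rfl fun j _ => ?_
    rw [mul_comm]
    conv_lhs => rw [dirD, dirD, (hd2 _ _ z hz).fderiv]
    rfl
  have e4 : Laplacian.laplacian (fun x => sepFun φ P x v) z =
      ∑ s, P s v * ∑ i, fderiv ℝ (fderiv ℝ (φ s)) z (stdv i) (stdv i) := by
    have h1 : fderiv ℝ (fun x => sepFun φ P x v) =ᶠ[nhds z]
        fun x => ∑ s, P s v • fderiv ℝ (φ s) x := by
      filter_upwards [hU.mem_nhds hz] with x hx
      exact (hasFDerivAt_sepFun_left (fun s => hd s x hx) v).fderiv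
    have h2 : HasFDerivAt (fun x => ∑ s, P s v • fderiv ℝ (φ s) x)
        (∑ s, P s v • fderiv ℝ (fderiv ℝ (φ s)) z) z :=
      HasFDerivAt.fun_sum fun s _ => (hd' s z hz).const_smul (P s v)
    rw [laplacian_eq_sum_fderiv, h1.fderiv_eq, h2.fderiv]
    simp only [sum_apply, smul_apply, smul_eq_mul, Finset.mul_sum]
    exact Finset.sum_comm
  rw [bosonicLaplacian, e2, e3, e4]
  simp only [bosonicSymbol, add_apply, smul_apply, sum_apply, evalPair_apply,
    smul_eq_mul, Finset.sum_add_distrib, ← Finset.mul_sum]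
  ring

end Separated

section Interpolation

variable {m : ℕ}

/-- Lagrange interpolation of harmonic polynomials at points of the unit ball. -/
theorem exists_interpolation (m k : ℕ) [NeZero m] :
    ∃ (S : Finset (Euc m)) (e : Euc m → harmonicPoly m k), (∀ w ∈ S, w ∈ ball (0 : Euc m) 1) ∧
      ∀ q : harmonicPoly m k, q = ∑ w ∈ S, evalAt w q • e w := by
  -- Evaluations at points of the ball separate `𝓗_k`: by homogeneity, a polynomial vanishing on the
  -- sphere of radius `1/2` vanishes on the unit sphere. Hence they span the dual.
  have hspan : Submodule.span ℝ ((fun w : Euc m => (evalAt w : harmonicPoly m k →ₗ[ℝ] ℝ)) ''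
      ball 0 1) = ⊤ := by
    refine Submodule.span_eq_top_of_ne_zero fun q hq => ?_
    by_contra! h
    refine hq (sphereForm_self q ?_)
    have h0 : ∀ u : USphere m, evalAt (u : Euc m) q = 0 := by
      intro u
      have h1 := h _ (mem_image_of_mem _ (show (2⁻¹ : ℝ) • (u : Euc m) ∈ ball 0 1 by
        simp [norm_smul]; norm_num))
      rw [evalAt_smul] at h1
      simpa using h1
    simp [sphereForm_apply, h0]
  set b := Module.finBasis ℝ (harmonicPoly m k)
  -- Each coordinate functional of a basis is a finite combination of evaluations; collecting these
  -- over the basis gives the formula.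
  have hc : ∀ j, ∃ c : Euc m →₀ ℝ, (∀ w ∈ c.support, w ∈ ball (0 : Euc m) 1) ∧
      ∀ q, b.repr q j = ∑ w ∈ c.support, c w * evalAt w q := by
    intro j
    have hj : b.coord j ∈ Submodule.span ℝ
      ((fun w : Euc m => (evalAt w : harmonicPoly m k →ₗ[ℝ] ℝ)) '' ball 0 1) := by
      rw [hspan]; trivial
    obtain ⟨c, hcs, hc⟩ := (Finsupp.mem_span_image_iff_linearCombination ℝ).1 hj
    refine ⟨c, fun w hw => hcs hw, fun q => ?_⟩
    have := LinearMap.congr_fun hc q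
    rw [Module.Basis.coord_apply] at this
    rw [← this, Finsupp.linearCombination_apply, Finsupp.sum]
    simp [LinearMap.sum_apply]
  choose c hcs hc using hc
  classical
  refine ⟨Finset.univ.biUnion fun j => (c j).support, fun w => ∑ j, c j w • b j, fun w hw => ?_,
    fun q => ?_⟩
  · obtain ⟨j, -, hj⟩ := Finset.mem_biUnion.1 hw
    exact hcs j w hj
  · conv_lhs => rw [← b.sum_repr q]
    simp only [Finset.smul_sum]
    rw [Finset.sum_comm]
    refine Finset.sum_congr rfl fun j _ => ?_
    rw [hc, Finset.sum_smul]
    refine (Finset.sum_subset (Finset.subset_biUnion_of_mem (fun j => (c j).support)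
      (Finset.mem_univ j)) fun w _ hw => ?_).trans (Finset.sum_congr rfl fun w _ => ?_)
    · simp [Finsupp.notMem_support_iff.1 hw]
    · rw [smul_smul, mul_comm]

end Interpolation

end

/-! ### The Poisson integral over the open half-space: smoothness and the equation. -/

section

variable {n k : ℕ}

theorem contDiffOn_reflect {m : ℕ} (v : Euc m) :
    ContDiffOn ℝ ∞ (fun z : Euc m => reflect z v) {0}ᶜ := by
  unfold reflect
  refine contDiffOn_const.sub (ContDiffOn.fun_smul (ContDiffOn.div ?_ ?_ ?_) contDiffOn_id)
  · exact (contDiff_const.mul (contDiff_const.inner ℝ contDiff_id)).contDiffOn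
  · exact (contDiff_norm_sq ℝ).contDiffOn
  · intro z hz
    exact pow_ne_zero _ (norm_ne_zero_iff.2 hz)

theorem reflect_smul_left {m : ℕ} {s : ℝ} (hs : s ≠ 0) (z v : Euc m) :
    reflect (s • z) v = reflect z v := by
  by_cases hz : z = 0
  · simp [hz]
  have hn : ‖z‖ ≠ 0 := norm_ne_zero_iff.2 hz
  rw [reflect, reflect, smul_smul, inner_smul_right, norm_smul, mul_pow, Real.norm_eq_abs, sq_abs]
  congr 2
  field_simp

/-- The Poisson kernel without the factor `y`. -/
def decayKernel {m : ℕ} (q : Euc m → ℝ) (v z : Euc m) : ℝ := (‖z‖ ^ m)⁻¹ * q (reflect z v)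

theorem contDiffOn_decayKernel {m : ℕ} {q : Euc m → ℝ} (hq : ContDiff ℝ ∞ q) (v : Euc m) :
    ContDiffOn ℝ ∞ (decayKernel q v) {0}ᶜ := by
  refine ContDiffOn.mul (ContDiffOn.inv (ContDiffOn.pow ?_ _) ?_)
    (hq.comp_contDiffOn (contDiffOn_reflect v))
  · intro z hz
    exact (contDiffAt_norm ℝ hz).contDiffWithinAt
  · intro z hz
    exact pow_ne_zero _ (norm_ne_zero_iff.2 hz)

theorem kernelFun_eq_mul_decayKernel {m : ℕ} (i : Fin m) (q : Euc m → ℝ) (v z : Euc m) :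
    kernelFun i q z v = z i * decayKernel q v z := by
  rw [kernelFun, decayKernel, mul_assoc]

theorem homNeg_decayKernel {m : ℕ} (q : Euc m → ℝ) (v : Euc m) :
    HomNeg m (decayKernel q v) := by
  intro s hs z
  rw [decayKernel, decayKernel, reflect_smul_left hs.ne', norm_smul, mul_pow,
    Real.norm_of_nonneg hs.le, smul_eq_mul, mul_inv, mul_assoc]

theorem contDiffOn_kernelFun {m : ℕ} {q : Euc m → ℝ} (hq : ContDiff ℝ ∞ q) (i : Fin m)
    (v : Euc m) : ContDiffOn ℝ ∞ (fun z => kernelFun i q z v) {0}ᶜ := by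
  simp only [kernelFun_eq_mul_decayKernel]
  exact (EuclideanSpace.proj (𝕜 := ℝ) i).contDiff.contDiffOn.mul (contDiffOn_decayKernel hq v)

theorem homNeg_kernelFun (i : Fin (n + 1)) (q : Euc (n + 1) → ℝ) (v : Euc (n + 1)) :
    HomNeg n (fun z => kernelFun i q z v) := by
  intro s hs z
  simp only [kernelFun_eq_mul_decayKernel]
  rw [homNeg_decayKernel q v s hs z]
  simp only [PiLp.smul_apply, smul_eq_mul, pow_succ]
  field_simp

/-- The Poisson integral, after integration over the sphere. -/
theorem poissonIntegral_eq (f : Euc n → harmonicPoly (n + 1) k) (x v : Euc (n + 1)) :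
    poissonIntegral f x v = poissonConst (n + 1) k *
      ∫ t, kernelFun (Fin.last n) (fun u => evalAt u (f t)) (x - bdry t) v := by
  rw [poissonIntegral, ← integral_const_mul]
  congr 1
  ext t
  simp only [poissonKernel, mul_assoc, integral_const_mul]
  rw [integral_zonal_reflect, kernelFun]
  have : (x - bdry t) (Fin.last n) = height x := height_sub_bdry x t
  rw [this, div_eq_mul_inv, mul_assoc]

/-- Continuity and boundedness of the boundary data, for each argument in the unit ball. -/
structure BoundaryData (f : Euc n → harmonicPoly (n + 1) k) (N : ℝ) : Prop where
  cont : ∀ v ∈ ball (0 : Euc (n + 1)) 1, Continuous fun t => evalAt v (f t)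
  bound : ∀ v ∈ ball (0 : Euc (n + 1)) 1, ∀ t, |evalAt v (f t)| ≤ N

variable {f : Euc n → harmonicPoly (n + 1) k} {N : ℝ}

/-- Along the boundary the factor `(x - bdry t) (Fin.last n)` is the constant `height x`. What
remains, `decayKernel`, has degree `-(n + 1)`, one better than the kernel as a function of `z`. -/
theorem integrable_kernelFun {a : Euc n → ℝ} (ha : Continuous a) {M : ℝ} (hM : ∀ t, |a t| ≤ M)
    {q : Euc (n + 1) → ℝ} (hq : ContDiff ℝ ∞ q) {x : Euc (n + 1)} (hx : x ∈ upperHalf n)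
    (v : Euc (n + 1)) :
    Integrable fun t => a t • kernelFun (Fin.last n) q (x - bdry t) v := by
  have h := integrable_sub_bdry le_rfl ha hM (contDiffOn_decayKernel hq v).continuousOn
    (homNeg_decayKernel q v) hx
  refine (h.const_mul (height x)).congr (Filter.Eventually.of_forall fun t => ?_)
  have : (x - bdry t) (Fin.last n) = height x := height_sub_bdry x t
  simp only [kernelFun_eq_mul_decayKernel, this, smul_eq_mul]
  ring

theorem contDiff_evalAt {m : ℕ} (p : harmonicPoly m k) : ContDiff ℝ ∞ fun u : Euc m => evalAt u p :=
  (solid_evalAt p).smooth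

/-- Interpolation of the Poisson kernel in the boundary data. -/
theorem kernelFun_sum {m : ℕ} {S : Finset (Euc m)} {e : Euc m → harmonicPoly m k}
    (he : ∀ q : harmonicPoly m k, q = ∑ w ∈ S, evalAt w q • e w) (i : Fin m)
    (p : harmonicPoly m k) (z v : Euc m) :
    kernelFun i (fun u => evalAt u p) z v =
      ∑ w ∈ S, evalAt w p • kernelFun i (fun u => evalAt u (e w)) z v := by
  simp only [kernelFun]
  conv_lhs => rw [he p]
  simp only [map_sum, map_smul, smul_eq_mul, Finset.mul_sum]
  exact Finset.sum_congr rfl fun w _ => by ring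

/-- Interpolation of the Poisson kernel in the variable `v`. -/
theorem kernelFun_sum_right {m : ℕ} {S : Finset (Euc m)} {e : Euc m → harmonicPoly m k}
    (he : ∀ q : harmonicPoly m k, q = ∑ w ∈ S, evalAt w q • e w) (i : Fin m)
    (p : harmonicPoly m k) (z v : Euc m) :
    kernelFun i (fun u => evalAt u p) z v =
      ∑ w ∈ S, kernelFun i (fun u => evalAt u p) z w * evalAt v (e w) := by
  simp only [kernelFun, ← evalAt_rot z _ p]
  conv_lhs => rw [he (rot z p)]
  simp only [map_sum, map_smul, smul_eq_mul, Finset.mul_sum]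
  exact Finset.sum_congr rfl fun w _ => by ring

section Interpolated
variable {S : Finset (Euc (n + 1))} {e : Euc (n + 1) → harmonicPoly (n + 1) k}

theorem integrable_poisson (hf : BoundaryData f N) {x : Euc (n + 1)} (hx : x ∈ upperHalf n)
    (v : Euc (n + 1)) :
    Integrable fun t => kernelFun (Fin.last n) (fun u => evalAt u (f t)) (x - bdry t) v := by
  obtain ⟨S, e, hS, he⟩ := exists_interpolation (n + 1) k
  simp only [fun t => kernelFun_sum he (Fin.last n) (f t) (x - bdry t) v]
  exact integrable_finsetSum _ fun w hw =>
    integrable_kernelFun (hf.cont w (hS w hw)) (hf.bound w (hS w hw)) (contDiff_evalAt _) hx v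

theorem poissonIntegral_eq_bdryConv (hf : BoundaryData f N)
    (hS : ∀ w ∈ S, w ∈ ball (0 : Euc (n + 1)) 1)
    (he : ∀ q : harmonicPoly (n + 1) k, q = ∑ w ∈ S, evalAt w q • e w)
    {x : Euc (n + 1)} (hx : x ∈ upperHalf n) (v : Euc (n + 1)) :
    poissonIntegral f x v = poissonConst (n + 1) k * ∑ w ∈ S, bdryConv (fun t => evalAt w (f t))
      (fun z => kernelFun (Fin.last n) (fun u => evalAt u (e w)) z v) x := by
  rw [poissonIntegral_eq]
  simp only [fun t => kernelFun_sum he (Fin.last n) (f t) (x - bdry t) v, bdryConv]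
  rw [integral_finsetSum _ fun w hw =>
    integrable_kernelFun (hf.cont w (hS w hw)) (hf.bound w (hS w hw)) (contDiff_evalAt _) hx v]

/-- The Poisson integral is a harmonic polynomial in `v`. -/
theorem poissonIntegral_eq_sepFun (hf : BoundaryData f N)
    (he : ∀ q : harmonicPoly (n + 1) k, q = ∑ w ∈ S, evalAt w q • e w)
    {x : Euc (n + 1)} (hx : x ∈ upperHalf n) (v : Euc (n + 1)) :
    poissonIntegral f x v = ∑ w ∈ S, poissonIntegral f x w * evalAt v (e w) := by
  simp only [poissonIntegral_eq]
  have h := fun t => kernelFun_sum_right he (Fin.last n) (f t) (x - bdry t) v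
  simp only [h]
  rw [integral_finsetSum _ fun w _ => (integrable_poisson hf hx w).mul_const _, Finset.mul_sum]
  exact Finset.sum_congr rfl fun w _ => by rw [integral_mul_const, mul_assoc]

theorem contDiffOn_poissonIntegral (hf : BoundaryData f N) (v : Euc (n + 1)) :
    ContDiffOn ℝ ∞ (fun x => poissonIntegral f x v) (upperHalf n) := by
  obtain ⟨S, e, hS, he⟩ := exists_interpolation (n + 1) k
  refine ContDiffOn.congr ?_ fun x hx => poissonIntegral_eq_bdryConv hf hS he hx v
  exact contDiffOn_const.mul (ContDiffOn.sum fun w hw => contDiffOn_bdryConv le_rfl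
    (hf.cont w (hS w hw)) (hf.bound w (hS w hw)) (contDiffOn_kernelFun (contDiff_evalAt _) _ v)
    (homNeg_kernelFun _ _ v) fun x hx => integrable_kernelFun (hf.cont w (hS w hw))
      (hf.bound w (hS w hw)) (contDiff_evalAt _) hx v)

/-- Joint smoothness follows from separate smoothness, because the dependence on `v` is through
finitely many fixed polynomials. -/
theorem contDiffOn_poissonIntegral_prod (hf : BoundaryData f N) :
    ContDiffOn ℝ ∞ (fun q : Euc (n + 1) × Euc (n + 1) => poissonIntegral f q.1 q.2)
      (upperHalf n ×ˢ univ) := by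
  obtain ⟨S, e, hS, he⟩ := exists_interpolation (n + 1) k
  refine ContDiffOn.congr ?_ fun q hq => poissonIntegral_eq_sepFun hf he hq.1 q.2
  refine ContDiffOn.sum fun w _ => ContDiffOn.mul ?_ ?_
  · exact (contDiffOn_poissonIntegral hf w).comp contDiff_fst.contDiffOn fun q hq => hq.1
  · exact ((contDiff_evalAt (e w)).comp contDiff_snd).contDiffOn

/-- The Hessian of a Poisson integral. -/
theorem fderiv_fderiv_poissonIntegral (hf : BoundaryData f N)
    (hS : ∀ w ∈ S, w ∈ ball (0 : Euc (n + 1)) 1)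
    (he : ∀ q : harmonicPoly (n + 1) k, q = ∑ w ∈ S, evalAt w q • e w)
    {x : Euc (n + 1)} (hx : x ∈ upperHalf n) (v : Euc (n + 1)) :
    fderiv ℝ (fderiv ℝ fun x => poissonIntegral f x v) x =
      poissonConst (n + 1) k • ∑ w ∈ S, bdryConv (fun t => evalAt w (f t))
        (fderiv ℝ (fderiv ℝ
          fun z => kernelFun (Fin.last n) (fun u => evalAt u (e w)) z v)) x := by
  have hs : ∀ w, ContDiffOn ℝ ∞
      (fun z => kernelFun (Fin.last n) (fun u => evalAt u (e w)) z v) {0}ᶜ :=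
    fun w => contDiffOn_kernelFun (contDiff_evalAt _) _ v
  have hh : ∀ w, HomNeg n (fun z => kernelFun (Fin.last n) (fun u => evalAt u (e w)) z v) :=
    fun w => homNeg_kernelFun _ _ v
  have h1 : ∀ x ∈ upperHalf n, HasFDerivAt (fun x => poissonIntegral f x v)
      (poissonConst (n + 1) k • ∑ w ∈ S, bdryConv (fun t => evalAt w (f t))
        (fderiv ℝ fun z => kernelFun (Fin.last n) (fun u => evalAt u (e w)) z v) x) x := by
    intro x hx
    have h2 := (HasFDerivAt.fun_sum fun w hw => hasFDerivAt_bdryConv le_rfl (hf.cont w (hS w hw))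
      (hf.bound w (hS w hw)) (hs w) (hh w) hx (integrable_kernelFun (hf.cont w (hS w hw))
        (hf.bound w (hS w hw)) (contDiff_evalAt _) hx v)).const_mul (poissonConst (n + 1) k)
    refine h2.congr_of_eventuallyEq ?_
    filter_upwards [isOpen_upperHalf.mem_nhds hx] with x hx
    exact poissonIntegral_eq_bdryConv hf hS he hx v
  have h3 : fderiv ℝ (fun x => poissonIntegral f x v) =ᶠ[nhds x] fun x =>
      poissonConst (n + 1) k • ∑ w ∈ S, bdryConv (fun t => evalAt w (f t))
        (fderiv ℝ fun z => kernelFun (Fin.last n) (fun u => evalAt u (e w)) z v) x := by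
    filter_upwards [isOpen_upperHalf.mem_nhds hx] with x hx
    exact (h1 x hx).fderiv
  rw [h3.fderiv_eq]
  have hs' := fun w => contDiffOn_fderiv_compl_zero (hs w)
  have h4 := (HasFDerivAt.fun_sum fun w hw => hasFDerivAt_bdryConv (Nat.le_succ n)
    (hf.cont w (hS w hw)) (hf.bound w (hS w hw)) (hs' w) (hh w).fderiv hx
    (integrable_sub_bdry le_rfl (hf.cont w (hS w hw)) (hf.bound w (hS w hw))
      (hs' w).continuousOn (hh w).fderiv hx)).const_smul (poissonConst (n + 1) k)
  exact h4.fderiv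

/-- This is `𝓓_k` of the kernel, written through interpolation in `v`. It is the form of the
equation that can be integrated in `t`. -/
theorem sum_bosonicSymbol_kernelFun (hn : 2 ≤ n) (hk : 1 ≤ k)
    (he : ∀ q : harmonicPoly (n + 1) k, q = ∑ w ∈ S, evalAt w q • e w)
    (p : harmonicPoly (n + 1) k) {z : Euc (n + 1)} (hz : z ≠ 0) (v : Euc (n + 1)) :
    ∑ s : S, bosonicSymbol k (fun u => evalAt u (e s)) v (fderiv ℝ (fderiv ℝ
      fun z => kernelFun (Fin.last n) (fun u => evalAt u p) z s) z) = 0 := by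
  rw [← bosonicLaplacian_kernelFun (solid_evalAt p) (by omega) (Fin.last n) hk hz v,
    ← bosonicLaplacian_sepFun isOpen_compl_singleton
      (fun s => contDiffOn_kernelFun (contDiff_evalAt p) _ _)
      (fun s => contDiff_evalAt _) hz v]
  congr 2
  ext z v
  rw [kernelFun_sum_right he, sepFun]
  exact Finset.sum_coe_sort S fun w => kernelFun (Fin.last n) _ z w * evalAt v (e w)

/-- Interpolation is used twice with the same nodes: in `v`, to separate variables, and in the
boundary data, to reduce to scalar potentials. After exchanging the two sums, the integrand for each
node `w` of the data vanishes pointwise by `sum_bosonicSymbol_kernelFun`. -/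
theorem bosonicLaplacian_poissonIntegral (hn : 2 ≤ n) (hk : 1 ≤ k) (hf : BoundaryData f N)
    {x : Euc (n + 1)} (hx : x ∈ upperHalf n) (v : Euc (n + 1)) :
    bosonicLaplacian k (poissonIntegral f) x v = 0 := by
  obtain ⟨S, e, hS, he⟩ := exists_interpolation (n + 1) k
  have h1 : ∀ x ∈ upperHalf n, poissonIntegral f x =
      sepFun (fun (s : S) x => poissonIntegral f x s) (fun s v => evalAt v (e s)) x := by
    intro x hx
    ext v
    rw [poissonIntegral_eq_sepFun hf he hx, sepFun]
    exact (Finset.sum_coe_sort S fun w => poissonIntegral f x w * evalAt v (e w)).symm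
  rw [bosonicLaplacian_congr isOpen_upperHalf h1 hx, bosonicLaplacian_sepFun isOpen_upperHalf
    (fun s => contDiffOn_poissonIntegral hf _) (fun s => contDiff_evalAt _) hx v]
  simp only [fderiv_fderiv_poissonIntegral hf hS he hx, map_smul, map_sum, ← Finset.smul_sum]
  rw [Finset.sum_comm, Finset.sum_eq_zero, smul_zero]
  intro w hw
  have hs' := fun s : S => contDiffOn_fderiv_compl_zero (contDiffOn_fderiv_compl_zero
    (contDiffOn_kernelFun (contDiff_evalAt (e w)) (Fin.last n) (s : Euc (n + 1))))
  have hi := fun s : S => integrable_sub_bdry (Nat.le_succ (n + 1)) (hf.cont w (hS w hw))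
    (hf.bound w (hS w hw)) (hs' s).continuousOn
      (homNeg_kernelFun (Fin.last n) (fun u => evalAt u (e w)) s).fderiv.fderiv hx
  simp only [bdryConv, ← fun s : S => ContinuousLinearMap.integral_comp_comm
    (bosonicSymbol k (fun u => evalAt u (e s)) v) (hi s)]
  rw [← integral_finsetSum _ fun s _ => ContinuousLinearMap.integrable_comp _ (hi s)]
  simp only [map_smul, ← Finset.smul_sum,
    sum_bosonicSymbol_kernelFun hn hk he _ (sub_bdry_ne_zero hx _), smul_zero, integral_zero]

end Interpolated

end

/-! ### Boundary behaviour, sup bounds and absolute convergence. -/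

section

variable {n k : ℕ} {f : Euc n → harmonicPoly (n + 1) k} {N : ℝ}

/-- The integral `∫ |(τ, 1)|^{-m} f(x' - y τ, R_{(τ, 1)} v) dτ`. -/
def scaledPoisson (f : Euc n → harmonicPoly (n + 1) k) (x v : Euc (n + 1)) : ℝ :=
  ∫ t : Euc n, decayKernel (fun u => evalAt u (f (tang x - height x • t))) v (pt t 1)

theorem tang_sub_bdry (x : Euc (n + 1)) (t : Euc n) : x - bdry t = pt (tang x - t) (height x) := by
  conv_lhs => rw [← pt_tang_height x, bdry_eq_pt, ← pt_sub, sub_zero]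

theorem kernelFun_smul_pt (q : Euc (n + 1) → ℝ) {y : ℝ} (hy : 0 < y) (t : Euc n)
    (v : Euc (n + 1)) :
    kernelFun (Fin.last n) q (pt (y • t) y) v = (y ^ n)⁻¹ * decayKernel q v (pt t 1) := by
  have h1 : pt (y • t) y = y • pt t 1 := by rw [← pt_smul, mul_one]
  have h2 := homNeg_kernelFun (Fin.last n) q v y hy (pt t 1)
  simp only [kernelFun_eq_mul_decayKernel, pt_last, one_mul, smul_eq_mul] at h2
  rw [h1, kernelFun_eq_mul_decayKernel, h2]

/-- Under `t = x' - y τ` the point `x - t` becomes `y (τ, 1)`; the Jacobian `y^n` cancels the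
homogeneity factor of the kernel. -/
theorem poissonIntegral_eq_scaled (f : Euc n → harmonicPoly (n + 1) k) {x : Euc (n + 1)}
    (hx : x ∈ upperHalf n) (v : Euc (n + 1)) :
    poissonIntegral f x v = poissonConst (n + 1) k * scaledPoisson f x v := by
  have hy : 0 < height x := hx
  rw [poissonIntegral_eq, scaledPoisson]
  congr 1
  rw [← integral_sub_left_eq_self _ volume (tang x)]
  have h1 := Measure.integral_comp_smul (volume : Measure (Euc n)) (fun t : Euc n => kernelFun
    (Fin.last n) (fun u => evalAt u (f (tang x - t))) (x - bdry (tang x - t)) v) (height x)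
  simp only [tang_sub_bdry, sub_sub_cancel, kernelFun_smul_pt _ hy, integral_const_mul,
    finrank_euclideanSpace_fin, smul_eq_mul, abs_inv, abs_of_pos (pow_pos hy n)] at h1 ⊢
  exact (mul_left_cancel₀ (inv_ne_zero (pow_pos hy n).ne') h1).symm

/-- At height zero the data no longer depend on the integration variable, so this is exactly the
normalisation `integral_poisson_const`. -/
theorem scaledPoisson_boundary (hn : 2 ≤ n) (f : Euc n → harmonicPoly (n + 1) k)
    {x : Euc (n + 1)} (hx : height x = 0) (v : Euc (n + 1)) :
    poissonConst (n + 1) k * scaledPoisson f x v = evalAt v (f (tang x)) := by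
  rw [evalAt_eq_polyFun, ← integral_poisson_const hn (f (tang x)).2 v, scaledPoisson, hx]
  simp only [zero_smul, sub_zero, decayKernel, evalAt_eq_polyFun]

theorem dirichletExt_eq_scaled (hn : 2 ≤ n) (f : Euc n → harmonicPoly (n + 1) k)
    {x : Euc (n + 1)} (hx : x ∈ closedUpperHalf n) (v : Euc (n + 1)) :
    dirichletExt f x v = poissonConst (n + 1) k * scaledPoisson f x v := by
  rw [dirichletExt]
  split_ifs with h
  · exact poissonIntegral_eq_scaled f h v
  · exact (scaledPoisson_boundary hn f (le_antisymm (not_lt.1 h) hx) v).symm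

theorem reflect_mem_ball {m : ℕ} (z : Euc m) {v : Euc m} (hv : v ∈ ball (0 : Euc m) 1) :
    reflect z v ∈ ball (0 : Euc m) 1 := by
  simpa [norm_reflect] using hv

theorem abs_decayKernel_le (hf : BoundaryData f N) {v : Euc (n + 1)}
    (hv : v ∈ ball (0 : Euc (n + 1)) 1) (s t : Euc n) :
    |decayKernel (fun u => evalAt u (f s)) v (pt t 1)| ≤ N * (‖pt t 1‖ ^ (n + 1))⁻¹ := by
  rw [decayKernel, abs_mul, abs_of_nonneg (by positivity), mul_comm]
  exact mul_le_mul_of_nonneg_right (hf.bound _ (reflect_mem_ball _ hv) s) (by positivity)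

theorem abs_scaledPoisson_le (hf : BoundaryData f N) (x : Euc (n + 1)) {v : Euc (n + 1)}
    (hv : v ∈ ball (0 : Euc (n + 1)) 1) :
    |scaledPoisson f x v| ≤ N * ∫ t : Euc n, (‖pt t 1‖ ^ (n + 1))⁻¹ := by
  rw [← integral_const_mul]
  refine norm_integral_le_of_norm_le (integrable_inv_norm_pt_pow.const_mul N)
    (f := fun t => decayKernel (fun u => evalAt u (f (tang x - height x • t))) v (pt t 1))
    (Filter.Eventually.of_forall fun t => ?_)
  exact abs_decayKernel_le hf hv (tang x - height x • t) t

/-- Interpolation upgrades continuity at each fixed argument in the ball to joint continuity on all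
of `ℝ^n × ℝ^{n+1}`. -/
theorem continuous_evalAt_prod (hf : BoundaryData f N) :
    Continuous fun q : Euc n × Euc (n + 1) => evalAt q.2 (f q.1) := by
  obtain ⟨S, e, hS, he⟩ := exists_interpolation (n + 1) k
  have h : ∀ q : Euc n × Euc (n + 1), evalAt q.2 (f q.1) =
      ∑ w ∈ S, evalAt w (f q.1) * evalAt q.2 (e w) := by
    intro q
    conv_lhs => rw [he (f q.1)]
    simp
  simp only [h]
  exact continuous_finsetSum _ fun w hw => ((hf.cont w (hS w hw)).comp continuous_fst).mul
    ((continuous_evalAt (e w)).comp continuous_snd)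

theorem continuous_tang : Continuous (tang : Euc (n + 1) → Euc n) := by
  unfold tang
  exact (PiLp.continuous_toLp 2 _).comp
    (continuous_pi fun i => (EuclideanSpace.proj (𝕜 := ℝ) i.castSucc).continuous)

theorem continuous_height : Continuous (height : Euc (n + 1) → ℝ) :=
  (EuclideanSpace.proj (𝕜 := ℝ) (Fin.last n)).continuous

theorem continuous_pt_one : Continuous fun t : Euc n => pt t 1 :=
  continuous_pt.comp (f := fun t : Euc n => (t, (1 : ℝ))) (by fun_prop)

theorem continuous_reflect_pt (v : Euc (n + 1)) : Continuous fun t : Euc n => reflect (pt t 1) v :=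
  (contDiffOn_reflect v).continuousOn.comp_continuous continuous_pt_one
    fun t => norm_pos_iff.1 (norm_pt_one_pos t)

/-- Dominated convergence: `x` enters only through the data, and the bound `N ‖pt t 1‖^{-(n+1)}`
does not involve `x`. No sign of the height is needed. -/
theorem continuous_scaledPoisson (hf : BoundaryData f N) {v : Euc (n + 1)}
    (hv : v ∈ ball (0 : Euc (n + 1)) 1) : Continuous fun x => scaledPoisson f x v := by
  have hc := continuous_evalAt_prod hf
  refine continuous_of_dominated (bound := fun t => N * (‖pt t 1‖ ^ (n + 1))⁻¹)
    (fun x => Continuous.aestronglyMeasurable ?_)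
    (fun x => Filter.Eventually.of_forall fun t => abs_decayKernel_le hf hv _ t)
    (integrable_inv_norm_pt_pow.const_mul N) (Filter.Eventually.of_forall fun t => ?_)
  · refine Continuous.mul (Continuous.inv₀ (continuous_pt_one.norm.pow _) fun t => ?_) ?_
    · exact pow_ne_zero _ (norm_pt_one_pos t).ne'
    · exact hc.comp (f := fun t : Euc n => (tang x - height x • t, reflect (pt t 1) v))
        (Continuous.prodMk (by fun_prop) (continuous_reflect_pt v))
  · refine Continuous.mul continuous_const ?_
    exact hc.comp (f := fun x : Euc (n + 1) => (tang x - height x • t, reflect (pt t 1) v))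
      ((continuous_tang.sub (continuous_height.smul continuous_const)).prodMk continuous_const)

theorem continuousOn_dirichletExt (hn : 2 ≤ n) (hf : BoundaryData f N) {v : Euc (n + 1)}
    (hv : v ∈ ball (0 : Euc (n + 1)) 1) :
    ContinuousOn (fun x => dirichletExt f x v) (closedUpperHalf n) :=
  (continuous_const.mul (continuous_scaledPoisson hf hv)).continuousOn.congr
    fun _ hx => dirichletExt_eq_scaled hn f hx v

theorem exists_abs_evalAt_sphere_le (hf : BoundaryData f N) :
    ∃ C, ∀ t, ∀ u ∈ sphere (0 : Euc (n + 1)) 1, |evalAt u (f t)| ≤ C := by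
  -- The data are controlled only on the open ball, so the value at `u` is obtained from `u / 2` by
  -- homogeneity.
  refine ⟨2 ^ k * N, fun t u hu => ?_⟩
  have h1 : (2⁻¹ : ℝ) • u ∈ ball (0 : Euc (n + 1)) 1 := by
    rw [mem_sphere_zero_iff_norm] at hu
    simp [norm_smul, hu]
    norm_num
  have h2 := evalAt_smul (f t) 2 ((2⁻¹ : ℝ) • u)
  rw [smul_inv_smul₀ two_ne_zero] at h2
  rw [h2, abs_mul, abs_of_nonneg (by positivity)]
  exact mul_le_mul_of_nonneg_left (hf.bound _ h1 t) (by positivity)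

/-- Absolute convergence of the Poisson integral. -/
theorem integrable_poissonKernel (hf : BoundaryData f N) {x : Euc (n + 1)} (hx : x ∈ upperHalf n)
    (v : Euc (n + 1)) :
    Integrable (fun q : Euc n × USphere (n + 1) =>
      poissonKernel n k x q.1 (q.2 : Euc (n + 1)) v * evalAt (q.2 : Euc (n + 1)) (f q.1))
      (volume.prod (surf (n + 1))) := by
  obtain ⟨C, hC⟩ := exists_abs_evalAt_sphere_le hf
  obtain ⟨D, hD⟩ := (isCompact_sphere (0 : Euc (n + 1)) 1).exists_bound_of_continuousOn
    (continuous_evalAt (zonalPoly (n + 1) k v)).continuousOn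
  have hy : 0 < height x := hx
  have hdecay : HomNeg (n + 1) fun z : Euc (n + 1) => (‖z‖ ^ (n + 1))⁻¹ := by
    intro s hs z
    simp only [norm_smul, mul_pow, Real.norm_of_nonneg hs.le, mul_inv, smul_eq_mul]
  have hdc : ContinuousOn (fun z : Euc (n + 1) => (‖z‖ ^ (n + 1))⁻¹) {0}ᶜ :=
    ContinuousOn.inv₀ (by fun_prop) fun z hz => pow_ne_zero _ (norm_ne_zero_iff.2 hz)
  have hint : Integrable fun t : Euc n => (‖x - bdry t‖ ^ (n + 1))⁻¹ := by
    simpa using integrable_sub_bdry (a := fun _ => 1) (M := 1) le_rfl continuous_const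
      (by simp) hdc hdecay hx
  have hbase : Continuous fun q : Euc n × USphere (n + 1) => x - bdry q.1 :=
    continuous_const.sub (continuous_bdry.comp continuous_fst)
  have hu : Continuous fun q : Euc n × USphere (n + 1) => (q.2 : Euc (n + 1)) :=
    continuous_subtype_val.comp continuous_snd
  have hrefl : Continuous fun q : Euc n × USphere (n + 1) =>
      reflect (x - bdry q.1) (q.2 : Euc (n + 1)) := by
    unfold reflect
    refine hu.sub (Continuous.smul (Continuous.div ?_ (hbase.norm.pow 2) fun q => ?_) hbase)
    · exact continuous_const.mul (hu.inner hbase)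
    · exact pow_ne_zero _ (norm_ne_zero_iff.2 (sub_bdry_ne_zero hx _))
  have hcont : Continuous fun q : Euc n × USphere (n + 1) =>
      poissonKernel n k x q.1 (q.2 : Euc (n + 1)) v * evalAt (q.2 : Euc (n + 1)) (f q.1) := by
    refine Continuous.mul (Continuous.mul (continuous_const.mul (Continuous.div continuous_const
      (hbase.norm.pow _) fun q => ?_)) ?_) ?_
    · exact pow_ne_zero _ (norm_ne_zero_iff.2 (sub_bdry_ne_zero hx _))
    · exact (continuous_evalAt (zonalPoly (n + 1) k v)).comp hrefl
    · exact (continuous_evalAt_prod hf).comp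
        (f := fun q : Euc n × USphere (n + 1) => (q.1, (q.2 : Euc (n + 1))))
        (continuous_fst.prodMk hu)
  -- `D` bounds the zonal polynomial on the unit sphere, where the reflected argument stays, and `C`
  -- bounds the data there. Only the decay in `t` remains, and the sphere has finite measure.
  have hdom := (hint.mul_prod (integrable_const (1 : ℝ) (μ := surf (n + 1)))).const_mul
    (|poissonConst (n + 1) k| * height x * D * C)
  refine hdom.mono' hcont.aestronglyMeasurable (Filter.Eventually.of_forall fun q => ?_)
  have h1 := hC q.1 q.2 q.2.2
  have h2 := hD (reflect (x - bdry q.1) q.2) (by simp [norm_reflect])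
  have h3 : 0 ≤ |poissonConst (n + 1) k| * (height x / ‖x - bdry q.1‖ ^ (n + 1)) := by positivity
  rw [poissonKernel, Real.norm_eq_abs, abs_mul, abs_mul, abs_mul,
    abs_of_nonneg (a := height x / _) (by positivity)]
  calc _ ≤ |poissonConst (n + 1) k| * (height x / ‖x - bdry q.1‖ ^ (n + 1)) * D * C := by
        refine mul_le_mul (mul_le_mul_of_nonneg_left h2 h3) h1 (abs_nonneg _)
          (mul_nonneg h3 ((norm_nonneg _).trans h2))
    _ = _ := by
      rw [div_eq_mul_inv]
      ring

/-- Boundary data bounded in the sense of the essential supremum. -/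
theorem boundaryData_of_memLp
    (hc : ContinuousOn (fun q : Euc n × Euc (n + 1) => evalAt q.2 (f q.1)) (univ ×ˢ ball 0 1))
    (hm : MemLp (fun q : Euc n × Euc (n + 1) => evalAt q.2 (f q.1)) ∞
      (volume.restrict (univ ×ˢ ball 0 1))) :
    BoundaryData f (eLpNorm (fun q : Euc n × Euc (n + 1) => evalAt q.2 (f q.1)) ∞
      (volume.restrict (univ ×ˢ ball 0 1))).toReal where
  cont v hv := hc.comp_continuous (f := fun t : Euc n => (t, v)) (by fun_prop)
    fun t => ⟨mem_univ _, hv⟩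
  bound v hv t := by
    set g := fun q : Euc n × Euc (n + 1) => evalAt q.2 (f q.1) with hg
    set U : Set (Euc n × Euc (n + 1)) := univ ×ˢ ball 0 1 with hU
    set L := (eLpNorm g ∞ (volume.restrict U)).toReal with hL
    have hUo : IsOpen U := isOpen_univ.prod isOpen_ball
    have hae : ∀ᵐ q ∂volume.restrict U, |g q| ≤ L := by
      filter_upwards [ae_le_eLpNormEssSup (f := g) (μ := volume.restrict U)] with q hq
      rw [hL, eLpNorm_exponent_top, ← Real.norm_eq_abs, ← toReal_enorm]
      exact ENNReal.toReal_mono (by simpa using hm.2.ne) hq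
    by_contra! hlt
    -- By continuity the set where the essential bound fails is open; if nonempty it has positive
    -- measure, so the bound holds at every point of the ball.
    have hV : IsOpen (U ∩ (fun q => |g q|) ⁻¹' Ioi L) :=
      hc.abs.isOpen_inter_preimage hUo isOpen_Ioi
    have hpos : 0 < volume (U ∩ (fun q => |g q|) ⁻¹' Ioi L) :=
      hV.measure_pos volume ⟨(t, v), ⟨mem_univ _, hv⟩, hlt⟩
    refine hpos.ne' ?_
    rw [ae_restrict_iff' hUo.measurableSet] at hae
    refine measure_mono_null (fun q hq => ?_) hae
    exact fun h => not_le_of_gt hq.2 (h hq.1)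

end

end Bosonic

end

/-! ### The theorem. -/

theorem mainTheorem1 (n k : ℕ) (hn : 2 ≤ n) (hk : 1 ≤ k) :
    ∃ a : ℝ, 0 < a ∧ ∀ f : Bosonic.Euc n → Bosonic.harmonicPoly (n + 1) k,
      ContinuousOn (fun q : Bosonic.Euc n × Bosonic.Euc (n + 1) => Bosonic.evalAt q.2 (f q.1))
        (univ ×ˢ ball 0 1) →
      MemLp (fun q : Bosonic.Euc n × Bosonic.Euc (n + 1) => Bosonic.evalAt q.2 (f q.1)) ∞
        (volume.restrict (univ ×ˢ ball 0 1)) →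
      -- the Poisson integral converges
      (∀ x ∈ Bosonic.upperHalf n, ∀ v ∈ ball (0 : Bosonic.Euc (n + 1)) 1,
        Integrable (fun q : Bosonic.Euc n × Bosonic.USphere (n + 1) =>
          Bosonic.poissonKernel n k x q.1 (q.2 : Bosonic.Euc (n + 1)) v *
            Bosonic.evalAt (q.2 : Bosonic.Euc (n + 1)) (f q.1))
          (volume.prod (Bosonic.surf (n + 1)))) ∧
      -- continuity up to the boundary with respect to `x`
      (∀ v ∈ ball (0 : Bosonic.Euc (n + 1)) 1,
        ContinuousOn (fun x => Bosonic.dirichletExt f x v) (Bosonic.closedUpperHalf n)) ∧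
      -- the extension is smooth with values in harmonic polynomials over the open half-space
      ContDiffOn ℝ ∞
        (fun q : Bosonic.Euc (n + 1) × Bosonic.Euc (n + 1) => Bosonic.dirichletExt f q.1 q.2)
        (Bosonic.upperHalf n ×ˢ ball 0 1) ∧
      (∀ x ∈ Bosonic.upperHalf n, ∃ p : Bosonic.harmonicPoly (n + 1) k,
        ∀ v ∈ ball (0 : Bosonic.Euc (n + 1)) 1,
          Bosonic.dirichletExt f x v = Bosonic.evalAt v p) ∧
      -- it is a null solution of the bosonic Laplacian
      (∀ x ∈ Bosonic.upperHalf n, ∀ v ∈ ball (0 : Bosonic.Euc (n + 1)) 1,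
        Bosonic.bosonicLaplacian k (Bosonic.dirichletExt f) x v = 0) ∧
      -- the sup-norm estimate
      MemLp (fun q : Bosonic.Euc (n + 1) × Bosonic.Euc (n + 1) => Bosonic.dirichletExt f q.1 q.2) ∞
        (volume.restrict (Bosonic.upperHalf n ×ˢ ball 0 1)) ∧
      eLpNorm (fun q : Bosonic.Euc (n + 1) × Bosonic.Euc (n + 1) => Bosonic.dirichletExt f q.1 q.2)
          ∞ (volume.restrict (Bosonic.upperHalf n ×ˢ ball 0 1)) ≤
        ENNReal.ofReal a *
          eLpNorm (fun q : Bosonic.Euc n × Bosonic.Euc (n + 1) => Bosonic.evalAt q.2 (f q.1))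
            ∞ (volume.restrict (univ ×ˢ ball 0 1)) := by
  set I := ∫ t : Bosonic.Euc n, (‖Bosonic.pt t 1‖ ^ (n + 1))⁻¹ with hI
  have hI0 : 0 ≤ I := integral_nonneg fun t => by positivity
  -- `|c_{m,k}| * I` is the bound from the scaled formula; the `+ 1` only makes positivity of the
  -- constant immediate.
  refine ⟨|Bosonic.poissonConst (n + 1) k| * I + 1, by positivity, fun f hc hm => ?_⟩
  have hf := Bosonic.boundaryData_of_memLp hc hm
  have hext : ∀ x ∈ Bosonic.upperHalf n, Bosonic.dirichletExt f x = Bosonic.poissonIntegral f x :=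
    fun x hx => funext fun v => if_pos hx
  have hU : IsOpen (Bosonic.upperHalf n ×ˢ ball (0 : Bosonic.Euc (n + 1)) 1) :=
    Bosonic.isOpen_upperHalf.prod isOpen_ball
  have hsmooth : ContDiffOn ℝ ∞
      (fun q : Bosonic.Euc (n + 1) × Bosonic.Euc (n + 1) => Bosonic.dirichletExt f q.1 q.2)
      (Bosonic.upperHalf n ×ˢ ball 0 1) :=
    ((Bosonic.contDiffOn_poissonIntegral_prod hf).mono
      (prod_mono_right (subset_univ _))).congr fun q hq => congrFun (hext q.1 hq.1) q.2
  have hbound : eLpNorm (fun q : Bosonic.Euc (n + 1) × Bosonic.Euc (n + 1) =>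
      Bosonic.dirichletExt f q.1 q.2) ∞ (volume.restrict (Bosonic.upperHalf n ×ˢ ball 0 1)) ≤
        ENNReal.ofReal (|Bosonic.poissonConst (n + 1) k| * I + 1) *
          eLpNorm (fun q : Bosonic.Euc n × Bosonic.Euc (n + 1) => Bosonic.evalAt q.2 (f q.1))
            ∞ (volume.restrict (univ ×ˢ ball 0 1)) := by
    rw [← ENNReal.ofReal_toReal hm.2.ne, ← ENNReal.ofReal_mul (by positivity),
      eLpNorm_exponent_top]
    refine eLpNormEssSup_le_of_ae_bound ?_
    filter_upwards [ae_restrict_mem hU.measurableSet] with q hq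
    have hq1 : 0 < Bosonic.height q.1 := hq.1
    rw [Bosonic.dirichletExt_eq_scaled hn f hq1.le, norm_mul, Real.norm_eq_abs, Real.norm_eq_abs]
    refine (mul_le_mul_of_nonneg_left (Bosonic.abs_scaledPoisson_le hf q.1 hq.2)
      (abs_nonneg _)).trans ?_
    rw [add_mul, one_mul, mul_comm _ I, ← mul_assoc]
    exact le_add_of_nonneg_right ENNReal.toReal_nonneg
  refine ⟨fun x hx v _ => Bosonic.integrable_poissonKernel hf hx v,
    fun v hv => Bosonic.continuousOn_dirichletExt hn hf hv, hsmooth, fun x hx => ?_,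
    fun x hx v _ => ?_, ⟨hsmooth.continuousOn.aestronglyMeasurable hU.measurableSet, ?_⟩, hbound⟩
  · obtain ⟨S, e, -, he⟩ := Bosonic.exists_interpolation (n + 1) k
    -- The polynomial in `v` is the interpolant of the values of the Poisson integral at the nodes.
    refine ⟨∑ w ∈ S, Bosonic.poissonIntegral f x w • e w, fun v _ => ?_⟩
    rw [hext x hx, Bosonic.poissonIntegral_eq_sepFun hf he hx]
    simp
  · rw [Bosonic.bosonicLaplacian_congr Bosonic.isOpen_upperHalf hext hx]
    exact Bosonic.bosonicLaplacian_poissonIntegral hn hk hf hx v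
  · exact hbound.trans_lt (ENNReal.mul_lt_top ENNReal.ofReal_lt_top hm.2)
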